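/- **Setting.** Let $(\mathcal H,\langle\cdot,\cdot\rangle)$ be a separable complex Hilbert space (inner product antilinear in the first argument), and let $E$ be $\mathcal H$ regarded as a real space with scalar product $\mathrm{Re}\langle\cdot,\cdot\rangle$ and symplectic form $\sigma=\mathrm{Im}\langle\cdot,\cdot\rangle$. Let $H>0$ be a self-adjoint operator on $\mathcal H$ and $s>0$ such that $H^{-s}$ is a (bounded) trace class operator. Let $\beta>0$. *Weyl algebra and weak KMS states.* $\mathcal W(E,0)$ is the sup-norm closure of the linear span $\Delta(E,0)$ of the functions $W^0(f)[g]=e^{i\mathrm{Re}\langle f,g\rangle}$ ($f\in E$) on $E$; the Poisson bracket on $\Delta(E,0)$ is the bilinear extension of $\{W^0(f),W^0(g)\}=\sigma(g,f)W^0(f+g)$. Put $\Phi_0(f)[g]=\mathrm{Re}\langle f,g\rangle$, and let $\delta_0(W^0(f))=i\Phi_0(iHf)W^0(f)$ on $D(\delta_0)=\mathrm{span}\{W^0(f):f\in D(H)\}$. A state $\omega_0$ on $\mathcal W(E,0)$ with GNS triple $(\mathcal H_0,\pi_0,\Omega_0)$ is $C^2$ if all groups $t\mapsto\pi_0(W^0(tf))$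 are strongly continuous and $\Omega_0$ is in the domain of all their generators $\Phi_{\omega_0}(f)$; then $\omega_0(\Phi_0(h)W^0(k)):=\langle\Omega_0,\Phi_{\omega_0}(h)\pi_0(W^0(k))\Omega_0\rangle$. A $C^2$ state is a $(\delta_0,\beta)$-weak KMS state if $\omega_0(\{a,b\})=\beta\,\omega_0(b\,\delta_0(a))$ for all $a,b\in D(\delta_0)$. *KMS measures.* $\mathcal H^{s}=D(H^{s/2})$ has norm $\|H^{s/2}f\|$, and $\mathcal H^{-s}$ is the completion of $E$ for the norm $\|H^{-s/2}f\|$; the duality $\langle f,u\rangle$ ($f\in\mathcal H^s$, $u\in\mathcal H^{-s}$) extends $\mathrm{Re}\langle f,u\rangle$, $u\in E$, by continuity; $\hat\mu(f)=\int e^{i\langle f,u\rangle}d\mu(u)$ for $f\in\mathcal H^s$. Fix an orthonormal basis $(e_k)_{1\le k\le N}$ (if $N=\dim\mathcal H<\infty$) or $(e_k)_{k\ge1}$ (if $N=\infty$) of $\mathcal H$ of eigenvectors of $H$, and let $f_k=ie_k$. Smooth compactly supported cylindrical functions are the functions $F(u)=\varphi(\langle e_1,u\rangle,\dots,\langle e_n,u\rangle,\langle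 f_1,u\rangle,\dots,\langle f_n,u\rangle)$ with finite $n\le N$ and $\varphi\in C_c^\infty(\mathbb R^{2n})$; $\nabla F(u)=\sum_{j\le n}(\partial_j\varphi)e_j+(\partial_{n+j}\varphi)f_j$ and $\{F,G\}(u)=\sigma(\nabla F(u),\nabla G(u))$. Let $X(u)=-iHu$ in the distributional sense, $\langle f,X(u)\rangle:=\langle iHf,u\rangle$ for $f\in\mathcal H^s\cap D(H)$ with $Hf\in\mathcal H^s$. A Borel probability measure $\mu$ on $\mathcal H^{-s}$ is a $(\beta,X)$-KMS state if $\langle f,X(\cdot)\rangle$ is $\mu$-integrable for all such $f$ and $$\int\{F,G\}(u)\,d\mu(u)=\beta\int\langle\nabla F(u),X(u)\rangle\,G(u)\,d\mu(u)$$ for all smooth compactly supported cylindrical functions $F,G$. **Theorem.** An orthonormal basis of eigenvectors of $H$, indexed as above, exists, and for every choice of it the following hold. 1. If $\omega_0$ is a $(\delta_0,\beta)$-weak KMS state on $\mathcal W(E,0)$, then there is a Borel probability measure $\mu_0$ on $\mathcal H^{-s}$ that is a $(\beta,X)$-KMS state and satisfies $\hat\mu_0(f)=\omega_0(W^0(f))$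 for all $f\in\mathcal H^s\cap D(H)$ (which is all of $\mathcal H^s$ if $s\ge2$); if moreover $f\mapsto\omega_0(W^0(f))$ is continuous on $\mathcal H^s$ for the norm of $\mathcal H^s$ (in particular, if it is norm continuous on $E$), then $\hat\mu_0(f)=\omega_0(W^0(f))$ for all $f\in\mathcal H^s$. 2. Conversely, let $\mu_0$ be a Borel probability measure on $\mathcal H^{-s}$ that is a $(\beta,X)$-KMS state. Then there is exactly one state $\omega_0$ on $\mathcal W(E,0)$ such that $\omega_0(W^0(f))=\hat\mu_0(f)$ for all $f\in\mathcal H^s$ and $f\mapsto\omega_0(W^0(f))$ is norm continuous on $E$, and it is a $(\delta_0,\beta)$-weak KMS state. -/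

import Mathlib

open Complex MeasureTheory
open scoped InnerProductSpace ComplexOrder

noncomputable section

variable {ℋ : Type*} [NormedAddCommGroup ℋ] [InnerProductSpace ℂ ℋ]

/-! ### The commutative Weyl algebra

The real symplectic space `E` is the complex Hilbert space `ℋ`, regarded as a real space with the
scalar product `Re ⟪f, g⟫` and the symplectic form `Im ⟪f, g⟫`
(the inner product is antilinear in its first argument). -/

/-- The symplectic form `σ(f, g) = Im ⟪f, g⟫`. -/
def symplForm (f g : ℋ) : ℝ := (⟪f, g⟫_ℂ).im

/-- The Weyl element `W(f)`, as the bounded continuous function `g ↦ exp (i Re ⟪f, g⟫)` on `E`. -/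
def weylFun (f : ℋ) : BoundedContinuousFunction ℋ ℂ :=
  BoundedContinuousFunction.ofNormedAddCommGroup
    (fun g : ℋ => Complex.exp ((((⟪f, g⟫_ℂ).re : ℝ) : ℂ) * Complex.I)) (by fun_prop) 1
    (fun g => (Complex.norm_exp_ofReal_mul_I _).le)

variable (ℋ) in
/-- The commutative Weyl C⋆-algebra `𝒲(E, 0)`: the sup-norm closure of the ⋆-algebra generated by
the Weyl elements (the algebra of almost periodic functions on `E`). -/
def weylSubalgebra : StarSubalgebra ℂ (BoundedContinuousFunction ℋ ℂ) :=
  (StarAlgebra.adjoin ℂ (Set.range (weylFun : ℋ → BoundedContinuousFunction ℋ ℂ))).topologicalClosure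

instance weylSubalgebra_isClosed :
    IsClosed (weylSubalgebra ℋ : Set (BoundedContinuousFunction ℋ ℂ)) :=
  StarSubalgebra.isClosed_topologicalClosure _

variable (ℋ) in
/-- `𝒲(E, 0)` as a type. -/
abbrev WeylAlg : Type _ := weylSubalgebra ℋ

/-- The usual order of a C⋆-algebra (`0 ≤ a` iff `a = b⋆ b` for some `b`). -/
instance weylAlgPartialOrder : PartialOrder (WeylAlg ℋ) := CStarAlgebra.spectralOrder _

instance weylAlgStarOrderedRing : StarOrderedRing (WeylAlg ℋ) := CStarAlgebra.spectralOrderedRing _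

/-- The Weyl element `W(f)` in `𝒲(E, 0)`. -/
def weyl (f : ℋ) : WeylAlg ℋ :=
  ⟨weylFun f, StarSubalgebra.le_topologicalClosure _ (StarAlgebra.subset_adjoin ℂ _ ⟨f, rfl⟩)⟩

/-- The linear span `Δ(E, 0)` of the (linearly independent) Weyl elements is represented by
finitely supported families of coefficients; `weylSum a = ∑ f, a f • W(f)`. -/
def weylSum (a : ℋ →₀ ℂ) : WeylAlg ℋ := a.sum fun f c => c • weyl f

/-- The Poisson bracket on `Δ(E, 0)`: the bilinear extension of
`{W(f), W(g)} = σ(g, f) W(f + g)`. -/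
def weylBracket (a b : ℋ →₀ ℂ) : ℋ →₀ ℂ :=
  a.sum fun f c => b.sum fun g d => Finsupp.single (f + g) (c * d * (symplForm g f : ℂ))

/-- The GNS vector `Ω` of a positive functional. -/
def gnsVec (ω : WeylAlg ℋ →ₚ[ℂ] ℂ) : ω.GNS :=
  ((ω.toPreGNS 1 : ω.PreGNS) : UniformSpace.Completion ω.PreGNS)

/-- The represented Weyl group `t ↦ π(W(t f)) x` in the GNS space. Its generator
`Φ_ω(f) x = -i (d/dt) π(W(t f)) x |_{t = 0}` has as domain the vectors at which this orbit is
differentiable at `0`. -/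
def gnsOrbit (ω : WeylAlg ℋ →ₚ[ℂ] ℂ) (f : ℋ) (x : ω.GNS) (t : ℝ) : ω.GNS :=
  ω.gnsStarAlgHom (weyl ((t : ℂ) • f)) x

/-- `C²` regularity: the GNS representation is regular (the groups `t ↦ π(W(t f))` are strongly
continuous), and `Ω` is in the domain of all generators `Φ_ω(f)`. -/
def IsC2 (ω : WeylAlg ℋ →ₚ[ℂ] ℂ) : Prop :=
  (∀ (f : ℋ) (x : ω.GNS), Continuous (gnsOrbit ω f x)) ∧
  ∀ f : ℋ, DifferentiableAt ℝ (gnsOrbit ω f (gnsVec ω)) 0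

/-- The expectation `ω(Φ(h) W(k)) = ⟪Ω, Φ_ω(h) π(W(k)) Ω⟫`, where `Φ(h)` is the field function
`g ↦ Re ⟪h, g⟫`. -/
def expField (ω : WeylAlg ℋ →ₚ[ℂ] ℂ) (h k : ℋ) : ℂ :=
  ⟪gnsVec ω, (-Complex.I) • deriv (gnsOrbit ω h (ω.gnsStarAlgHom (weyl k) (gnsVec ω))) 0⟫_ℂ

/-- The expectation `ω(b δ(a))` for the weak derivation `δ(W(f)) = i Φ(i H f) W(f)`, whose domain
is the span of the `W(f)` with `f ∈ D(H)`: the bilinear extension of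
`ω(W(g) δ(W(f))) = i ω(Φ(i H f) W(f + g))`. -/
def expMulDeriv (H : ℋ →ₗ.[ℂ] ℋ) (ω : WeylAlg ℋ →ₚ[ℂ] ℂ) (b a : H.domain →₀ ℂ) : ℂ :=
  a.sum fun f c => b.sum fun g d =>
    c * d * (Complex.I * expField ω (Complex.I • H f) ((f : ℋ) + (g : ℋ)))

/-- The weak `(δ, β)`-KMS condition: `ω` is a `C²` state on `𝒲(E, 0)` and
`ω({a, b}) = β ω(b δ(a))` for all `a, b` in the domain of `δ`. -/
def IsWeakKMS (H : ℋ →ₗ.[ℂ] ℋ) (β : ℝ) (ω : WeylAlg ℋ →ₚ[ℂ] ℂ) : Prop :=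
  ω 1 = 1 ∧ IsC2 ω ∧ ∀ a b : H.domain →₀ ℂ,
    ω (weylSum (weylBracket (a.mapDomain Subtype.val) (b.mapDomain Subtype.val))) =
      (β : ℂ) * expMulDeriv H ω b a

/-! ### Negative powers of `H` and Sobolev spaces -/

/-- `H > 0`. -/
def IsStrictlyPos (H : ℋ →ₗ.[ℂ] ℋ) : Prop :=
  ∀ f : H.domain, (f : ℋ) ≠ 0 → 0 < (⟪(f : ℋ), H f⟫_ℂ).re

/-- `T` is an everywhere defined bounded inverse of `H`. -/
def IsBoundedInverse (H : ℋ →ₗ.[ℂ] ℋ) (T : ℋ →L[ℂ] ℋ) : Prop :=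
  ∀ f g : ℋ, (f, g) ∈ H.graph ↔ T g = f

open Classical in
/-- The bounded operator `H⁻¹` (with value `0` if there is none). -/
def boundedInv (H : ℋ →ₗ.[ℂ] ℋ) : ℋ →L[ℂ] ℋ :=
  if h : ∃ T, IsBoundedInverse H T then h.choose else 0

variable [CompleteSpace ℋ]

/-- `H ^ (-r) = (H⁻¹) ^ r` for `r > 0`, by continuous functional calculus. -/
def negPow (H : ℋ →ₗ.[ℂ] ℋ) (r : ℝ) : ℋ →L[ℂ] ℋ := boundedInv H ^ r

/-- Trace class operators: `∑ ⟪b i, |A| b i⟫ < ∞` for an orthonormal basis `b`. -/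
def IsTraceClass (A : ℋ →L[ℂ] ℋ) : Prop :=
  ∃ (w : Set ℋ) (b : HilbertBasis w ℂ ℋ), Summable fun i => (⟪b i, CFC.abs A (b i)⟫_ℂ).re

/-- `H ^ (-s)` is a (bounded) trace class operator. -/
def NegPowTraceClass (H : ℋ →ₗ.[ℂ] ℋ) (s : ℝ) : Prop :=
  (∃ T, IsBoundedInverse H T) ∧ IsTraceClass (negPow H s)

/-- The Sobolev space `ℋ^s = D(H ^ (s/2))`, that is, the range of `H ^ (-s/2)`; its norm is
`‖H ^ (-s/2) g‖_s = ‖g‖`. -/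
def sobolev (H : ℋ →ₗ.[ℂ] ℋ) (s : ℝ) : Submodule ℂ ℋ :=
  LinearMap.range (negPow H (s / 2) : ℋ →ₗ[ℂ] ℋ)

/-- Continuity of a function on `ℋ^s` for the norm of `ℋ^s`. -/
def SobolevContinuous (H : ℋ →ₗ.[ℂ] ℋ) (s : ℝ) (θ : ℋ → ℂ) : Prop :=
  Continuous fun g : ℋ => θ (negPow H (s / 2) g)

set_option linter.unusedVariables false in
/-- A copy of `ℋ`, to carry the norm `‖f‖_{-s} = ‖H ^ (-s/2) f‖`. -/
def PreNegSobolev (H : ℋ →ₗ.[ℂ] ℋ) (s : ℝ) : Type _ := ℋ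

instance (H : ℋ →ₗ.[ℂ] ℋ) (s : ℝ) : AddCommGroup (PreNegSobolev H s) :=
  inferInstanceAs (AddCommGroup ℋ)

instance (H : ℋ →ₗ.[ℂ] ℋ) (s : ℝ) : Module ℂ (PreNegSobolev H s) :=
  inferInstanceAs (Module ℂ ℋ)

/-- The identity map to `ℋ`. -/
def PreNegSobolev.val (H : ℋ →ₗ.[ℂ] ℋ) (s : ℝ) : PreNegSobolev H s →ₗ[ℂ] ℋ :=
  (LinearMap.id : ℋ →ₗ[ℂ] ℋ)

instance (H : ℋ →ₗ.[ℂ] ℋ) (s : ℝ) : SeminormedAddCommGroup (PreNegSobolev H s) :=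
  SeminormedAddCommGroup.induced (PreNegSobolev H s) ℋ
    ((negPow H (s / 2) : ℋ →ₗ[ℂ] ℋ) ∘ₗ PreNegSobolev.val H s)

/-- The space `ℋ^{-s}`: the completion of `E` for the norm `‖f‖_{-s} = ‖H ^ (-s/2) f‖`. -/
abbrev NegSobolev (H : ℋ →ₗ.[ℂ] ℋ) (s : ℝ) : Type _ := UniformSpace.Completion (PreNegSobolev H s)

instance (H : ℋ →ₗ.[ℂ] ℋ) (s : ℝ) : MeasurableSpace (NegSobolev H s) := borel _

instance (H : ℋ →ₗ.[ℂ] ℋ) (s : ℝ) : BorelSpace (NegSobolev H s) := ⟨rfl⟩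

/-- The canonical duality `⟨f, u⟩` of `f ∈ ℋ^s` and `u ∈ ℋ^{-s}`: the continuous extension
of `v ↦ Re ⟪f, v⟫` from `E` to `ℋ^{-s}`. -/
def pairing (H : ℋ →ₗ.[ℂ] ℋ) (s : ℝ) (f : ℋ) : NegSobolev H s → ℝ :=
  UniformSpace.Completion.extension fun v : PreNegSobolev H s => (⟪f, PreNegSobolev.val H s v⟫_ℂ).re

/-- The Fourier transform of a measure on `ℋ^{-s}`. -/
def fourierMeas (H : ℋ →ₗ.[ℂ] ℋ) (s : ℝ) (μ : Measure (NegSobolev H s)) (f : ℋ) : ℂ :=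
  ∫ u, Complex.exp ((pairing H s f u : ℂ) * Complex.I) ∂μ

/-! ### The KMS condition for measures -/

/-- An orthonormal basis of `ℋ` that consists of eigenvectors of `H`, indexed by `k < N`,
where `N ∈ ℕ ∪ {∞}` is the dimension. -/
structure EigenBasis (H : ℋ →ₗ.[ℂ] ℋ) where
  N : ℕ∞
  basis : HilbertBasis {k : ℕ // (k : ℕ∞) < N} ℂ ℋ
  eigen : ∀ k, ∃ l : ℝ, (basis k, (l : ℂ) • basis k) ∈ H.graph

/-- The basis vector `e_k`, for `k < N` (and `0` for other `k`). -/
def EigenBasis.e {H : ℋ →ₗ.[ℂ] ℋ} (B : EigenBasis H) (k : ℕ) : ℋ :=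
  if h : (k : ℕ∞) < B.N then B.basis ⟨k, h⟩ else 0

/-- A function in `C_c^∞(ℝ^{2n})`, with `n` at most the dimension. -/
structure CylTest (N : ℕ∞) where
  n : ℕ
  hn : (n : ℕ∞) ≤ N
  φ : (Fin n → ℝ) × (Fin n → ℝ) → ℝ
  smooth : ContDiff ℝ (⊤ : ℕ∞) φ
  compact : HasCompactSupport φ

section Cylinder

variable {H : ℋ →ₗ.[ℂ] ℋ} (B : EigenBasis H) (s : ℝ)

/-- `π_n(u)`, with coordinates `⟨e_k, u⟩` and `⟨f_k, u⟩`, where `f_k = i e_k`. -/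
def cylProj (n : ℕ) (u : NegSobolev H s) : (Fin n → ℝ) × (Fin n → ℝ) :=
  (fun k => pairing H s (B.e k) u, fun k => pairing H s (Complex.I • B.e k) u)

/-- The smooth cylindrical function `F(u) = φ(π_n(u))`. -/
def cylFun (F : CylTest B.N) (u : NegSobolev H s) : ℝ := F.φ (cylProj B s F.n u)

/-- Its gradient `∇F(u) = ∑ k, ∂¹_k φ(π_n(u)) e_k + ∂²_k φ(π_n(u)) f_k`. -/
def cylGrad (F : CylTest B.N) (u : NegSobolev H s) : ℋ :=
  ∑ k : Fin F.n,
    (((fderiv ℝ F.φ (cylProj B s F.n u) (Pi.single k 1, 0) : ℝ) : ℂ) • B.e k +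
      ((fderiv ℝ F.φ (cylProj B s F.n u) (0, Pi.single k 1) : ℝ) : ℂ) • (Complex.I • B.e k))

end Cylinder

open Classical in
/-- `⟨f, X(u)⟩` for the vector field `X(u) = -i H u`, understood in the distributional sense:
`⟨f, X(u)⟩ = ⟨i H f, u⟩`, for `f ∈ D(H)` such that `H f ∈ ℋ^s`. -/
def pairingX (H : ℋ →ₗ.[ℂ] ℋ) (s : ℝ) (f : ℋ) (u : NegSobolev H s) : ℝ :=
  if h : f ∈ H.domain then pairing H s (Complex.I • H ⟨f, h⟩) u else 0

/-- The KMS condition for a measure on `ℋ^{-s}`, at inverse temperature `β`, for the vector field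
`X(u) = -i H u`. -/
def IsKMSMeasure {H : ℋ →ₗ.[ℂ] ℋ} (B : EigenBasis H) (s β : ℝ) (μ : Measure (NegSobolev H s)) :
    Prop :=
  (∀ f : H.domain, (f : ℋ) ∈ sobolev H s → H f ∈ sobolev H s →
    Integrable (fun u => pairingX H s (f : ℋ) u) μ) ∧
  ∀ F G : CylTest B.N,
    ∫ u, symplForm (cylGrad B s F u) (cylGrad B s G u) ∂μ =
      β * ∫ u, pairingX H s (cylGrad B s F u) u * cylFun B s G u ∂μ

/-- `ω` is a state on `𝒲(E, 0)` that extends `W(f) ↦ θ(f)`, `f ∈ ℋ^s`, by continuity to `E`, and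
by linearity and continuity to `𝒲(E, 0)`. -/
def IsExtendedState (H : ℋ →ₗ.[ℂ] ℋ) (s : ℝ) (θ : ℋ → ℂ) (ω : WeylAlg ℋ →ₚ[ℂ] ℂ) : Prop :=
  ω 1 = 1 ∧ (∀ f ∈ sobolev H s, ω (weyl f) = θ f) ∧ Continuous fun f : ℋ => ω (weyl f)

end

noncomputable section

set_option linter.unusedSectionVars false

variable {ℋ : Type*} [NormedAddCommGroup ℋ] [InnerProductSpace ℂ ℋ]

/-! ### Operators: functional calculus on eigenvectors, Hilbert–Schmidt operators -/

section Operators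

open Filter Topology

variable [CompleteSpace ℋ]

/-! Both KMS conditions are first order differential identities whose only normalised solution is
the Gaussian `θ(f) = exp (-Re ⟪f, H⁻¹ f⟫ / (2β))`. The correspondence between states and measures
therefore needs no abstract extension argument: each side is computed to be this Gaussian, and
conversely the Gaussian is shown to exist and to satisfy the condition on each side.

For a weak KMS state, testing with `W(f)` and `W(k - f)` gives `d/dt ω(W(k + t iHf)) = β⁻¹ σ(k, f)
ω(W(k))` at `t = 0`. With `f = H⁻¹(-ih)` and `k = t h` this is `D' = -c t D` along the ray through
`h`, where `c = Re ⟪h, H⁻¹ h⟫ / β`, so `ω(W(h)) = θ(h)` on `D(H)` (`IsWeakKMS.apply_weyl`). For a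
KMS measure, taking `F` linear near the support of `G` turns the condition into `∫ ∂_{H⁻¹a} G = β ∫
⟨a, u⟩ G`. Tested with sines and cosines, this gives the same equation for the characteristic
function; continuity then passes from cylindrical vectors to `ℋ^s` (`fourierMeas_of_isKMSMeasure`).

Existence: since `H^{-s}` is trace class, `H` has an eigenbasis with `H⁻¹ e_k = τ_k e_k` and `∑
τ_k^s < ∞`. Independent coordinates `⟨e_k, u⟩`, `⟨f_k, u⟩` of variance `τ_k / β` then define a
random `u` with `H^{-s/2} u ∈ ℋ` almost surely. One-dimensional Gaussian integration by parts and
the symmetry of second derivatives give the KMS condition (`isKMSMeasure_gaussMeasure`). The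
Gaussian state is a limit of averages of Weyl functions over finite-dimensional truncations of `u`
(`exists_gaussian_state`). It is `C²` because the orbits of `Ω` have a Gaussian Gram kernel, and
weak KMS by differentiating `θ` (`isWeakKMS_of_gaussian`). -/

lemma mem_spectrum_of_eigenvector {a : ℋ →L[ℂ] ℋ} {μ : ℝ} {e : ℋ} (he : e ≠ 0)
    (h : a e = (μ : ℂ) • e) : μ ∈ spectrum ℝ a := by
  intro hu
  obtain ⟨u, hu⟩ := hu
  apply he
  have h0 : (u : ℋ →L[ℂ] ℋ) e = 0 := by
    rw [hu]
    simp [h, Algebra.algebraMap_eq_smul_one]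
  have h1 : ((↑u⁻¹ : ℋ →L[ℂ] ℋ) * (u : ℋ →L[ℂ] ℋ)) e = e := by simp
  rw [← h1, mul_apply_eq_comp, h0, map_zero]

/-- The continuous functional calculus acts on eigenvectors through the eigenvalue. -/
lemma cfcHom_apply_eigenvector {a : ℋ →L[ℂ] ℋ} (ha : IsSelfAdjoint a) {μ : ℝ} {e : ℋ}
    (hμ : μ ∈ spectrum ℝ a) (h : a e = (μ : ℂ) • e) (f : C(spectrum ℝ a, ℝ)) :
    cfcHom ha f e = ((f ⟨μ, hμ⟩ : ℝ) : ℂ) • e := by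
  have : CompactSpace (spectrum ℝ a) := isCompact_iff_compactSpace.mp (spectrum.isCompact a)
  induction f using ContinuousMap.induction_on_of_compact with
  | const r =>
    have : (ContinuousMap.const (spectrum ℝ a) r) = algebraMap ℝ C(spectrum ℝ a, ℝ) r := rfl
    rw [this, AlgHomClass.commutes]
    simp [Algebra.algebraMap_eq_smul_one]
  | id => rw [cfcHom_id, h]; rfl
  | star_id => simp only [map_star, cfcHom_id, ha.star_eq, h]; simp
  | add f g hf hg => simp [map_add, hf, hg, add_smul]
  | mul f g hf hg =>
    simp only [map_mul, mul_apply_eq_comp, hf, hg, map_smul, smul_smul,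
      ContinuousMap.mul_apply, ofReal_mul]
    rw [mul_comm]
  | frequently f hf =>
    have hc : IsClosed {g : C(spectrum ℝ a, ℝ) |
        cfcHom ha g e = ((g ⟨μ, hμ⟩ : ℝ) : ℂ) • e} := by
      refine isClosed_eq ?_ ?_
      · exact (ContinuousLinearMap.apply ℂ ℋ e).continuous.comp (cfcHom_continuous ha)
      · exact (continuous_ofReal.comp (continuous_eval_const _)).smul
          continuous_const
    exact hc.mem_of_frequently_of_tendsto hf tendsto_id

lemma rpow_apply_eigenvector {a : ℋ →L[ℂ] ℋ} (ha : 0 ≤ a) {μ : ℝ} {e : ℋ}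
    (h : a e = (μ : ℂ) • e) {r : ℝ} (hr : 0 < r) :
    (a ^ r) e = ((μ ^ r : ℝ) : ℂ) • e := by
  rcases eq_or_ne e 0 with rfl | he
  · simp
  have hsa : IsSelfAdjoint a := IsSelfAdjoint.of_nonneg ha
  rw [CFC.rpow_eq_cfc_real ha, cfc_apply (fun x : ℝ => x ^ r) a hsa
    (fun x _ => (Real.continuousAt_rpow_const x r (Or.inr hr.le)).continuousWithinAt),
    cfcHom_apply_eigenvector hsa (mem_spectrum_of_eigenvector he h) h]
  rfl

lemma HilbertBasis.hasSum_norm_inner_sq {ι : Type*} (b : HilbertBasis ι ℂ ℋ) (x : ℋ) :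
    HasSum (fun i => ‖⟪b i, x⟫_ℂ‖ ^ 2) (‖x‖ ^ 2) := by
  have h := b.hasSum_inner_mul_inner x x
  have h2 := Complex.hasSum_re h
  convert h2 using 1
  · ext i
    rw [← inner_conj_symm x, ← Complex.normSq_eq_conj_mul_self, Complex.ofReal_re,
      Complex.normSq_eq_norm_sq]
  · exact (inner_self_eq_norm_sq (𝕜 := ℂ) x).symm

/-- A self-adjoint Hilbert–Schmidt operator is compact. -/
lemma isCompactOperator_of_summable {ι : Type*} (b : HilbertBasis ι ℂ ℋ) {S : ℋ →L[ℂ] ℋ}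
    (hS : S.IsSymmetric) (hsum : Summable fun i => ‖S (b i)‖ ^ 2) : IsCompactOperator S := by
  classical
  let P : Finset ι → ℋ →L[ℂ] ℋ := fun F => ∑ i ∈ F, (innerSL ℂ (b i)).smulRight (b i)
  have hP (F : Finset ι) (y : ℋ) (i : ι) :
      ⟪b i, P F y⟫_ℂ = if i ∈ F then ⟪b i, y⟫_ℂ else 0 := by
    have := orthonormal_iff_ite.mp b.orthonormal
    simp [P, this]
  have hPc (F : Finset ι) : IsCompactOperator (P F ∘L S) := by
    have h1 : IsCompactOperator (P F) := by
      have : ∀ F : Finset ι, P F ∈ compactOperator (RingHom.id ℂ) ℋ ℋ := by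
        intro F
        refine Submodule.sum_mem _ fun i _ => ?_
        change IsCompactOperator ((innerSL ℂ (b i)).smulRight (b i))
        have hid : IsCompactOperator (innerSL ℂ (b i)) := by
          refine (isCompactOperator_iff_exists_mem_nhds_isCompact_closure_image _).2
            ⟨Metric.ball 0 1, Metric.ball_mem_nhds _ one_pos, ?_⟩
          exact ((Metric.isBounded_ball).image (innerSL ℂ (b i))).isCompact_closure
        exact hid.clm_comp ((ContinuousLinearMap.id ℂ ℂ).smulRight (b i))
      exact this F
    exact h1.comp_clm S
  -- By Parseval and symmetry, `‖(P F - 1) S x‖²` is the sum of `|⟪S (b i), x⟫|²` over `i ∉ F`, so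
  -- the finite rank operators `P F ∘L S` converge to `S` in norm.
  have hbound (F : Finset ι) :
      ‖P F ∘L S - S‖ ≤ √(∑' i : {i // i ∉ F}, ‖S (b i)‖ ^ 2) := by
    refine ContinuousLinearMap.opNorm_le_bound _ (Real.sqrt_nonneg _) fun x => ?_
    rw [← Real.sqrt_sq (norm_nonneg x), ← Real.sqrt_mul (tsum_nonneg fun _ => sq_nonneg _)]
    refine Real.le_sqrt_of_sq_le ?_
    have h1 := b.hasSum_norm_inner_sq ((P F ∘L S - S) x)
    rw [← h1.tsum_eq, ← tsum_mul_right]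
    have h2 : ∀ i, ‖⟪b i, (P F ∘L S - S) x⟫_ℂ‖ ^ 2 ≤
        {i | i ∉ F}.indicator (fun i => ‖S (b i)‖ ^ 2 * ‖x‖ ^ 2) i := by
      intro i
      by_cases hi : i ∈ F
      · simp [hP, hi]
      · have : ⟪b i, S x⟫_ℂ = ⟪S (b i), x⟫_ℂ := (hS (b i) x).symm
        simp only [sub_apply, ContinuousLinearMap.comp_apply,
          inner_sub_right, hP, hi, if_false, zero_sub, norm_neg, this, Set.mem_ofPred_eq,
          not_false_eq_true, Set.indicator_of_mem, ← mul_pow]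
        gcongr
        exact norm_inner_le_norm _ _
    have hs' : Summable ({i | i ∉ F}.indicator (fun i => ‖S (b i)‖ ^ 2 * ‖x‖ ^ 2)) :=
      (hsum.mul_right _).indicator _
    refine (h1.summable.tsum_le_tsum h2 hs').trans (le_of_eq ?_)
    rw [← tsum_subtype]
    rfl
  refine isCompactOperator_of_tendsto (l := atTop) (F := fun F => P F ∘L S) ?_
    (Eventually.of_forall hPc)
  rw [tendsto_iff_norm_sub_tendsto_zero]
  refine squeeze_zero (fun _ => norm_nonneg _) hbound ?_
  have := (tendsto_tsum_compl_atTop_zero fun i => ‖S (b i)‖ ^ 2)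
  simpa using this.sqrt

/-- The Hilbert–Schmidt property does not depend on the basis. -/
lemma summable_norm_sq_basis_change {ι κ : Type*} (b : HilbertBasis ι ℂ ℋ)
    (c : HilbertBasis κ ℂ ℋ) {S : ℋ →L[ℂ] ℋ} (hS : S.IsSymmetric)
    (hsum : Summable fun i => ‖S (b i)‖ ^ 2) : Summable fun k => ‖S (c k)‖ ^ 2 := by
  have h1 (k : κ) : ENNReal.ofReal (‖S (c k)‖ ^ 2) =
      ∑' i, ENNReal.ofReal (‖⟪b i, S (c k)⟫_ℂ‖ ^ 2) := by
    rw [← (b.hasSum_norm_inner_sq (S (c k))).tsum_eq]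
    exact ENNReal.ofReal_tsum_of_nonneg (fun _ => sq_nonneg _)
      (b.hasSum_norm_inner_sq _).summable
  have h2 (i : ι) : ENNReal.ofReal (‖S (b i)‖ ^ 2) =
      ∑' k, ENNReal.ofReal (‖⟪c k, S (b i)⟫_ℂ‖ ^ 2) := by
    rw [← (c.hasSum_norm_inner_sq (S (b i))).tsum_eq]
    exact ENNReal.ofReal_tsum_of_nonneg (fun _ => sq_nonneg _)
      (c.hasSum_norm_inner_sq _).summable
  -- Both sides are the double sum of `|⟪b i, S (c k)⟫|²`; Tonelli in `ENNReal` exchanges the order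
  -- before any summability is known.
  have h3 : ∑' k, ENNReal.ofReal (‖S (c k)‖ ^ 2) = ∑' i, ENNReal.ofReal (‖S (b i)‖ ^ 2) := by
    simp_rw [h1, h2]
    rw [ENNReal.tsum_comm]
    refine tsum_congr fun i => tsum_congr fun k => ?_
    rw [norm_inner_symm, show ⟪S (c k), b i⟫_ℂ = ⟪c k, S (b i)⟫_ℂ from hS (c k) (b i)]
  have h4 : ∑' k, ENNReal.ofReal (‖S (c k)‖ ^ 2) ≠ ⊤ := by
    rw [h3]
    exact hsum.tsum_ofReal_ne_top
  have h5 := ENNReal.summable_toReal h4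
  simpa [ENNReal.toReal_ofReal] using h5

end Operators

/-! ### The inverse of `H` and its spectral decomposition -/

section Inverse

universe u

variable {H : ℋ →ₗ.[ℂ] ℋ}

lemma isBoundedInverse_boundedInv (h : ∃ T, IsBoundedInverse H T) :
    IsBoundedInverse H (boundedInv H) := by
  unfold boundedInv
  rw [dif_pos h]
  exact h.choose_spec

lemma IsBoundedInverse.exists_apply {T : ℋ →L[ℂ] ℋ} (hT : IsBoundedInverse H T) (g : ℋ) :
    ∃ h : T g ∈ H.domain, H ⟨T g, h⟩ = g := by
  have h := (hT (T g) g).2 rfl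
  obtain ⟨y, hy, hy'⟩ := (LinearPMap.mem_graph_iff _).1 h
  dsimp only at hy hy'
  have hm : T g ∈ H.domain := hy ▸ y.2
  refine ⟨hm, ?_⟩
  have : y = ⟨_, hm⟩ := Subtype.ext hy
  rw [← this, hy']

lemma IsBoundedInverse.apply_domain {T : ℋ →L[ℂ] ℋ} (hT : IsBoundedInverse H T) (f : H.domain) :
    T (H f) = f :=
  (hT f (H f)).1 (LinearPMap.mem_graph H f)

lemma IsBoundedInverse.apply_eigenvector {T : ℋ →L[ℂ] ℋ} (hT : IsBoundedInverse H T) {e : ℋ}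
    {t : ℝ} (ht : t ≠ 0) (h : T e = (t : ℂ) • e) :
    ∃ hd : e ∈ H.domain, H ⟨e, hd⟩ = ((t⁻¹ : ℝ) : ℂ) • e := by
  have h1 : T (((t⁻¹ : ℝ) : ℂ) • e) = e := by
    rw [map_smul, h, smul_smul, ← ofReal_mul, inv_mul_cancel₀ ht, ofReal_one, one_smul]
  obtain ⟨y, hy, hy'⟩ := (LinearPMap.mem_graph_iff _).1 ((hT _ _).2 h1)
  dsimp only at hy hy'
  have hm : e ∈ H.domain := hy ▸ y.2
  refine ⟨hm, ?_⟩
  have : y = ⟨_, hm⟩ := Subtype.ext hy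
  rw [← this, hy']

variable [CompleteSpace ℋ]

lemma inner_symm_of_isSelfAdjoint (hself : IsSelfAdjoint H) (f g : H.domain) :
    ⟪H f, (g : ℋ)⟫_ℂ = ⟪(f : ℋ), H g⟫_ℂ := by
  have h := LinearPMap.adjoint_isFormalAdjoint hself.dense_domain
  have h2 : H.adjoint = H := hself
  rw [h2] at h
  exact h f g

/-- Since `f = H (T f)`, symmetry and positivity of `T` at `f` are those of `H` at `T f`. -/
lemma IsBoundedInverse.nonneg {T : ℋ →L[ℂ] ℋ} (hT : IsBoundedInverse H T)
    (hself : IsSelfAdjoint H) (hpos : IsStrictlyPos H) : 0 ≤ T := by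
  rw [ContinuousLinearMap.nonneg_iff_isPositive, ContinuousLinearMap.isPositive_def]
  constructor
  · intro f g
    obtain ⟨h1, h1'⟩ := hT.exists_apply f
    obtain ⟨h2, h2'⟩ := hT.exists_apply g
    have := inner_symm_of_isSelfAdjoint hself ⟨T f, h1⟩ ⟨T g, h2⟩
    rw [h1', h2'] at this
    exact this.symm
  · intro f
    obtain ⟨h1, h1'⟩ := hT.exists_apply f
    rw [ContinuousLinearMap.reApplyInnerSelf_apply]
    rcases eq_or_ne (T f) 0 with h0 | h0
    · simp [h0]
    · have := hpos ⟨T f, h1⟩ h0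
      rw [h1'] at this
      exact this.le

lemma IsBoundedInverse.injective {T : ℋ →L[ℂ] ℋ} (hT : IsBoundedInverse H T) {g : ℋ}
    (h : T g = 0) : g = 0 := by
  obtain ⟨h1, h1'⟩ := hT.exists_apply g
  rw [← h1']
  have : (⟨T g, h1⟩ : H.domain) = 0 := Subtype.ext h
  rw [this, LinearPMap.map_zero]

lemma IsSymmetric_of_nonneg {T : ℋ →L[ℂ] ℋ} (hT : 0 ≤ T) (f g : ℋ) : ⟪T f, g⟫_ℂ = ⟪f, T g⟫_ℂ := by
  rw [ContinuousLinearMap.nonneg_iff_isPositive] at hT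
  exact hT.isSymmetric f g

lemma eigenvalue_pos {T : ℋ →L[ℂ] ℋ} (hT : 0 ≤ T) (hinj : ∀ g, T g = 0 → g = 0) {e : ℋ}
    (he : e ≠ 0) {t : ℝ} (h : T e = (t : ℂ) • e) : 0 < t := by
  rw [ContinuousLinearMap.nonneg_iff_isPositive] at hT
  have h1 := hT.re_inner_nonneg_right e
  rw [h, inner_smul_right, inner_self_eq_norm_sq_to_K] at h1
  have h2 : t ≠ 0 := by
    rintro rfl
    exact he (hinj e (by simpa using h))
  have h3 : 0 < ‖e‖ ^ 2 := by positivity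
  have h4 : 0 ≤ t * ‖e‖ ^ 2 := by
    convert h1 using 1
    have : (t : ℂ) * ((‖e‖ : ℝ) : ℂ) ^ 2 = ((t * ‖e‖ ^ 2 : ℝ) : ℂ) := by push_cast; rfl
    exact (congrArg Complex.re this).symm
  exact lt_of_le_of_ne (nonneg_of_mul_nonneg_left h4 h3) h2.symm

lemma rpow_eq_half_mul_half {T : ℋ →L[ℂ] ℋ} (hT : 0 ≤ T) {s : ℝ} (hs : 0 < s) :
    T ^ s = T ^ (s / 2) * T ^ (s / 2) := by
  have h2 := CFC.rpow_rpow_of_exponent_nonneg T (s / 2) (2 : ℕ) (by positivity) (by positivity) hT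
  rw [CFC.rpow_natCast _ _ CFC.rpow_nonneg, pow_two] at h2
  rw [h2]
  congr 1
  push_cast
  ring

/-- A positive operator with a trace class power has a Hilbert–Schmidt half of that power. -/
lemma IsTraceClass.summable_rpow {T : ℋ →L[ℂ] ℋ} (hT : 0 ≤ T) {s : ℝ} (hs : 0 < s)
    (h : IsTraceClass (T ^ s)) :
    ∃ (w : Set ℋ) (b : HilbertBasis w ℂ ℋ), Summable fun i => ‖(T ^ (s / 2)) (b i)‖ ^ 2 := by
  obtain ⟨w, b, hb⟩ := h
  have hsym := IsSymmetric_of_nonneg (T := T ^ (s / 2)) CFC.rpow_nonneg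
  have key (x : ℋ) : (⟪x, CFC.abs (T ^ s) x⟫_ℂ).re = ‖(T ^ (s / 2)) x‖ ^ 2 := by
    rw [CFC.abs_of_nonneg _ CFC.rpow_nonneg, rpow_eq_half_mul_half hT hs, mul_apply_eq_comp,
      ← hsym]
    exact inner_self_eq_norm_sq (𝕜 := ℂ) _
  simp only [key] at hb
  exact ⟨w, b, hb⟩

/-- A compact self-adjoint operator has an orthonormal basis of eigenvectors. -/
lemma exists_hilbertBasis_eigenvectors {ℋ : Type u} [NormedAddCommGroup ℋ]
    [InnerProductSpace ℂ ℋ] [CompleteSpace ℋ] {S : ℋ →L[ℂ] ℋ} (hc : IsCompactOperator S)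
    (hS : S.IsSymmetric) :
    ∃ (ι : Type u) (b : HilbertBasis ι ℂ ℋ), ∀ i, ∃ t : ℝ, S (b i) = (t : ℂ) • b i := by
  have hbot := ContinuousLinearMap.orthogonalComplement_iSup_eigenspaces_eq_bot hc hS
  have hV := hS.orthogonalFamily_eigenspaces
  have hcl (μ : ℂ) : CompleteSpace (Module.End.eigenspace (S : Module.End ℂ ℋ) μ) := by
    refine IsClosed.completeSpace_coe (hs := ?_)
    have : ((Module.End.eigenspace (S : Module.End ℂ ℋ) μ : Submodule ℂ ℋ) : Set ℋ) =
        {x | S x = μ • x} := by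
      ext x
      exact Module.End.mem_eigenspace_iff
    rw [this]
    exact isClosed_eq S.continuous (continuous_const_smul μ)
  -- Every complex `μ` is given a basis of its eigenspace, empty when that space is zero; the union
  -- over all `μ` is orthonormal, and it is total because the eigenspaces have trivial common
  -- orthogonal complement.
  choose w b hb using fun μ : ℂ =>
    exists_hilbertBasis ℂ (Module.End.eigenspace (S : Module.End ℂ ℋ) μ)
  have hon := hV.orthonormal_sigma_orthonormal (v_family := fun μ => (b μ : w μ → _))
    fun μ => (b μ).orthonormal
  have hsp : (Submodule.span ℂ (Set.range fun a : Σ μ, w μ =>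
      ((b a.1 a.2 : Module.End.eigenspace (S : Module.End ℂ ℋ) a.1) : ℋ)))ᗮ = ⊥ := by
    rw [eq_bot_iff, ← hbot]
    intro x hx
    rw [Submodule.mem_orthogonal'] at hx
    rw [Submodule.mem_orthogonal]
    intro y hy
    induction hy using Submodule.iSup_induction' with
    | zero => simp
    | add y z _ _ hy hz => rw [inner_add_left, hy, hz, add_zero]
    | mem μ y hy =>
      have h1 := ((b μ).hasSum_repr ⟨y, hy⟩).mapL
        (Module.End.eigenspace (S : Module.End ℂ ℋ) μ).subtypeL
      have h2 := h1.mapL (innerSL ℂ x)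
      have h3 : ⟪x, y⟫_ℂ = 0 := by
        refine h2.unique ?_
        convert hasSum_zero with i
        have := hx _ (Submodule.subset_span ⟨⟨μ, i⟩, rfl⟩)
        simp [this]
      rw [← inner_conj_symm, h3, map_zero]
  refine ⟨_, HilbertBasis.mkOfOrthogonalEqBot hon hsp, fun a => ?_⟩
  have hcoe := congrFun (HilbertBasis.coe_mkOfOrthogonalEqBot hon hsp) a
  rw [hcoe]
  have h1 : S (b a.1 a.2 : ℋ) = a.1 • (b a.1 a.2 : ℋ) :=
    Module.End.mem_eigenspace_iff.1 (b a.1 a.2).2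
  refine ⟨a.1.re, ?_⟩
  have hne : (b a.1 a.2 : ℋ) ≠ 0 := by
    have : ‖(b a.1 a.2 : ℋ)‖ = 1 := hon.1 a
    intro h0
    rw [h0] at this
    simp at this
  have hev : Module.End.HasEigenvalue (S : Module.End ℂ ℋ) a.1 :=
    Module.End.hasEigenvalue_of_hasEigenvector ⟨(b a.1 a.2).2, hne⟩
  have := hS.conj_eigenvalue_eq_self hev
  rw [Complex.conj_eq_iff_re.1 this]
  exact h1

/-- In a separable space, Hilbert bases are indexed by initial segments of `ℕ`. -/
lemma exists_equiv_initialSegment [TopologicalSpace.SeparableSpace ℋ] {ι : Type*}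
    (b : HilbertBasis ι ℂ ℋ) : ∃ N : ℕ∞, Nonempty ({k : ℕ // (k : ℕ∞) < N} ≃ ι) := by
  have hcount : Countable ι := by
    -- Distinct basis vectors have distance `√2`, so the balls of radius `1/2` are disjoint, and a
    -- separable space has only countably many of these.
    have hd : Pairwise (Function.onFun Disjoint fun i => Metric.ball (b i) (1 / 2)) := by
      intro i j hij
      refine Metric.ball_disjoint_ball ?_
      have h1 : ‖b i - b j‖ ^ 2 = 2 := by
        have h2 := b.orthonormal.1
        have h3 := b.orthonormal.2 hij
        rw [@norm_sub_sq ℂ, h2, h2, h3]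
        norm_num
      rw [dist_eq_norm]
      nlinarith [norm_nonneg (b i - b j)]
    have := Pairwise.countable_of_isOpen_disjoint hd (fun i => Metric.isOpen_ball)
      fun i => ⟨b i, Metric.mem_ball_self (by norm_num)⟩
    exact this
  rcases finite_or_infinite ι with hfin | hinf
  · refine ⟨Nat.card ι, ⟨?_⟩⟩
    refine Equiv.trans ?_ (Finite.equivFin ι).symm
    exact ⟨fun k => ⟨k.1, by exact_mod_cast k.2⟩, fun k => ⟨k.1, by exact_mod_cast k.2⟩,
      fun _ => rfl, fun _ => rfl⟩
  · obtain ⟨e⟩ := nonempty_equiv_of_countable (α := ℕ) (β := ι)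
    exact ⟨⊤, ⟨(Equiv.subtypeUnivEquiv fun k => ENat.natCast_lt_top k).trans e⟩⟩

/-- The square of `H^{-s/2}` is trace class, so `H^{-s/2}` is Hilbert–Schmidt, hence compact and
diagonalisable. Its eigenvectors are also eigenvectors of its power `H⁻¹`, whose eigenvalues are
nonzero by injectivity. -/
theorem exists_eigenBasis [TopologicalSpace.SeparableSpace ℋ] (hself : IsSelfAdjoint H)
    (hpos : IsStrictlyPos H) {s : ℝ} (hs : 0 < s) (htr : NegPowTraceClass H s) :
    Nonempty (EigenBasis H) := by
  have hT := isBoundedInverse_boundedInv htr.1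
  have hT0 := hT.nonneg hself hpos
  obtain ⟨w, b, hb⟩ := IsTraceClass.summable_rpow hT0 hs htr.2
  have hsym : (boundedInv H ^ (s / 2)).IsSymmetric := IsSymmetric_of_nonneg CFC.rpow_nonneg
  have hc := isCompactOperator_of_summable b hsym hb
  obtain ⟨ι, c, hcS⟩ := exists_hilbertBasis_eigenvectors hc hsym
  obtain ⟨N, ⟨e⟩⟩ := exists_equiv_initialSegment c
  have hon : Orthonormal ℂ fun k => c (e k) := c.orthonormal.comp e e.injective
  have hsp : ⊤ ≤ (Submodule.span ℂ (Set.range fun k => c (e k))).topologicalClosure := by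
    have : (Set.range fun k => c (e k)) = Set.range c := e.surjective.range_comp c
    rw [this, c.dense_span]
  refine ⟨⟨N, HilbertBasis.mk hon hsp, fun k => ?_⟩⟩
  rw [HilbertBasis.coe_mk]
  obtain ⟨t, ht⟩ := hcS (e k)
  -- The exponent `2 / s` undoes `s / 2` and returns to `H⁻¹`.
  have h1 := rpow_apply_eigenvector CFC.rpow_nonneg ht (show (0 : ℝ) < 2 / s by positivity)
  rw [CFC.rpow_rpow_of_exponent_nonneg _ _ _ (by positivity) (by positivity) hT0,
    show s / 2 * (2 / s) = 1 by field_simp, CFC.rpow_one _ hT0] at h1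
  have hne : c (e k) ≠ 0 := by
    intro h0
    have := c.orthonormal.1 (e k)
    simp [h0] at this
  have hpos' := eigenvalue_pos hT0 (fun g => hT.injective) hne h1
  refine ⟨(t ^ (2 / s))⁻¹, (hT _ _).2 ?_⟩
  rw [map_smul, h1, smul_smul, ← ofReal_mul, inv_mul_cancel₀ hpos'.ne', ofReal_one, one_smul]

end Inverse

/-! ### Coordinates with respect to an eigenbasis -/

section EigenBasis

namespace EigenBasis

variable {H : ℋ →ₗ.[ℂ] ℋ} (B : EigenBasis H)

/-- The index set of an eigenbasis. -/
abbrev Idx : Type := {k : ℕ // (k : ℕ∞) < B.N}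

/-- The eigenvalues of `H⁻¹`. -/
def tau (k : B.Idx) : ℝ := (B.eigen k).choose⁻¹

lemma basis_ne_zero (k : B.Idx) : B.basis k ≠ 0 := by
  intro h0
  have := B.basis.orthonormal.1 k
  simp [h0] at this

lemma e_coe (k : B.Idx) : B.e k = B.basis k := by
  unfold EigenBasis.e
  rw [dif_pos k.2]

variable {B} [CompleteSpace ℋ] {T : ℋ →L[ℂ] ℋ}

lemma inv_apply (hT : IsBoundedInverse H T) (k : B.Idx) :
    T (B.basis k) = (B.tau k : ℂ) • B.basis k := by
  have h1 := (hT _ _).1 (B.eigen k).choose_spec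
  have h2 : ((B.eigen k).choose : ℂ) ≠ 0 := by
    intro h0
    rw [h0, zero_smul, map_zero] at h1
    exact B.basis_ne_zero k h1.symm
  rw [map_smul] at h1
  unfold tau
  rw [ofReal_inv, eq_inv_smul_iff₀ h2, h1]

lemma tau_pos (hT : IsBoundedInverse H T) (hT0 : 0 ≤ T) (k : B.Idx) : 0 < B.tau k :=
  eigenvalue_pos hT0 (fun _ => hT.injective) (B.basis_ne_zero k) (inv_apply hT k)

/-- The trace hypothesis concerns some unspecified basis. The Hilbert–Schmidt norm of `T^{s/2}` can
be moved to the eigenbasis, where `‖T^{s/2} e_k‖² = τ_k^s`. -/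
lemma summable_tau_rpow (hT : IsBoundedInverse H T) (hT0 : 0 ≤ T) {s : ℝ} (hs : 0 < s)
    (htr : IsTraceClass (T ^ s)) : Summable fun k => B.tau k ^ s := by
  obtain ⟨w, b, hb⟩ := IsTraceClass.summable_rpow hT0 hs htr
  have h1 := summable_norm_sq_basis_change b B.basis
    (IsSymmetric_of_nonneg CFC.rpow_nonneg) hb
  refine h1.congr fun k => ?_
  have hk := (tau_pos hT hT0 k).le
  rw [rpow_apply_eigenvector hT0 (inv_apply hT k) (by positivity), norm_smul,
    B.basis.orthonormal.1 k, mul_one, Complex.norm_real, Real.norm_of_nonneg (by positivity),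
    ← Real.rpow_natCast, ← Real.rpow_mul hk]
  congr 1
  push_cast
  ring

lemma tau_le (hT : IsBoundedInverse H T) (hT0 : 0 ≤ T) (k : B.Idx) : B.tau k ≤ ‖T‖ := by
  have h1 := T.le_opNorm (B.basis k)
  rw [inv_apply hT k, norm_smul, B.basis.orthonormal.1 k, Complex.norm_real,
    Real.norm_of_nonneg (tau_pos hT hT0 k).le] at h1
  simpa using h1

end EigenBasis

end EigenBasis

/-! ### The space `ℋ^{-s}` and the duality -/

section NegSobolevSpace

open UniformSpace

variable [CompleteSpace ℋ] (H : ℋ →ₗ.[ℂ] ℋ) (s : ℝ)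

lemma isometry_negPow_val :
    Isometry fun v : PreNegSobolev H s => negPow H (s / 2) (PreNegSobolev.val H s v) := by
  refine Isometry.of_dist_eq fun v w => ?_
  rw [dist_eq_norm, dist_eq_norm, ← map_sub, ← map_sub]
  rfl

/-- The extension of `H ^ (-s/2)` to an isometry from `ℋ^{-s}` to `ℋ`. -/
def negSobolevMap : NegSobolev H s → ℋ :=
  Completion.extension fun v : PreNegSobolev H s => negPow H (s / 2) (PreNegSobolev.val H s v)

lemma isometry_negSobolevMap : Isometry (negSobolevMap H s) :=
  (isometry_negPow_val H s).completion_extension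

lemma negSobolevMap_coe (v : PreNegSobolev H s) :
    negSobolevMap H s v = negPow H (s / 2) (PreNegSobolev.val H s v) :=
  Completion.extension_coe (isometry_negPow_val H s).uniformContinuous v

/-- An isometric image of a complete space is closed, and this one contains a dense range. Thus
`ℋ^{-s}` is a copy of `ℋ`, and a random element of it can be prescribed through its image `H^{-s/2}
u`. -/
lemma negSobolevMap_surjective (hd : DenseRange (negPow H (s / 2))) :
    Function.Surjective (negSobolevMap H s) := by
  have hc : IsClosed (Set.range (negSobolevMap H s)) :=
    (isometry_negSobolevMap H s).isClosedEmbedding.isClosed_range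
  rw [← Set.range_eq_univ, ← hc.closure_eq]
  refine Dense.closure_eq (hd.mono ?_)
  rintro _ ⟨v, rfl⟩
  exact ⟨((show PreNegSobolev H s from v : PreNegSobolev H s) : NegSobolev H s),
    negSobolevMap_coe H s v⟩

variable {H s}

lemma inner_negPow (r : ℝ) (f g : ℋ) :
    ⟪negPow H r f, g⟫_ℂ = ⟪f, negPow H r g⟫_ℂ :=
  IsSymmetric_of_nonneg (T := boundedInv H ^ r) CFC.rpow_nonneg f g

lemma uniformContinuous_re_inner (g : ℋ) : UniformContinuous fun x : ℋ => (⟪g, x⟫_ℂ).re :=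
  Complex.reCLM.uniformContinuous.comp (innerSL ℂ g).uniformContinuous

/-- Both sides extend the same uniformly continuous function on `E`. This reduces the duality to the
inner product of `ℋ`; it applies only to `f` in `ℋ^s`, which is why the algebraic rules for
`pairing` carry that hypothesis. -/
lemma pairing_negPow (g : ℋ) (u : NegSobolev H s) :
    pairing H s (negPow H (s / 2) g) u = (⟪g, negSobolevMap H s u⟫_ℂ).re := by
  have h1 : (fun v : PreNegSobolev H s =>
      (⟪negPow H (s / 2) g, PreNegSobolev.val H s v⟫_ℂ).re) =
      fun v => (⟪g, negPow H (s / 2) (PreNegSobolev.val H s v)⟫_ℂ).re := by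
    ext v
    rw [inner_negPow]
  have h2 := uniformContinuous_re_inner g
  unfold pairing
  rw [h1]
  refine congrFun (Completion.extension_unique
    (h2.comp (isometry_negPow_val H s).uniformContinuous)
    (h2.comp (isometry_negSobolevMap H s).uniformContinuous) fun v => ?_) u
  simp only [Function.comp, negSobolevMap_coe]

lemma mem_sobolev_iff {f : ℋ} : f ∈ sobolev H s ↔ ∃ g, negPow H (s / 2) g = f :=
  LinearMap.mem_range

lemma pairing_add {f f' : ℋ} (hf : f ∈ sobolev H s)
    (hf' : f' ∈ sobolev H s) (u : NegSobolev H s) :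
    pairing H s (f + f') u = pairing H s f u + pairing H s f' u := by
  obtain ⟨g, rfl⟩ := mem_sobolev_iff.1 hf
  obtain ⟨g', rfl⟩ := mem_sobolev_iff.1 hf'
  rw [← map_add]
  simp only [pairing_negPow, inner_add_left, add_re]

lemma pairing_smul {f : ℋ} (hf : f ∈ sobolev H s) (c : ℝ)
    (u : NegSobolev H s) : pairing H s ((c : ℂ) • f) u = c * pairing H s f u := by
  obtain ⟨g, rfl⟩ := mem_sobolev_iff.1 hf
  rw [← map_smul]
  simp only [pairing_negPow, inner_smul_left, conj_ofReal, re_ofReal_mul]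

lemma pairing_zero (u : NegSobolev H s) :
    pairing H s (0 : ℋ) u = 0 := by
  have := pairing_negPow 0 u
  simpa using this

lemma pairing_sum {ι : Type*} (F : Finset ι) {f : ι → ℋ}
    (hf : ∀ i, f i ∈ sobolev H s) (u : NegSobolev H s) :
    pairing H s (∑ i ∈ F, f i) u = ∑ i ∈ F, pairing H s (f i) u := by
  classical
  induction F using Finset.induction_on with
  | empty => simp [pairing_zero]
  | insert i F hi ih =>
    rw [Finset.sum_insert hi, Finset.sum_insert hi,
      pairing_add (hf i) (Submodule.sum_mem _ fun j _ => hf j), ih]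

lemma continuous_pairing {f : ℋ} (hf : f ∈ sobolev H s) :
    Continuous (pairing H s f) := by
  obtain ⟨g, rfl⟩ := mem_sobolev_iff.1 hf
  have : pairing H s (negPow H (s / 2) g) = fun u => (⟪g, negSobolevMap H s u⟫_ℂ).re :=
    funext fun u => pairing_negPow g u
  rw [this]
  exact Complex.continuous_re.comp
    ((innerSL ℂ g).continuous.comp (isometry_negSobolevMap H s).continuous)

end NegSobolevSpace

/-! ### Cylindrical coordinates -/

section Coordinates

variable [CompleteSpace ℋ] {H : ℋ →ₗ.[ℂ] ℋ} (B : EigenBasis H) {s : ℝ}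

/-- The vector `∑ k, a_k e_k + b_k f_k` with real coordinates `(a, b)`. -/
def ofCoord {n : ℕ} (a : (Fin n → ℝ) × (Fin n → ℝ)) : ℋ :=
  ∑ k : Fin n, ((a.1 k : ℂ) • B.e k + (a.2 k : ℂ) • (Complex.I • B.e k))

/-- The eigenvalues of `H⁻¹`, indexed by `Fin n`. -/
def EigenBasis.tauFin {n : ℕ} (hn : (n : ℕ∞) ≤ B.N) (k : Fin n) : ℝ :=
  B.tau ⟨k, lt_of_lt_of_le (by exact_mod_cast k.2) hn⟩

variable {B}

lemma EigenBasis.e_fin {n : ℕ} (hn : (n : ℕ∞) ≤ B.N) (k : Fin n) :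
    B.e k = B.basis ⟨k, lt_of_lt_of_le (by exact_mod_cast k.2) hn⟩ :=
  B.e_coe ⟨k, lt_of_lt_of_le (by exact_mod_cast k.2) hn⟩

/-- The standing assumptions on the inverse of `H`. -/
structure GoodInverse (H : ℋ →ₗ.[ℂ] ℋ) (s : ℝ) : Prop where
  inv : IsBoundedInverse H (boundedInv H)
  nonneg : 0 ≤ boundedInv H
  hs : 0 < s
  trace : IsTraceClass (boundedInv H ^ s)

namespace GoodInverse

lemma tau_pos (h : GoodInverse H s) (k : B.Idx) : 0 < B.tau k :=
  EigenBasis.tau_pos h.inv h.nonneg k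

lemma tauFin_pos (h : GoodInverse H s) {n : ℕ} (hn : (n : ℕ∞) ≤ B.N) (k : Fin n) :
    0 < B.tauFin hn k := h.tau_pos _

lemma negPow_basis (h : GoodInverse H s) (k : B.Idx) :
    negPow H (s / 2) (B.basis k) = ((B.tau k ^ (s / 2) : ℝ) : ℂ) • B.basis k :=
  rpow_apply_eigenvector h.nonneg (EigenBasis.inv_apply h.inv k) (half_pos h.hs)

lemma negPow_smul_basis (h : GoodInverse H s) (k : B.Idx) (c : ℂ) :
    negPow H (s / 2) ((((B.tau k ^ (s / 2))⁻¹ : ℝ) : ℂ) • (c • B.basis k)) = c • B.basis k := by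
  have h0 : ((B.tau k ^ (s / 2) : ℝ) : ℂ) ≠ 0 := by
    have := Real.rpow_pos_of_pos (h.tau_pos k) (s / 2)
    exact_mod_cast this.ne'
  rw [map_smul, map_smul, h.negPow_basis, smul_comm, smul_smul, smul_smul, ofReal_inv, mul_assoc,
    inv_mul_cancel₀ h0, mul_one]

lemma smul_basis_mem_sobolev (h : GoodInverse H s) (k : B.Idx) (c : ℂ) :
    c • B.basis k ∈ sobolev H s :=
  mem_sobolev_iff.2 ⟨_, h.negPow_smul_basis k c⟩

lemma basis_mem_sobolev (h : GoodInverse H s) (k : B.Idx) : B.basis k ∈ sobolev H s := by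
  simpa using h.smul_basis_mem_sobolev k 1

lemma e_mem_sobolev (h : GoodInverse H s) (k : ℕ) : B.e k ∈ sobolev H s := by
  unfold EigenBasis.e
  split_ifs
  · exact h.basis_mem_sobolev _
  · exact zero_mem _

lemma ofCoord_mem_sobolev (h : GoodInverse H s) {n : ℕ} (a : (Fin n → ℝ) × (Fin n → ℝ)) :
    ofCoord B a ∈ sobolev H s :=
  Submodule.sum_mem _ fun k _ => Submodule.add_mem _
    (Submodule.smul_mem _ _ (h.e_mem_sobolev k))
    (Submodule.smul_mem _ _ (Submodule.smul_mem _ _ (h.e_mem_sobolev k)))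

lemma denseRange_negPow (h : GoodInverse H s) (B : EigenBasis H) :
    DenseRange (negPow H (s / 2)) := by
  have h1 : Submodule.span ℂ (Set.range B.basis) ≤ sobolev H s := by
    rw [Submodule.span_le]
    rintro _ ⟨k, rfl⟩
    exact h.basis_mem_sobolev k
  have h2 : Dense (Submodule.span ℂ (Set.range B.basis) : Set ℋ) := by
    rw [Submodule.dense_iff_topologicalClosure_eq_top]
    exact B.basis.dense_span
  exact h2.mono h1

lemma pairing_ofCoord (h : GoodInverse H s) {n : ℕ} (a : (Fin n → ℝ) × (Fin n → ℝ))
    (u : NegSobolev H s) :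
    pairing H s (ofCoord B a) u =
      ∑ k, (a.1 k * (cylProj B s n u).1 k + a.2 k * (cylProj B s n u).2 k) := by
  have h1 (k : Fin n) := h.e_mem_sobolev (B := B) k
  have h2 (k : Fin n) := Submodule.smul_mem _ Complex.I (h1 k)
  unfold ofCoord
  rw [pairing_sum]
  · refine Finset.sum_congr rfl fun k _ => ?_
    rw [pairing_add (Submodule.smul_mem _ _ (h1 k)) (Submodule.smul_mem _ _ (h2 k)),
      pairing_smul (h1 k), pairing_smul (h2 k)]
    rfl
  · exact fun k => Submodule.add_mem _ (Submodule.smul_mem _ _ (h1 k))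
      (Submodule.smul_mem _ _ (h2 k))

lemma boundedInv_ofCoord (h : GoodInverse H s) {n : ℕ} (hn : (n : ℕ∞) ≤ B.N)
    (a : (Fin n → ℝ) × (Fin n → ℝ)) :
    boundedInv H (ofCoord B a) =
      ofCoord B (fun k => B.tauFin hn k * a.1 k, fun k => B.tauFin hn k * a.2 k) := by
  unfold ofCoord
  rw [map_sum]
  refine Finset.sum_congr rfl fun k _ => ?_
  simp only [map_add, map_smul, EigenBasis.e_fin hn, EigenBasis.inv_apply h.inv,
    EigenBasis.tauFin, ofReal_mul, smul_smul]
  congr 2 <;> ring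

/-- `i H` acts on cylindrical vectors as a rotation with the frequencies of `H`. -/
lemma exists_H_ofCoord (h : GoodInverse H s) {n : ℕ} (hn : (n : ℕ∞) ≤ B.N)
    (a : (Fin n → ℝ) × (Fin n → ℝ)) :
    ∃ hd : ofCoord B a ∈ H.domain, Complex.I • H ⟨ofCoord B a, hd⟩ =
      ofCoord B (fun k => -((B.tauFin hn k)⁻¹ * a.2 k), fun k => (B.tauFin hn k)⁻¹ * a.1 k) := by
  -- `H` is not applied termwise: its value on `ofCoord B a` is read off from a vector that `H⁻¹`
  -- maps to `ofCoord B a`. Multiplication by `i` then exchanges the two coordinate blocks.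
  have h1 : boundedInv H (ofCoord B
      (fun k => (B.tauFin hn k)⁻¹ * a.1 k, fun k => (B.tauFin hn k)⁻¹ * a.2 k)) =
      ofCoord B a := by
    rw [h.boundedInv_ofCoord hn]
    congr 1
    ext k <;> simp only [] <;> rw [mul_inv_cancel_left₀ (h.tauFin_pos hn k).ne']
  obtain ⟨hd, hd'⟩ := h.inv.exists_apply (ofCoord B
      (fun k => (B.tauFin hn k)⁻¹ * a.1 k, fun k => (B.tauFin hn k)⁻¹ * a.2 k))
  rw [h1] at hd
  simp only [h1] at hd'
  refine ⟨hd, ?_⟩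
  rw [hd']
  unfold ofCoord
  rw [Finset.smul_sum]
  refine Finset.sum_congr rfl fun k _ => ?_
  simp only [smul_add, smul_smul, ofReal_mul, ofReal_neg]
  rw [add_comm]
  congr 2
  · linear_combination (((B.tauFin hn k)⁻¹ : ℝ) : ℂ) * (a.2 k : ℂ) * Complex.I_mul_I
  · ring

lemma pairingX_ofCoord (h : GoodInverse H s) {n : ℕ} (hn : (n : ℕ∞) ≤ B.N)
    (a : (Fin n → ℝ) × (Fin n → ℝ)) (u : NegSobolev H s) :
    pairingX H s (ofCoord B a) u =
      ∑ k, (B.tauFin hn k)⁻¹ *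
        (a.1 k * (cylProj B s n u).2 k - a.2 k * (cylProj B s n u).1 k) := by
  obtain ⟨hd, hd'⟩ := h.exists_H_ofCoord hn a
  unfold pairingX
  rw [dif_pos hd, hd', h.pairing_ofCoord]
  refine Finset.sum_congr rfl fun k _ => ?_
  ring

end GoodInverse

/-- Two test functions may depend on different numbers of coordinates, so the diagonal is written as
a condition on pairs of indices. -/
lemma symplForm_ofCoord {n m : ℕ} (hn : (n : ℕ∞) ≤ B.N) (hm : (m : ℕ∞) ≤ B.N)
    (a : (Fin n → ℝ) × (Fin n → ℝ)) (b : (Fin m → ℝ) × (Fin m → ℝ)) :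
    symplForm (ofCoord B a) (ofCoord B b) =
      ∑ k : Fin n, ∑ l : Fin m, if (k : ℕ) = l then a.1 k * b.2 l - a.2 k * b.1 l else 0 := by
  unfold symplForm ofCoord
  rw [sum_inner, Complex.im_sum]
  refine Finset.sum_congr rfl fun k _ => ?_
  rw [inner_sum, Complex.im_sum]
  refine Finset.sum_congr rfl fun l _ => ?_
  have h1 : ⟪B.e k, B.e l⟫_ℂ = if (k : ℕ) = l then 1 else 0 := by
    rw [EigenBasis.e_fin hn, EigenBasis.e_fin hm, orthonormal_iff_ite.1 B.basis.orthonormal]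
    simp
  simp only [inner_add_left, inner_add_right, inner_smul_left, inner_smul_right, h1]
  split_ifs <;> simp
  ring

lemma inner_self_boundedInv_ofCoord (h : GoodInverse H s) {n : ℕ} (hn : (n : ℕ∞) ≤ B.N)
    (a : (Fin n → ℝ) × (Fin n → ℝ)) :
    (⟪ofCoord B a, boundedInv H (ofCoord B a)⟫_ℂ).re =
      ∑ k, B.tauFin hn k * (a.1 k ^ 2 + a.2 k ^ 2) := by
  have h1 : ∀ b : (Fin n → ℝ) × (Fin n → ℝ),
      ofCoord B b = ∑ k, ((b.1 k : ℂ) + b.2 k * I) • B.e k := by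
    intro b
    unfold ofCoord
    simp only [add_smul, smul_smul]
  have hon : Orthonormal ℂ fun k : Fin n => B.e k := by
    rw [orthonormal_iff_ite]
    intro i j
    simp only [EigenBasis.e_fin hn]
    rw [orthonormal_iff_ite.1 B.basis.orthonormal]
    simp [Fin.ext_iff]
  rw [h.boundedInv_ofCoord hn, h1, h1, hon.inner_sum, Complex.re_sum]
  refine Finset.sum_congr rfl fun k _ => ?_
  simp
  ring

lemma cylGrad_eq_ofCoord (F : CylTest B.N) (u : NegSobolev H s) :
    cylGrad B s F u = ofCoord B (fun k => fderiv ℝ F.φ (cylProj B s F.n u) (Pi.single k 1, 0),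
      fun k => fderiv ℝ F.φ (cylProj B s F.n u) (0, Pi.single k 1)) := rfl

lemma measurable_cylProj (h : GoodInverse H s) (n : ℕ) : Measurable (cylProj B s n) := by
  refine Continuous.measurable ?_
  unfold cylProj
  refine Continuous.prodMk ?_ ?_
  · exact continuous_pi fun k => continuous_pairing (h.e_mem_sobolev k)
  · exact continuous_pi fun k =>
      continuous_pairing (Submodule.smul_mem _ _ (h.e_mem_sobolev k))

end Coordinates

/-! ### Integration by parts determines the Fourier transform -/

section CharFun

open Filter Topology

/-- The integrating factor `exp (c t² / 2)` makes the product constant. Both the state and the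
measure are identified by this uniqueness statement. -/
lemma gaussian_of_hasDerivAt {D : ℝ → ℂ} {c : ℝ}
    (hD : ∀ t, HasDerivAt D (-((c * t : ℝ) : ℂ) * D t) t) (h0 : D 0 = 1) (t : ℝ) :
    D t = Complex.exp (((-(c * t ^ 2 / 2) : ℝ) : ℂ)) := by
  have hE (t : ℝ) : HasDerivAt (fun t : ℝ => Complex.exp (((c * t ^ 2 / 2 : ℝ) : ℂ)))
      (Complex.exp (((c * t ^ 2 / 2 : ℝ) : ℂ)) * ((c * t : ℝ) : ℂ)) t := by
    have h1 : HasDerivAt (fun t : ℝ => c * t ^ 2 / 2) (c * t) t := by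
      have := ((hasDerivAt_pow 2 t).const_mul c).div_const 2
      refine this.congr_deriv ?_
      push_cast
      ring
    exact h1.ofReal_comp.cexp
  have hP (t : ℝ) : HasDerivAt (fun t : ℝ => D t * Complex.exp (((c * t ^ 2 / 2 : ℝ) : ℂ)))
      0 t := by
    refine ((hD t).mul (hE t)).congr_deriv ?_
    ring
  have hconst := is_const_of_deriv_eq_zero (fun t => (hP t).differentiableAt)
    (fun t => (hP t).deriv) t 0
  simp only [h0] at hconst
  rw [ofReal_neg, Complex.exp_neg]
  refine eq_inv_of_mul_eq_one_left (hconst.trans ?_)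
  simp

variable {X : Type*} [NormedAddCommGroup X] [NormedSpace ℝ X] [FiniteDimensional ℝ X]
  [MeasurableSpace X] [BorelSpace X]
  {Ω : Type*} [MeasurableSpace Ω] {μ : Measure Ω} [IsProbabilityMeasure μ]

/-- Integration by parts for test functions extends to bounded functions of a linear form. -/
lemma integral_deriv_linear_of_testFunctions {p : Ω → X} (hp : Measurable p) {L : X →L[ℝ] ℝ}
    {y : X} {β : ℝ} (hL : Integrable (fun ω => L (p ω)) μ)
    (hst : ∀ ψ : X → ℝ, ContDiff ℝ (⊤ : ℕ∞) ψ → HasCompactSupport ψ →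
      ∫ ω, fderiv ℝ ψ (p ω) y ∂μ = β * ∫ ω, L (p ω) * ψ (p ω) ∂μ)
    {g : ℝ → ℝ} (hg : ContDiff ℝ (⊤ : ℕ∞) g) {M : ℝ} (hgM : ∀ x, |g x| ≤ M)
    (hgM' : ∀ x, |deriv g x| ≤ M) :
    L y * ∫ ω, deriv g (L (p ω)) ∂μ = β * ∫ ω, L (p ω) * g (L (p ω)) ∂μ := by
  let χ : ContDiffBump (0 : X) := ⟨1, 2, one_pos, one_lt_two⟩
  let r : ℕ → ℝ := fun n => 1 / ((n : ℝ) + 1)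
  have hr0 (n : ℕ) : 0 < r n := Nat.one_div_pos_of_nat
  have hr1 (n : ℕ) : r n ≤ 1 := by
    have : (0 : ℝ) ≤ n := n.cast_nonneg
    exact (div_le_one (by positivity)).2 (by linarith)
  have hr : Tendsto r atTop (𝓝 0) := tendsto_one_div_add_atTop_nhds_zero_nat
  have hχs : ContDiff ℝ (⊤ : ℕ∞) (χ : X → ℝ) := χ.contDiff
  have hM0 : 0 ≤ M := (abs_nonneg _).trans (hgM 0)
  obtain ⟨K, hK⟩ := (χ.hasCompactSupport.fderiv ℝ).exists_bound_of_continuous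
    (hχs.continuous_fderiv (by simp))
  have hK0 : 0 ≤ K := (norm_nonneg _).trans (hK 0)
  -- The cutoff lives at scale `n + 1`, so its derivative carries a factor `r n → 0`. Integrability
  -- of `L ∘ p` dominates the right-hand side; the left-hand side is uniformly bounded.
  let ψ : ℕ → X → ℝ := fun n x => g (L x) * χ (r n • x)
  have hψs (n : ℕ) : ContDiff ℝ (⊤ : ℕ∞) (ψ n) :=
    (hg.comp L.contDiff).mul (hχs.comp (contDiff_const_smul _))
  have hψc (n : ℕ) : HasCompactSupport (ψ n) := by
    refine HasCompactSupport.mul_left ?_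
    exact χ.hasCompactSupport.comp_homeomorph (Homeomorph.smulOfNeZero (r n) (hr0 n).ne')
  have hgd (x : ℝ) : HasDerivAt g (deriv g x) x :=
    (hg.differentiable (by simp)).differentiableAt.hasDerivAt
  have hψd (n : ℕ) (x : X) : fderiv ℝ (ψ n) x y =
      deriv g (L x) * L y * χ (r n • x) + g (L x) * (r n * fderiv ℝ χ (r n • x) y) := by
    have h1 : HasFDerivAt (fun x => g (L x)) (deriv g (L x) • L) x :=
      (hgd (L x)).comp_hasFDerivAt x L.hasFDerivAt
    have h2 : HasFDerivAt (fun x : X => χ (r n • x))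
        ((fderiv ℝ χ (r n • x)).comp (r n • ContinuousLinearMap.id ℝ X)) x :=
      (hχs.differentiable (by simp)).differentiableAt.hasFDerivAt.comp x
        ((hasFDerivAt_id x).const_smul (r n))
    have h3 : fderiv ℝ (ψ n) x = _ := (h1.mul h2).fderiv
    rw [h3]
    simp
    ring
  have hχ0 (x : X) : Tendsto (fun n => χ (r n • x)) atTop (𝓝 1) := by
    have h1 : Tendsto (fun n => r n • x) atTop (𝓝 0) := by
      simpa using hr.smul_const x
    have h2 := (χ.continuous.tendsto 0).comp h1
    rwa [χ.one_of_mem_closedBall (by simp [χ])] at h2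
  have hχb (x : X) : |χ x| ≤ 1 := by
    rw [abs_of_nonneg χ.nonneg]
    exact χ.le_one
  have hLm : Measurable fun ω => L (p ω) := L.continuous.measurable.comp hp
  have hA : Tendsto (fun n => ∫ ω, fderiv ℝ (ψ n) (p ω) y ∂μ) atTop
      (𝓝 (∫ ω, deriv g (L (p ω)) * L y ∂μ)) := by
    refine tendsto_integral_of_dominated_convergence
      (fun _ => M * |L y| + M * (K * ‖y‖)) ?_ (integrable_const _) ?_ ?_
    · intro n
      have hc : Continuous fun x => fderiv ℝ (ψ n) x y :=
        ((hψs n).continuous_fderiv (by simp)).clm_apply continuous_const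
      exact (hc.measurable.comp hp).aestronglyMeasurable
    · intro n
      refine Eventually.of_forall fun ω => ?_
      rw [hψd, Real.norm_eq_abs]
      refine (abs_add_le _ _).trans (add_le_add ?_ ?_)
      · rw [abs_mul, abs_mul]
        calc |deriv g (L (p ω))| * |L y| * |χ (r n • p ω)| ≤ M * |L y| * 1 := by
              gcongr
              · exact hgM' _
              · exact hχb _
          _ = _ := mul_one _
      · rw [abs_mul, abs_mul, abs_of_pos (hr0 n)]
        have h1 : |fderiv ℝ χ (r n • p ω) y| ≤ K * ‖y‖ :=
          (ContinuousLinearMap.le_opNorm _ _).trans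
            (mul_le_mul_of_nonneg_right (hK _) (norm_nonneg y))
        calc |g (L (p ω))| * (r n * |fderiv ℝ χ (r n • p ω) y|) ≤ M * (1 * (K * ‖y‖)) := by
              gcongr
              exacts [hgM _, hr1 n]
          _ = _ := by ring
    · refine Eventually.of_forall fun ω => ?_
      simp only [hψd]
      have h1 : Tendsto (fun n => r n * fderiv ℝ χ (r n • p ω) y) atTop (𝓝 0) := by
        refine squeeze_zero_norm (a := fun n => r n * (K * ‖y‖)) (fun n => ?_) ?_
        · rw [norm_mul, Real.norm_of_nonneg (hr0 n).le]
          have := (ContinuousLinearMap.le_opNorm (fderiv ℝ χ (r n • p ω)) y).trans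
            (mul_le_mul_of_nonneg_right (hK _) (norm_nonneg y))
          exact mul_le_mul_of_nonneg_left this (hr0 n).le
        · simpa using hr.mul_const (K * ‖y‖)
      have h2 := ((hχ0 (p ω)).const_mul (deriv g (L (p ω)) * L y)).add
        (h1.const_mul (g (L (p ω))))
      simpa using h2
  have hB : Tendsto (fun n => ∫ ω, L (p ω) * ψ n (p ω) ∂μ) atTop
      (𝓝 (∫ ω, L (p ω) * g (L (p ω)) ∂μ)) := by
    refine tendsto_integral_of_dominated_convergence (fun ω => |L (p ω)| * M) ?_
      (hL.abs.mul_const M) ?_ ?_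
    · exact fun n => (hLm.mul ((hψs n).continuous.measurable.comp hp)).aestronglyMeasurable
    · intro n
      refine Eventually.of_forall fun ω => ?_
      rw [norm_mul, Real.norm_eq_abs, Real.norm_eq_abs]
      refine mul_le_mul_of_nonneg_left ?_ (abs_nonneg _)
      change |g (L (p ω)) * χ (r n • p ω)| ≤ M
      rw [abs_mul]
      calc |g (L (p ω))| * |χ (r n • p ω)| ≤ M * 1 := by
            gcongr
            · exact hgM _
            · exact hχb _
        _ = M := mul_one _
    · refine Eventually.of_forall fun ω => ?_
      have := ((hχ0 (p ω)).const_mul (g (L (p ω)))).const_mul (L (p ω))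
      simpa [ψ] using this
  have hE := tendsto_nhds_unique hA
    ((hB.const_mul β).congr fun n => (hst (ψ n) (hψs n) (hψc n)).symm)
  rw [← hE, integral_mul_const, mul_comm]

/-- Integration by parts for test functions determines the characteristic function of a
linear form. -/
lemma integral_cexp_of_testFunctions {p : Ω → X} (hp : Measurable p) {L : X →L[ℝ] ℝ}
    {y : X} {β : ℝ} (hβ : β ≠ 0) (hL : Integrable (fun ω => L (p ω)) μ)
    (hst : ∀ ψ : X → ℝ, ContDiff ℝ (⊤ : ℕ∞) ψ → HasCompactSupport ψ →
      ∫ ω, fderiv ℝ ψ (p ω) y ∂μ = β * ∫ ω, L (p ω) * ψ (p ω) ∂μ) :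
    ∫ ω, Complex.exp ((L (p ω) : ℂ) * I) ∂μ = Complex.exp ((-(L y / β / 2) : ℝ) : ℂ) := by
  have hLm : Measurable fun ω => L (p ω) := L.continuous.measurable.comp hp
  -- The identity is for real test functions, so it is applied to `cos (t ·)` and `sin (t ·)`
  -- separately and recombined into the exponential.
  have key := fun (g : ℝ → ℝ) (hg : ContDiff ℝ (⊤ : ℕ∞) g) (M : ℝ) (h1 : ∀ x, |g x| ≤ M)
    (h2 : ∀ x, |deriv g x| ≤ M) => integral_deriv_linear_of_testFunctions hp hL hst hg h1 h2
  have hC (t : ℝ) : Integrable (fun ω => Real.cos (t * L (p ω))) μ :=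
    Integrable.of_bound ((Real.measurable_cos.comp (hLm.const_mul t)).aestronglyMeasurable) 1
      (Eventually.of_forall fun _ => Real.abs_cos_le_one _)
  have hS (t : ℝ) : Integrable (fun ω => Real.sin (t * L (p ω))) μ :=
    Integrable.of_bound ((Real.measurable_sin.comp (hLm.const_mul t)).aestronglyMeasurable) 1
      (Eventually.of_forall fun _ => Real.abs_sin_le_one _)
  have hLC (t : ℝ) : Integrable (fun ω => L (p ω) * Real.cos (t * L (p ω))) μ :=
    hL.mul_bdd (c := 1) ((Real.measurable_cos.comp (hLm.const_mul t)).aestronglyMeasurable)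
      (Eventually.of_forall fun _ => Real.abs_cos_le_one _)
  have hLS (t : ℝ) : Integrable (fun ω => L (p ω) * Real.sin (t * L (p ω))) μ :=
    hL.mul_bdd (c := 1) ((Real.measurable_sin.comp (hLm.const_mul t)).aestronglyMeasurable)
      (Eventually.of_forall fun _ => Real.abs_sin_le_one _)
  have hcosd (t x : ℝ) : HasDerivAt (fun x => Real.cos (t * x)) (-Real.sin (t * x) * t) x := by
    simpa using ((hasDerivAt_id x).const_mul t).cos
  have hsind (t x : ℝ) : HasDerivAt (fun x => Real.sin (t * x)) (Real.cos (t * x) * t) x := by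
    simpa using ((hasDerivAt_id x).const_mul t).sin
  have hcos (t : ℝ) : ∫ ω, L (p ω) * Real.cos (t * L (p ω)) ∂μ =
      -(L y / β * t) * ∫ ω, Real.sin (t * L (p ω)) ∂μ := by
    have h1 := key (fun x => Real.cos (t * x))
      (Real.contDiff_cos.comp (contDiff_const.mul contDiff_id)) (max 1 |t|)
      (fun x => (Real.abs_cos_le_one _).trans (le_max_left _ _)) (fun x => by
        rw [(hcosd t x).deriv, abs_mul, abs_neg]
        exact (mul_le_of_le_one_left (abs_nonneg _) (Real.abs_sin_le_one _)).trans
          (le_max_right _ _))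
    simp only [fun t x => (hcosd t x).deriv, integral_mul_const, integral_neg] at h1
    have h2 : ∫ ω, L (p ω) * Real.cos (t * L (p ω)) ∂μ = (L y *
        ((-∫ ω, Real.sin (t * L (p ω)) ∂μ) * t)) / β := by
      rw [h1, mul_div_cancel_left₀ _ hβ]
    rw [h2]
    ring
  have hsin (t : ℝ) : ∫ ω, L (p ω) * Real.sin (t * L (p ω)) ∂μ =
      (L y / β * t) * ∫ ω, Real.cos (t * L (p ω)) ∂μ := by
    have h1 := key (fun x => Real.sin (t * x))
      (Real.contDiff_sin.comp (contDiff_const.mul contDiff_id)) (max 1 |t|)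
      (fun x => (Real.abs_sin_le_one _).trans (le_max_left _ _)) (fun x => by
        rw [(hsind t x).deriv, abs_mul]
        exact (mul_le_of_le_one_left (abs_nonneg _) (Real.abs_cos_le_one _)).trans
          (le_max_right _ _))
    simp only [fun t x => (hsind t x).deriv, integral_mul_const] at h1
    have h2 : ∫ ω, L (p ω) * Real.sin (t * L (p ω)) ∂μ = (L y *
        ((∫ ω, Real.cos (t * L (p ω)) ∂μ) * t)) / β := by
      rw [h1, mul_div_cancel_left₀ _ hβ]
    rw [h2]
    ring
  let D : ℝ → ℂ := fun t => ∫ ω, Complex.exp (((t * L (p ω) : ℝ) : ℂ) * I) ∂μ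
  have hDe (t : ℝ) : D t = ((∫ ω, Real.cos (t * L (p ω)) ∂μ : ℝ) : ℂ) +
      ((∫ ω, Real.sin (t * L (p ω)) ∂μ : ℝ) : ℂ) * I := by
    simp only [D, Complex.exp_mul_I, ← ofReal_cos, ← ofReal_sin]
    have hCc : Integrable (fun ω => ((Real.cos (t * L (p ω)) : ℝ) : ℂ)) μ := (hC t).ofReal
    have hSc : Integrable (fun ω => ((Real.sin (t * L (p ω)) : ℝ) : ℂ) * I) μ :=
      (hS t).ofReal.mul_const I
    rw [integral_add hCc hSc, integral_mul_const, integral_complex_ofReal,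
      integral_complex_ofReal]
  -- Differentiation under the integral is dominated by `|L ∘ p|`; the resulting first moments are
  -- eliminated by `hcos` and `hsin`.
  have hDd (t : ℝ) : HasDerivAt D (-(((L y / β) * t : ℝ) : ℂ) * D t) t := by
    have hd := (hasDerivAt_integral_of_dominated_loc_of_deriv_le (μ := μ)
      (F := fun (t : ℝ) ω => Complex.exp (((t * L (p ω) : ℝ) : ℂ) * I))
      (F' := fun (t : ℝ) ω => Complex.exp (((t * L (p ω) : ℝ) : ℂ) * I) *
        ((L (p ω) : ℝ) * I)) (x₀ := t)
      (s := Set.univ) (bound := fun ω => |L (p ω)|) univ_mem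
      (Eventually.of_forall fun t => (Complex.measurable_exp.comp
        ((Complex.measurable_ofReal.comp (hLm.const_mul t)).mul_const I)).aestronglyMeasurable)
      (Integrable.of_bound ((Complex.measurable_exp.comp
        ((Complex.measurable_ofReal.comp (hLm.const_mul t)).mul_const I)).aestronglyMeasurable) 1
        (Eventually.of_forall fun ω => (Complex.norm_exp_ofReal_mul_I _).le))
      (((Complex.measurable_exp.comp
        ((Complex.measurable_ofReal.comp (hLm.const_mul t)).mul_const I)).mul
        ((Complex.measurable_ofReal.comp hLm).mul_const I)).aestronglyMeasurable)
      (Eventually.of_forall fun ω t _ => by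
        rw [norm_mul, Complex.norm_exp_ofReal_mul_I, one_mul, norm_mul, Complex.norm_I, mul_one,
          Complex.norm_real, Real.norm_eq_abs])
      hL.abs
      (Eventually.of_forall fun ω t _ => by
        have h1 : HasDerivAt (fun t : ℝ => t * L (p ω)) (L (p ω)) t := by
          simpa using (hasDerivAt_id t).mul_const (L (p ω))
        exact (h1.ofReal_comp.mul_const I).cexp)).2
    refine hd.congr_deriv ?_
    rw [hDe]
    have h1 (ω : Ω) : Complex.exp (((t * L (p ω) : ℝ) : ℂ) * I) * ((L (p ω) : ℝ) * I) =
        ((L (p ω) * Real.cos (t * L (p ω)) : ℝ) : ℂ) * I +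
          -((L (p ω) * Real.sin (t * L (p ω)) : ℝ) : ℂ) := by
      rw [Complex.exp_mul_I, ← ofReal_cos, ← ofReal_sin]
      push_cast
      linear_combination (L (p ω) : ℂ) * Complex.sin (t * L (p ω)) * Complex.I_mul_I
    simp only [h1]
    have hCc : Integrable (fun ω => ((L (p ω) * Real.cos (t * L (p ω)) : ℝ) : ℂ) * I) μ :=
      (hLC t).ofReal.mul_const I
    have hSc : Integrable (fun ω => -((L (p ω) * Real.sin (t * L (p ω)) : ℝ) : ℂ)) μ :=
      (hLS t).ofReal.neg
    rw [integral_add hCc hSc, integral_mul_const, integral_neg, integral_complex_ofReal,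
      integral_complex_ofReal, hcos, hsin]
    push_cast
    ring
  have h0 : D 0 = 1 := by simp [D]
  have := gaussian_of_hasDerivAt hDd h0 1
  simpa [D] using this

end CharFun

/-! ### KMS measures have Gaussian Fourier transform -/

section KMSFourier

open Filter Topology

/-- The linear form `x ↦ ∑ k, a_k x_k + b_k y_k`. -/
def dotForm {n : ℕ} (a : (Fin n → ℝ) × (Fin n → ℝ)) : ((Fin n → ℝ) × (Fin n → ℝ)) →L[ℝ] ℝ :=
  ∑ k, (a.1 k • (ContinuousLinearMap.proj k ∘L ContinuousLinearMap.fst ℝ _ _) +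
    a.2 k • (ContinuousLinearMap.proj k ∘L ContinuousLinearMap.snd ℝ _ _))

lemma dotForm_apply {n : ℕ} (a x : (Fin n → ℝ) × (Fin n → ℝ)) :
    dotForm a x = ∑ k, (a.1 k * x.1 k + a.2 k * x.2 k) := by
  simp [dotForm]

lemma clm_prod_pi_apply {n : ℕ} (D : ((Fin n → ℝ) × (Fin n → ℝ)) →L[ℝ] ℝ)
    (x : (Fin n → ℝ) × (Fin n → ℝ)) :
    D x = ∑ k, (x.1 k * D (Pi.single k 1, 0) + x.2 k * D (0, Pi.single k 1)) := by
  have hx : x = ∑ k, (x.1 k • ((Pi.single k 1, 0) : (Fin n → ℝ) × (Fin n → ℝ)) +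
      x.2 k • ((0, Pi.single k 1) : (Fin n → ℝ) × (Fin n → ℝ))) := by
    ext j
    · simp [Prod.fst_sum, Finset.sum_apply, Pi.single_apply]
    · simp [Prod.snd_sum, Finset.sum_apply, Pi.single_apply]
  conv_lhs => rw [hx]
  simp only [map_sum, map_add, map_smul, smul_eq_mul]

variable [CompleteSpace ℋ] {H : ℋ →ₗ.[ℂ] ℋ} {B : EigenBasis H} {s β : ℝ}
  {μ : Measure (NegSobolev H s)}

lemma GoodInverse.pairing_ofCoord_eq_dotForm (h : GoodInverse H s) {n : ℕ}
    (a : (Fin n → ℝ) × (Fin n → ℝ)) (u : NegSobolev H s) :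
    pairing H s (ofCoord B a) u = dotForm a (cylProj B s n u) := by
  rw [h.pairing_ofCoord, dotForm_apply]

/-- A KMS measure only promises integrability of `⟨iHf, u⟩`. The vector `f = -i H⁻¹ a`, with
coordinates `b`, makes this `⟨a, u⟩`. -/
lemma integrable_dotForm (h : GoodInverse H s) {n : ℕ} (hn : (n : ℕ∞) ≤ B.N)
    (hμ : IsKMSMeasure B s β μ) (a : (Fin n → ℝ) × (Fin n → ℝ)) :
    Integrable (fun u => dotForm a (cylProj B s n u)) μ := by
  let b : (Fin n → ℝ) × (Fin n → ℝ) :=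
    (fun k => B.tauFin hn k * a.2 k, fun k => -(B.tauFin hn k * a.1 k))
  obtain ⟨hd, hd'⟩ := h.exists_H_ofCoord hn b
  have h1 : ofCoord B (fun k => -((B.tauFin hn k)⁻¹ * b.2 k),
      fun k => (B.tauFin hn k)⁻¹ * b.1 k) = ofCoord B a := by
    congr 1
    ext k
    · simp only [b, mul_neg, neg_neg]
      rw [inv_mul_cancel_left₀ (h.tauFin_pos hn k).ne']
    · simp only [b]
      rw [inv_mul_cancel_left₀ (h.tauFin_pos hn k).ne']
  rw [h1] at hd'
  have hm : H ⟨ofCoord B b, hd⟩ ∈ sobolev H s := by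
    have : H ⟨ofCoord B b, hd⟩ = (-Complex.I) • ofCoord B a := by
      rw [← hd', smul_smul, neg_mul, Complex.I_mul_I, neg_neg, one_smul]
    rw [this]
    exact Submodule.smul_mem _ _ (h.ofCoord_mem_sobolev a)
  have h2 := hμ.1 ⟨ofCoord B b, hd⟩ (h.ofCoord_mem_sobolev b) hm
  refine h2.congr (Eventually.of_forall fun u => ?_)
  simp only [pairingX, dif_pos hd]
  rw [hd', h.pairing_ofCoord_eq_dotForm]

/-- For `F` with constant gradient `-i H⁻¹ a`, the bracket `{F, G}` is the derivative of `G` along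
`H⁻¹ a`, and `⟨∇F, X(u)⟩ = ⟨a, u⟩`. -/
lemma integral_fderiv_of_isKMSMeasure (h : GoodInverse H s) {n : ℕ} (hn : (n : ℕ∞) ≤ B.N)
    (hμ : IsKMSMeasure B s β μ) (a : (Fin n → ℝ) × (Fin n → ℝ))
    (ψ : (Fin n → ℝ) × (Fin n → ℝ) → ℝ) (hψ : ContDiff ℝ (⊤ : ℕ∞) ψ)
    (hψc : HasCompactSupport ψ) :
    ∫ u, fderiv ℝ ψ (cylProj B s n u)
        (fun k => B.tauFin hn k * a.1 k, fun k => B.tauFin hn k * a.2 k) ∂μ =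
      β * ∫ u, dotForm a (cylProj B s n u) * ψ (cylProj B s n u) ∂μ := by
  obtain ⟨R, hR0, hR⟩ := hψc.isCompact.isBounded.subset_ball_lt 0 0
  -- A linear `F` lacks compact support. The bump is `1` on a ball containing the support of `ψ`, so
  -- `φ` is linear near that support; elsewhere `ψ` and its derivative kill both integrands.
  let χ : ContDiffBump (0 : (Fin n → ℝ) × (Fin n → ℝ)) := ⟨R, R + 1, hR0, by linarith⟩
  let b : (Fin n → ℝ) × (Fin n → ℝ) :=
    (fun k => B.tauFin hn k * a.2 k, fun k => -(B.tauFin hn k * a.1 k))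
  let φ : (Fin n → ℝ) × (Fin n → ℝ) → ℝ := fun x => dotForm b x * χ x
  have hφd (x) (hx : x ∈ tsupport ψ) : fderiv ℝ φ x = dotForm b := by
    have h1 : φ =ᶠ[𝓝 x] dotForm b := by
      filter_upwards [χ.eventuallyEq_one_of_mem_ball (hR hx)] with y hy
      change dotForm b y * χ y = _
      rw [hy, Pi.one_apply, mul_one]
    rw [h1.fderiv_eq, ContinuousLinearMap.fderiv]
  let F : CylTest B.N := ⟨n, hn, φ, (dotForm b).contDiff.mul χ.contDiff,
    χ.hasCompactSupport.mul_left⟩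
  let G : CylTest B.N := ⟨n, hn, ψ, hψ, hψc⟩
  have hb1 (k : Fin n) : dotForm b (Pi.single k 1, 0) = b.1 k := by
    simp [dotForm_apply, Pi.single_apply]
  have hb2 (k : Fin n) : dotForm b (0, Pi.single k 1) = b.2 k := by
    simp [dotForm_apply, Pi.single_apply]
  have key := hμ.2 F G
  have hl (u : NegSobolev H s) : symplForm (cylGrad B s F u) (cylGrad B s G u) =
      fderiv ℝ ψ (cylProj B s n u)
        (fun k => B.tauFin hn k * a.1 k, fun k => B.tauFin hn k * a.2 k) := by
    rw [clm_prod_pi_apply, cylGrad_eq_ofCoord, cylGrad_eq_ofCoord, symplForm_ofCoord F.hn G.hn]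
    refine Finset.sum_congr rfl fun k _ => ?_
    rw [Finset.sum_eq_single k]
    · simp only [if_true]
      change fderiv ℝ φ (cylProj B s n u) (Pi.single k 1, 0) *
          fderiv ℝ ψ (cylProj B s n u) (0, Pi.single k 1) -
        fderiv ℝ φ (cylProj B s n u) (0, Pi.single k 1) *
          fderiv ℝ ψ (cylProj B s n u) (Pi.single k 1, 0) = _
      by_cases hx : cylProj B s n u ∈ tsupport ψ
      · rw [hφd _ hx, hb1, hb2]
        simp only [b]
        ring
      · have h0 : fderiv ℝ ψ (cylProj B s n u) = 0 := by
          by_contra hne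
          exact hx (support_fderiv_subset ℝ hne)
        simp [h0]
    · intro l _ hl
      rw [if_neg (fun hkl => hl (Fin.ext hkl.symm))]
    · simp
  have hr (u : NegSobolev H s) : pairingX H s (cylGrad B s F u) u * cylFun B s G u =
      dotForm a (cylProj B s n u) * ψ (cylProj B s n u) := by
    change _ * ψ (cylProj B s n u) = _
    by_cases hx : cylProj B s n u ∈ tsupport ψ
    · congr 1
      rw [cylGrad_eq_ofCoord, h.pairingX_ofCoord F.hn, dotForm_apply]
      refine Finset.sum_congr rfl fun k _ => ?_
      change (B.tauFin hn k)⁻¹ * (fderiv ℝ φ (cylProj B s n u) (Pi.single k 1, 0) *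
        (cylProj B s n u).2 k - fderiv ℝ φ (cylProj B s n u) (0, Pi.single k 1) *
        (cylProj B s n u).1 k) = _
      rw [hφd _ hx, hb1, hb2]
      have := (h.tauFin_pos hn k).ne'
      simp only [b]
      field_simp
      ring
    · rw [image_eq_zero_of_notMem_tsupport hx, mul_zero, mul_zero]
  simp only [hl, hr] at key
  exact key

lemma fourierMeas_ofCoord [IsProbabilityMeasure μ] (h : GoodInverse H s) (hβ : β ≠ 0)
    (hμ : IsKMSMeasure B s β μ) {n : ℕ} (hn : (n : ℕ∞) ≤ B.N)
    (a : (Fin n → ℝ) × (Fin n → ℝ)) :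
    fourierMeas H s μ (ofCoord B a) = Complex.exp
      ((-((⟪ofCoord B a, boundedInv H (ofCoord B a)⟫_ℂ).re / β / 2) : ℝ) : ℂ) := by
  have h1 := integral_cexp_of_testFunctions (measurable_cylProj h n) hβ
    (integrable_dotForm h hn hμ a) (integral_fderiv_of_isKMSMeasure h hn hμ a)
  rw [dotForm_apply] at h1
  rw [inner_self_boundedInv_ofCoord h hn]
  unfold fourierMeas
  simp only [h.pairing_ofCoord_eq_dotForm, h1]
  congr 5
  refine Finset.sum_congr rfl fun k _ => ?_
  ring

lemma fourierMeas_negPow (g : ℋ) : fourierMeas H s μ (negPow H (s / 2) g) =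
    ∫ u, Complex.exp (((⟪g, negSobolevMap H s u⟫_ℂ).re : ℂ) * Complex.I) ∂μ := by
  unfold fourierMeas
  simp only [pairing_negPow]

lemma continuous_fourierMeas_negPow [IsFiniteMeasure μ] :
    Continuous fun g => fourierMeas H s μ (negPow H (s / 2) g) := by
  simp only [fourierMeas_negPow]
  have hJ := (isometry_negSobolevMap H s).continuous
  refine continuous_of_dominated (bound := fun _ => 1) ?_ ?_ (integrable_const _) ?_
  · intro g
    have : Continuous fun u => Complex.exp
        (((⟪g, negSobolevMap H s u⟫_ℂ).re : ℂ) * Complex.I) := by fun_prop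
    exact this.measurable.aestronglyMeasurable
  · exact fun g => Eventually.of_forall fun u => (Complex.norm_exp_ofReal_mul_I _).le
  · exact Eventually.of_forall fun u => by fun_prop

/-- Basis expansions converge along finite index sets, whereas cylinders use initial segments. With
`n` one more than the largest index of `F`, the missing coordinates are set to zero. -/
lemma exists_ofCoord_eq_sum (F : Finset B.Idx) (c : B.Idx → ℂ) :
    ∃ (n : ℕ) (_ : (n : ℕ∞) ≤ B.N) (a : (Fin n → ℝ) × (Fin n → ℝ)),
      ∑ k ∈ F, c k • B.basis k = ofCoord B a := by
  classical
  have hn : ((F.sup fun k => k.1 + 1 : ℕ) : ℕ∞) ≤ B.N := by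
    induction F using Finset.induction_on with
    | empty => simp
    | insert k F hk ih =>
      rw [Finset.sup_insert]
      have : ((k.1 + 1 : ℕ) : ℕ∞) ≤ B.N := by
        push_cast
        exact Order.add_one_le_of_lt k.2
      rcases le_total (k.1 + 1) (F.sup fun k => k.1 + 1) with h | h
      · rwa [sup_eq_right.2 h]
      · rwa [sup_eq_left.2 h]
  set n := F.sup fun k => k.1 + 1 with hndef
  let i : Fin n → B.Idx := fun k => ⟨k, lt_of_lt_of_le (by exact_mod_cast k.2) hn⟩
  refine ⟨n, hn, (fun k => if i k ∈ F then (c (i k)).re else 0,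
    fun k => if i k ∈ F then (c (i k)).im else 0), ?_⟩
  unfold ofCoord
  have h1 : ∀ k : Fin n, (((if i k ∈ F then (c (i k)).re else 0 : ℝ) : ℂ) • B.e k +
      ((if i k ∈ F then (c (i k)).im else 0 : ℝ) : ℂ) • (Complex.I • B.e k)) =
      if i k ∈ F then c (i k) • B.basis (i k) else 0 := by
    intro k
    rw [EigenBasis.e_fin hn]
    split_ifs
    · rw [smul_smul, ← add_smul, Complex.re_add_im]
    · simp
  simp only [h1]
  rw [← Finset.sum_filter]
  refine (Finset.sum_bij (fun k _ => i k) ?_ ?_ ?_ fun _ _ => rfl).symm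
  · intro k hk
    exact (Finset.mem_filter.1 hk).2
  · intro k _ l _ hkl
    exact Fin.ext (congrArg Subtype.val hkl)
  · intro k hk
    have hlt : k.1 < n := Nat.lt_of_succ_le (Finset.le_sup (f := fun k : B.Idx => k.1 + 1) hk)
    exact ⟨⟨k.1, hlt⟩, by simpa [i] using hk, rfl⟩

lemma continuous_inner_self_comp (T S : ℋ →L[ℂ] ℋ) (β : ℝ) : Continuous fun g =>
    Complex.exp ((-((⟪S g, T (S g)⟫_ℂ).re / β / 2) : ℝ) : ℂ) := by
  fun_prop

/-- KMS measures have Gaussian Fourier transform. -/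
theorem fourierMeas_of_isKMSMeasure [IsProbabilityMeasure μ] (h : GoodInverse H s) (hβ : β ≠ 0)
    (hμ : IsKMSMeasure B s β μ) {f : ℋ} (hf : f ∈ sobolev H s) :
    fourierMeas H s μ f =
      Complex.exp ((-((⟪f, boundedInv H f⟫_ℂ).re / β / 2) : ℝ) : ℂ) := by
  obtain ⟨g, rfl⟩ := mem_sobolev_iff.1 hf
  have h1 := B.basis.hasSum_repr g
  have h2 := (continuous_fourierMeas_negPow (μ := μ)).continuousAt.tendsto.comp h1
  have h3 := (continuous_inner_self_comp (boundedInv H) (negPow H (s / 2))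
    β).continuousAt.tendsto.comp h1
  refine tendsto_nhds_unique h2 (h3.congr fun F => ?_)
  -- `H^{-s/2}` is diagonal, so it maps partial sums of `g` to cylindrical vectors, where the
  -- formula is known; both sides are continuous in `g`.
  have h4 : negPow H (s / 2) (∑ k ∈ F, B.basis.repr g k • B.basis k) =
      ∑ k ∈ F, (B.basis.repr g k * ((B.tau k ^ (s / 2) : ℝ) : ℂ)) • B.basis k := by
    rw [map_sum]
    refine Finset.sum_congr rfl fun k _ => ?_
    rw [map_smul, h.negPow_basis, smul_smul]
  obtain ⟨n, hn, a, ha⟩ := exists_ofCoord_eq_sum F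
    fun k => B.basis.repr g k * ((B.tau k ^ (s / 2) : ℝ) : ℂ)
  simp only [Function.comp]
  rw [h4, ha, fourierMeas_ofCoord h hβ hμ hn]

end KMSFourier

/-! ### The Weyl relations and the GNS representation -/

section Weyl

open Filter Topology UniformSpace

lemma weylFun_apply (f g : ℋ) :
    weylFun f g = Complex.exp ((((⟪f, g⟫_ℂ).re : ℝ) : ℂ) * Complex.I) := rfl

lemma weylFun_add (f g : ℋ) : weylFun (f + g) = weylFun f * weylFun g := by
  ext x
  simp only [weylFun_apply, BoundedContinuousFunction.mul_apply, ← Complex.exp_add,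
    inner_add_left, add_re, ofReal_add, add_mul]

lemma weylFun_zero : weylFun (0 : ℋ) = 1 := by
  ext x
  simp [weylFun_apply]

lemma star_weylFun (f : ℋ) : star (weylFun f) = weylFun (-f) := by
  ext x
  rw [BoundedContinuousFunction.star_apply, weylFun_apply, weylFun_apply, Complex.star_def,
    ← Complex.exp_conj]
  simp

lemma weyl_add (f g : ℋ) : weyl (f + g) = weyl f * weyl g := Subtype.ext (weylFun_add f g)

lemma weyl_zero : weyl (0 : ℋ) = 1 := Subtype.ext weylFun_zero

lemma star_weyl (f : ℋ) : star (weyl f) = weyl (-f) := Subtype.ext (star_weylFun f)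

lemma norm_weyl_le (f : ℋ) : ‖weyl f‖ ≤ 1 :=
  BoundedContinuousFunction.norm_ofNormedAddCommGroup_le _ zero_le_one
    fun _ => (Complex.norm_exp_ofReal_mul_I _).le

/-- The span of the Weyl elements is dense. -/
lemma mem_closure_span_weyl (a : WeylAlg ℋ) :
    a ∈ closure (Submodule.span ℂ (Set.range (weyl : ℋ → WeylAlg ℋ)) : Set (WeylAlg ℋ)) := by
  let S := Submodule.span ℂ (Set.range (weylFun : ℋ → BoundedContinuousFunction ℋ ℂ))
  -- By the Weyl relations the plain linear span is already a ⋆-algebra, so it contains the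
  -- generated one.
  have hmul : ∀ x ∈ S, ∀ y ∈ S, x * y ∈ S := by
    intro x hx y hy
    induction hx using Submodule.span_induction with
    | mem x hx =>
      obtain ⟨f, rfl⟩ := hx
      induction hy using Submodule.span_induction with
      | mem y hy =>
        obtain ⟨g, rfl⟩ := hy
        rw [← weylFun_add]
        exact Submodule.subset_span ⟨_, rfl⟩
      | zero => simp
      | add y z _ _ hy hz => rw [mul_add]; exact S.add_mem hy hz
      | smul c y _ hy => rw [mul_smul_comm]; exact S.smul_mem c hy
    | zero => simp
    | add x z _ _ hx hz => rw [add_mul]; exact S.add_mem hx hz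
    | smul c x _ hx => rw [smul_mul_assoc]; exact S.smul_mem c hx
  have hstar : ∀ x ∈ S, star x ∈ S := by
    intro x hx
    induction hx using Submodule.span_induction with
    | mem x hx =>
      obtain ⟨f, rfl⟩ := hx
      rw [star_weylFun]
      exact Submodule.subset_span ⟨_, rfl⟩
    | zero => simp
    | add x z _ _ hx hz => rw [star_add]; exact S.add_mem hx hz
    | smul c x _ hx => rw [star_smul]; exact S.smul_mem _ hx
  have hadj : ∀ x ∈ StarAlgebra.adjoin ℂ (Set.range (weylFun : ℋ → _)), x ∈ S := by
    intro x hx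
    induction hx using StarAlgebra.adjoin_induction with
    | mem x hx => exact Submodule.subset_span hx
    | algebraMap r =>
      rw [Algebra.algebraMap_eq_smul_one, ← weylFun_zero]
      exact S.smul_mem _ (Submodule.subset_span ⟨_, rfl⟩)
    | add x y _ _ hx hy => exact S.add_mem hx hy
    | mul x y _ _ hx hy => exact hmul x hx y hy
    | star x _ hx => exact hstar x hx
  have himg : (S : Set (BoundedContinuousFunction ℋ ℂ)) ⊆ (Subtype.val : WeylAlg ℋ → _) ''
      (Submodule.span ℂ (Set.range (weyl : ℋ → WeylAlg ℋ)) : Set (WeylAlg ℋ)) := by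
    intro x hx
    induction hx using Submodule.span_induction with
    | mem x hx =>
      obtain ⟨f, rfl⟩ := hx
      exact ⟨weyl f, Submodule.subset_span ⟨f, rfl⟩, rfl⟩
    | zero => exact ⟨0, zero_mem _, rfl⟩
    | add x y _ _ hx hy =>
      obtain ⟨x', hx', rfl⟩ := hx
      obtain ⟨y', hy', rfl⟩ := hy
      exact ⟨x' + y', add_mem hx' hy', rfl⟩
    | smul c x _ hx =>
      obtain ⟨x', hx', rfl⟩ := hx
      exact ⟨c • x', Submodule.smul_mem _ c hx', rfl⟩
  rw [closure_subtype]
  have h2 : (a : BoundedContinuousFunction ℋ ℂ) ∈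
      closure (StarAlgebra.adjoin ℂ (Set.range (weylFun : ℋ → _)) :
        Set (BoundedContinuousFunction ℋ ℂ)) := a.2
  exact closure_mono (fun x hx => himg (hadj x hx)) h2

variable (ω : WeylAlg ℋ →ₚ[ℂ] ℂ)

/-- The vector `π(a) Ω`. -/
def gnsMk (a : WeylAlg ℋ) : ω.GNS := ((ω.toPreGNS a : ω.PreGNS) : Completion ω.PreGNS)

lemma gns_apply_gnsMk (a b : WeylAlg ℋ) : ω.gnsStarAlgHom a (gnsMk ω b) = gnsMk ω (a * b) := by
  change ω.gnsNonUnitalStarAlgHom a ((ω.toPreGNS b : ω.PreGNS) : Completion ω.PreGNS) = _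
  rw [PositiveLinearMap.gnsNonUnitalStarAlgHom_apply_coe]
  rfl

lemma gnsVec_eq : gnsVec ω = gnsMk ω 1 := rfl

lemma gns_apply_gnsVec (a : WeylAlg ℋ) : ω.gnsStarAlgHom a (gnsVec ω) = gnsMk ω a := by
  rw [gnsVec_eq, gns_apply_gnsMk, mul_one]

lemma inner_gnsMk (a b : WeylAlg ℋ) : ⟪gnsMk ω a, gnsMk ω b⟫_ℂ = ω (star a * b) := by
  unfold gnsMk
  rw [Completion.inner_coe]
  rfl

lemma norm_gnsStarAlgHom_le (a : WeylAlg ℋ) : ‖ω.gnsStarAlgHom a‖ ≤ ‖a‖ :=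
  NonUnitalStarAlgHom.norm_apply_le ω.gnsStarAlgHom a

lemma continuous_gnsStarAlgHom : Continuous ω.gnsStarAlgHom :=
  AddMonoidHomClass.continuous_of_bound ω.gnsStarAlgHom 1
    fun a => by simpa using norm_gnsStarAlgHom_le ω a

lemma continuous_gnsMk : Continuous (gnsMk ω) := by
  have : gnsMk ω = fun a => ω.gnsStarAlgHom a (gnsVec ω) :=
    funext fun a => (gns_apply_gnsVec ω a).symm
  rw [this]
  exact (ContinuousLinearMap.apply ℂ ω.GNS (gnsVec ω)).continuous.comp
    (continuous_gnsStarAlgHom ω)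

/-- Continuity is automatic, since `ω(a) = ⟪Ω, π(a) Ω⟫` and `π` is contractive. -/
lemma continuous_state : Continuous ω := by
  have : (ω : WeylAlg ℋ → ℂ) = fun a => ⟪gnsVec ω, gnsMk ω a⟫_ℂ := by
    ext a
    rw [gnsVec_eq, inner_gnsMk, star_one, one_mul]
  rw [this]
  exact continuous_const.inner (continuous_gnsMk ω)

variable {ω}

/-- A state is determined by its values on the Weyl elements. -/
lemma state_ext {ω' : WeylAlg ℋ →ₚ[ℂ] ℂ} (h : ∀ f, ω (weyl f) = ω' (weyl f)) : ω = ω' := by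
  refine PositiveLinearMap.ext fun a => ?_
  have hcl : IsClosed {a | ω a = ω' a} := isClosed_eq (continuous_state ω) (continuous_state ω')
  refine hcl.closure_subset_iff.2 ?_ (mem_closure_span_weyl a)
  intro x hx
  induction hx using Submodule.span_induction with
  | mem x hx => obtain ⟨f, rfl⟩ := hx; exact h f
  | zero => simp
  | add x y _ _ hx hy => simp_all
  | smul c x _ hx => simp_all

variable (ω) in
lemma gnsOrbit_gnsMk_weyl (f k : ℋ) (t : ℝ) :
    gnsOrbit ω f (gnsMk ω (weyl k)) t = gnsMk ω (weyl ((t : ℂ) • f + k)) := by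
  unfold gnsOrbit
  rw [gns_apply_gnsMk, weyl_add]

/-- The algebra is commutative, so `π(W(k))` commutes with the group and carries differentiability
of the orbit of `Ω` to that of `π(W(k)) Ω`. Hence the `deriv` in `expField` is a genuine derivative
and not the default `0`. -/
lemma hasDerivAt_state_weyl {h : ℋ} (hd : DifferentiableAt ℝ (gnsOrbit ω h (gnsVec ω)) 0)
    (k : ℋ) :
    HasDerivAt (fun t : ℝ => ω (weyl (k + (t : ℂ) • h))) (Complex.I * expField ω h k) 0 := by
  let x : ω.GNS := ω.gnsStarAlgHom (weyl k) (gnsVec ω)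
  have h1 : gnsOrbit ω h x = fun t => ω.gnsStarAlgHom (weyl k) (gnsOrbit ω h (gnsVec ω) t) := by
    ext t
    simp only [x, gns_apply_gnsVec, gnsOrbit, gns_apply_gnsMk, ← weyl_add, add_comm]
  have h2 : DifferentiableAt ℝ (gnsOrbit ω h x) 0 := by
    rw [h1]
    exact ((ω.gnsStarAlgHom (weyl k)).restrictScalars ℝ).differentiableAt.comp 0 hd
  have h3 : HasDerivAt (fun t => ⟪gnsVec ω, gnsOrbit ω h x t⟫_ℂ)
      (⟪gnsVec ω, deriv (gnsOrbit ω h x) 0⟫_ℂ) 0 :=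
    (((innerSL ℂ (gnsVec ω)).restrictScalars ℝ).hasFDerivAt).comp_hasDerivAt 0 h2.hasDerivAt
  have h4 : Complex.I * expField ω h k = ⟪gnsVec ω, deriv (gnsOrbit ω h x) 0⟫_ℂ := by
    unfold expField
    rw [inner_smul_right, ← mul_assoc, mul_neg, Complex.I_mul_I, neg_neg, one_mul]
  rw [h4]
  convert h3 using 2 with t
  simp only [x]
  rw [gns_apply_gnsVec, gnsOrbit_gnsMk_weyl, gnsVec_eq, inner_gnsMk, star_one, one_mul, add_comm]

lemma weylSum_single (f : ℋ) (c : ℂ) : weylSum (Finsupp.single f c) = c • weyl f := by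
  simp [weylSum]

variable {H : ℋ →ₗ.[ℂ] ℋ} {β : ℝ}

/-- The infinitesimal form of the weak KMS condition. -/
lemma IsWeakKMS.hasDerivAt (hω : IsWeakKMS H β ω) (hβ : β ≠ 0) (f : H.domain) {k : ℋ}
    (hk : k ∈ H.domain) :
    HasDerivAt (fun t : ℝ => ω (weyl (k + (t : ℂ) • (Complex.I • H f))))
      ((symplForm k f / β : ℝ) * ω (weyl k)) 0 := by
  have h1 := hasDerivAt_state_weyl (hω.2.1.2 (Complex.I • H f)) k
  refine h1.congr_deriv ?_
  -- With `a = W(f)` and `b = W(k - f)` the product is `W(k)`, and `σ(k - f, f) = σ(k, f)`.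
  have h2 := hω.2.2 (Finsupp.single f 1) (Finsupp.single ⟨k - f, sub_mem hk f.2⟩ 1)
  have h3 : symplForm (k - f) (f : ℋ) = symplForm k f := by
    unfold symplForm
    rw [inner_sub_left, sub_im]
    have : (⟪(f : ℋ), f⟫_ℂ).im = 0 := inner_self_im (𝕜 := ℂ) _
    rw [this, sub_zero]
  simp only [Finsupp.mapDomain_single, weylBracket, expMulDeriv] at h2
  simp only [Finsupp.sum_single_index, zero_mul, mul_zero, Finsupp.single_zero,
    weylSum_single, mul_one, one_mul, map_smul, add_sub_cancel, h3, smul_eq_mul] at h2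
  have hβ' : (β : ℂ) ≠ 0 := by exact_mod_cast hβ
  rw [ofReal_div, div_mul_eq_mul_div, h2, mul_div_cancel_left₀ _ hβ']

/-- Weak KMS states are Gaussian on the domain of `H`. -/
theorem IsWeakKMS.apply_weyl (hω : IsWeakKMS H β ω) (hβ : β ≠ 0) {T : ℋ →L[ℂ] ℋ}
    (hT : IsBoundedInverse H T) {h : ℋ} (hh : h ∈ H.domain) :
    ω (weyl h) = Complex.exp ((-((⟪h, T h⟫_ℂ).re / β / 2) : ℝ) : ℂ) := by
  -- The vector `f = H⁻¹(-ih)` satisfies `iHf = h`, so at `k = t h` the KMS derivative is taken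
  -- along the ray itself. Membership of `h` in `D(H)` is needed to use `k = t h`.
  obtain ⟨hd, hd'⟩ := hT.exists_apply ((-Complex.I) • h)
  have h1 (t : ℝ) : HasDerivAt (fun t : ℝ => ω (weyl ((t : ℂ) • h)))
      (-(((⟪h, T h⟫_ℂ).re / β * t : ℝ) : ℂ) * ω (weyl ((t : ℂ) • h))) t := by
    have h2 := hω.hasDerivAt hβ ⟨_, hd⟩ (Submodule.smul_mem _ (t : ℂ) hh)
    rw [hd', smul_smul, mul_neg, Complex.I_mul_I, neg_neg, one_smul] at h2
    have h3 : symplForm ((t : ℂ) • h) (T ((-Complex.I) • h)) = -(t * (⟪h, T h⟫_ℂ).re) := by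
      unfold symplForm
      rw [map_smul, inner_smul_left, inner_smul_right, conj_ofReal, im_ofReal_mul]
      simp
    -- The derivative at `0` of `r ↦ ω(W(t h + r h))` is translated to the derivative at `t` of `r ↦
    -- ω(W(r h))`.
    rw [h3, show (0 : ℝ) = t - t by ring] at h2
    have h4 := h2.comp_sub_const t t
    simp only [← add_smul, ← ofReal_add, add_sub_cancel] at h4
    refine h4.congr_deriv ?_
    push_cast
    ring
  have h0 : ω (weyl (((0 : ℝ) : ℂ) • h)) = 1 := by
    rw [ofReal_zero, zero_smul, weyl_zero, hω.1]
  have := gaussian_of_hasDerivAt h1 h0 1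
  simpa using this

end Weyl

/-! ### Gaussian states are weak KMS states -/

section GaussianState

open Filter Topology

/-- The mixed difference quotients of a Gaussian function converge. -/
lemma tendsto_gaussian_mixed_slope (c : ℝ) :
    Tendsto (fun p : ℝ × ℝ => (p.1 * p.2)⁻¹ * (Real.exp (-(c * (p.1 - p.2) ^ 2 / 2)) -
      Real.exp (-(c * p.1 ^ 2 / 2)) - Real.exp (-(c * p.2 ^ 2 / 2)) + 1))
      (𝓝[≠] 0 ×ˢ 𝓝[≠] 0) (𝓝 c) := by
  let A : ℝ → ℝ := fun s => Real.exp (-(c * s ^ 2 / 2))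
  have hA0 : A 0 = 1 := by simp [A]
  have hAd : HasDerivAt A 0 0 := by
    have h1 : HasDerivAt (fun s : ℝ => -(c * s ^ 2 / 2)) 0 0 := by
      have := (((hasDerivAt_pow 2 (0 : ℝ)).const_mul c).div_const 2).neg
      refine this.congr_deriv ?_
      simp
    refine h1.exp.congr_deriv ?_
    simp
  have hAs : Tendsto (fun s => s⁻¹ * (1 - A s)) (𝓝[≠] 0) (𝓝 0) := by
    have := (hasDerivAt_iff_tendsto_slope_zero.1 hAd).neg
    simp only [zero_add, hA0, smul_eq_mul, neg_zero] at this
    refine this.congr fun s => ?_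
    ring
  have hAc : Tendsto A (𝓝[≠] 0) (𝓝 1) := by
    have := hAd.continuousAt.tendsto
    rw [hA0] at this
    exact this.mono_left nhdsWithin_le_nhds
  have hE : Tendsto (fun r => r⁻¹ * (Real.exp (c * r) - 1)) (𝓝[≠] 0) (𝓝 c) := by
    have h1 : HasDerivAt (fun r => Real.exp (c * r)) c 0 := by
      have := ((hasDerivAt_id (0 : ℝ)).const_mul c).exp
      refine this.congr_deriv ?_
      simp
    have := hasDerivAt_iff_tendsto_slope_zero.1 h1
    simpa using this
  have hm : Tendsto (fun p : ℝ × ℝ => p.1 * p.2) (𝓝[≠] 0 ×ˢ 𝓝[≠] 0) (𝓝[≠] 0) := by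
    refine tendsto_nhdsWithin_iff.2 ⟨?_, ?_⟩
    · have h1 : Tendsto (fun p : ℝ × ℝ => p.1) (𝓝[≠] 0 ×ˢ 𝓝[≠] 0) (𝓝 (0 : ℝ)) :=
        tendsto_fst.mono_right nhdsWithin_le_nhds
      have h2 : Tendsto (fun p : ℝ × ℝ => p.2) (𝓝[≠] 0 ×ˢ 𝓝[≠] 0) (𝓝 (0 : ℝ)) :=
        tendsto_snd.mono_right nhdsWithin_le_nhds
      simpa using h1.mul h2
    · have h1 : ∀ᶠ p : ℝ × ℝ in 𝓝[≠] 0 ×ˢ 𝓝[≠] 0, p.1 ∈ ({0}ᶜ : Set ℝ) :=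
        tendsto_fst.eventually self_mem_nhdsWithin
      have h2 : ∀ᶠ p : ℝ × ℝ in 𝓝[≠] 0 ×ˢ 𝓝[≠] 0, p.2 ∈ ({0}ᶜ : Set ℝ) :=
        tendsto_snd.eventually self_mem_nhdsWithin
      filter_upwards [h1, h2] with p hp1 hp2
      exact mul_ne_zero hp1 hp2
  have h1 := (((hAc.comp tendsto_fst).mul (hAc.comp tendsto_snd)).mul (hE.comp hm)).add
    ((hAs.comp tendsto_fst).mul (hAs.comp tendsto_snd))
  simp only [one_mul, mul_zero, add_zero] at h1
  refine h1.congr fun p => ?_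
  -- With this factorisation the bracket splits as `A s A t (exp (c s t) - 1) + (1 - A s) (1 - A
  -- t)`; after division by `s t`, only the first term survives in the limit.
  have h2 : Real.exp (-(c * (p.1 - p.2) ^ 2 / 2)) = A p.1 * A p.2 * Real.exp (c * (p.1 * p.2)) := by
    simp only [A, ← Real.exp_add]
    congr 1
    ring
  rw [h2]
  simp only [Function.comp, mul_inv, A]
  ring

/-- A curve with Gaussian Gram kernel is differentiable at the origin. -/
lemma differentiableAt_of_gaussian_inner {E : Type*} [NormedAddCommGroup E]
    [InnerProductSpace ℂ E] [CompleteSpace E] {x : ℝ → E} {c : ℝ}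
    (hx : ∀ s t, ⟪x s, x t⟫_ℂ = ((Real.exp (-(c * (s - t) ^ 2 / 2)) : ℝ) : ℂ)) :
    DifferentiableAt ℝ x 0 := by
  let K : ℝ → ℝ → ℝ := fun s t => (s * t)⁻¹ * (Real.exp (-(c * (s - t) ^ 2 / 2)) -
      Real.exp (-(c * s ^ 2 / 2)) - Real.exp (-(c * t ^ 2 / 2)) + 1)
  let q : ℝ → E := fun t => ((t⁻¹ : ℝ) : ℂ) • (x t - x 0)
  have hq (s t : ℝ) : ⟪q s, q t⟫_ℂ = (K s t : ℂ) := by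
    simp only [q, K, inner_smul_left, inner_smul_right, inner_sub_left, inner_sub_right, hx,
      conj_ofReal]
    simp
    ring
  have hn (s t : ℝ) : ‖q s - q t‖ ^ 2 = K s s - 2 * K s t + K t t := by
    have h1 : ‖q s - q t‖ ^ 2 = (⟪q s - q t, q s - q t⟫_ℂ).re :=
      (inner_self_eq_norm_sq (𝕜 := ℂ) _).symm
    have hsymm : K t s = K s t := by
      simp only [K, mul_comm t s, show (t - s) ^ 2 = (s - t) ^ 2 by ring]
      ring
    rw [h1, inner_sub_left, inner_sub_right, inner_sub_right, hq, hq, hq, hq]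
    simp only [sub_re, ofReal_re, hsymm]
    ring
  have hK := tendsto_gaussian_mixed_slope c
  have hdiag : Tendsto (fun t : ℝ => (t, t)) (𝓝[≠] 0) (𝓝[≠] 0 ×ˢ 𝓝[≠] 0) :=
    tendsto_id.prodMk tendsto_id
  -- All three inner products in `hn` tend to `c`, so the limit is `c - 2c + c = 0` and the
  -- difference quotients are Cauchy.
  have hlim : Tendsto (fun p : ℝ × ℝ => ‖q p.1 - q p.2‖ ^ 2) (𝓝[≠] 0 ×ˢ 𝓝[≠] 0) (𝓝 0) := by
    have h1 := (((hK.comp hdiag).comp tendsto_fst).sub (hK.const_mul 2)).add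
      ((hK.comp hdiag).comp tendsto_snd)
    rw [show c - 2 * c + c = 0 by ring] at h1
    exact h1.congr fun p => (hn p.1 p.2).symm
  have hc : Cauchy (map q (𝓝[≠] 0)) := by
    rw [cauchy_map_iff]
    refine ⟨inferInstance, ?_⟩
    rw [tendsto_uniformity_iff_dist_tendsto_zero]
    have h1 := hlim.sqrt
    rw [Real.sqrt_zero] at h1
    refine h1.congr fun p => ?_
    rw [Real.sqrt_sq (norm_nonneg _), dist_eq_norm]
  obtain ⟨d, hd⟩ := CompleteSpace.complete hc
  have : HasDerivAt x d 0 := by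
    rw [hasDerivAt_iff_tendsto_slope_zero]
    refine Tendsto.congr (fun t => ?_) hd
    simp only [q, zero_add]
    exact (Complex.coe_smul _ _)
  exact this.differentiableAt

variable {ω : WeylAlg ℋ →ₚ[ℂ] ℂ}

/-- Regularity of the GNS representation follows from continuity along lines. -/
lemma continuous_gnsOrbit {f : ℋ} (hω : Continuous fun t : ℝ => ω (weyl ((t : ℂ) • f)))
    (x : ω.GNS) : Continuous (gnsOrbit ω f x) := by
  have happ (x y : ω.GNS) (t : ℝ) : dist (gnsOrbit ω f x t) (gnsOrbit ω f y t) ≤ dist x y := by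
    rw [dist_eq_norm, dist_eq_norm]
    unfold gnsOrbit
    rw [← map_sub]
    refine (ContinuousLinearMap.le_opNorm _ _).trans ?_
    refine mul_le_of_le_one_left (norm_nonneg _) ?_
    exact (norm_gnsStarAlgHom_le ω _).trans (norm_weyl_le _)
  -- The orbit maps are contractive uniformly in `t`, so continuity survives limits and only the
  -- total set of vectors `π(W(k)) Ω` has to be checked.
  have hcl : IsClosed {x : ω.GNS | Continuous (gnsOrbit ω f x)} := by
    rw [← isSeqClosed_iff_isClosed]
    intro y x hy hyx
    refine continuous_of_uniform_approx_of_continuous fun u hu => ?_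
    obtain ⟨ε, hε, hεu⟩ := Metric.mem_uniformity_dist.1 hu
    obtain ⟨n, hn⟩ := (Metric.tendsto_atTop.1 hyx) ε hε
    refine ⟨gnsOrbit ω f (y n), hy n, fun t => hεu ?_⟩
    refine (happ _ _ t).trans_lt ?_
    rw [dist_comm]
    exact hn n le_rfl
  have hweyl (k : ℋ) : Continuous (gnsOrbit ω f (gnsMk ω (weyl k))) := by
    have hsq (t s : ℝ) : ‖gnsOrbit ω f (gnsMk ω (weyl k)) t -
        gnsOrbit ω f (gnsMk ω (weyl k)) s‖ ^ 2 =
        (ω (weyl (((0 : ℝ) : ℂ) • f)) - ω (weyl (((s - t : ℝ) : ℂ) • f)) -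
          ω (weyl (((t - s : ℝ) : ℂ) • f)) + ω (weyl (((0 : ℝ) : ℂ) • f))).re := by
      have h1 (v : ω.GNS) : ‖v‖ ^ 2 = (⟪v, v⟫_ℂ).re := (inner_self_eq_norm_sq (𝕜 := ℂ) _).symm
      have h2 (a b : ℝ) : ⟪gnsOrbit ω f (gnsMk ω (weyl k)) a,
          gnsOrbit ω f (gnsMk ω (weyl k)) b⟫_ℂ = ω (weyl (((b - a : ℝ) : ℂ) • f)) := by
        rw [gnsOrbit_gnsMk_weyl, gnsOrbit_gnsMk_weyl, inner_gnsMk, star_weyl, ← weyl_add]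
        congr 2
        push_cast
        module
      rw [h1, inner_sub_left, inner_sub_right, inner_sub_right, h2, h2, h2, h2, sub_self, sub_self]
      congr 1
      ring
    rw [continuous_iff_continuousAt]
    intro s
    rw [ContinuousAt, tendsto_iff_norm_sub_tendsto_zero]
    have h3 : Tendsto (fun t : ℝ => ‖gnsOrbit ω f (gnsMk ω (weyl k)) t -
        gnsOrbit ω f (gnsMk ω (weyl k)) s‖ ^ 2) (𝓝 s) (𝓝 0) := by
      simp only [hsq]
      have hc : Continuous fun t : ℝ => (ω (weyl (((0 : ℝ) : ℂ) • f)) -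
          ω (weyl (((s - t : ℝ) : ℂ) • f)) - ω (weyl (((t - s : ℝ) : ℂ) • f)) +
          ω (weyl (((0 : ℝ) : ℂ) • f))).re := by
        have e1 : Continuous fun t : ℝ => ω (weyl (((s - t : ℝ) : ℂ) • f)) :=
          hω.comp (continuous_const.sub continuous_id)
        have e2 : Continuous fun t : ℝ => ω (weyl (((t - s : ℝ) : ℂ) • f)) :=
          hω.comp (continuous_id.sub continuous_const)
        exact Complex.continuous_re.comp (((continuous_const.sub e1).sub e2).add continuous_const)
      have h4 := hc.tendsto s
      simpa using h4
    have h5 := h3.sqrt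
    rw [Real.sqrt_zero] at h5
    exact h5.congr fun t => Real.sqrt_sq (norm_nonneg _)
  have hspan (a : WeylAlg ℋ) : Continuous (gnsOrbit ω f (gnsMk ω a)) := by
    refine (hcl.preimage (continuous_gnsMk ω)).closure_subset_iff.2 ?_ (mem_closure_span_weyl a)
    intro a ha
    induction ha using Submodule.span_induction with
    | mem a ha => obtain ⟨k, rfl⟩ := ha; exact hweyl k
    | zero =>
      have : gnsOrbit ω f (gnsMk ω 0) = fun _ => gnsMk ω 0 := by
        ext t
        unfold gnsOrbit
        rw [gns_apply_gnsMk, mul_zero]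
      change Continuous (gnsOrbit ω f (gnsMk ω 0))
      rw [this]
      exact continuous_const
    | add a b _ _ ha hb =>
      have : gnsOrbit ω f (gnsMk ω (a + b)) =
          fun t => gnsOrbit ω f (gnsMk ω a) t + gnsOrbit ω f (gnsMk ω b) t := by
        ext t
        unfold gnsOrbit
        rw [← map_add]
        congr 1
        simp [gnsMk, UniformSpace.Completion.coe_add]
      change Continuous (gnsOrbit ω f (gnsMk ω (a + b)))
      rw [this]
      exact Continuous.add ha hb
    | smul c a _ ha =>
      have : gnsOrbit ω f (gnsMk ω (c • a)) = fun t => c • gnsOrbit ω f (gnsMk ω a) t := by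
        ext t
        unfold gnsOrbit
        rw [← map_smul]
        congr 1
        simp [gnsMk, UniformSpace.Completion.coe_smul]
      change Continuous (gnsOrbit ω f (gnsMk ω (c • a)))
      rw [this]
      exact Continuous.const_smul ha c
  induction x using UniformSpace.Completion.induction_on with
  | hp => exact hcl
  | ih x => exact hspan (ω.ofPreGNS x)

lemma isC2_of_gaussian {T : ℋ →L[ℂ] ℋ} {β : ℝ}
    (hω : ∀ f, ω (weyl f) = Complex.exp ((-((⟪f, T f⟫_ℂ).re / β / 2) : ℝ) : ℂ)) : IsC2 ω := by
  have hline (f : ℋ) (t : ℝ) : ω (weyl ((t : ℂ) • f)) =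
      ((Real.exp (-((⟪f, T f⟫_ℂ).re / β * t ^ 2 / 2)) : ℝ) : ℂ) := by
    rw [hω, ofReal_exp, map_smul, inner_smul_left, inner_smul_right, conj_ofReal, ← mul_assoc,
      ← ofReal_mul, re_ofReal_mul]
    congr 3
    ring
  constructor
  · intro f x
    refine continuous_gnsOrbit ?_ x
    simp only [hline]
    fun_prop
  · intro f
    refine differentiableAt_of_gaussian_inner (c := (⟪f, T f⟫_ℂ).re / β) fun s t => ?_
    unfold gnsOrbit
    rw [gns_apply_gnsVec, gns_apply_gnsVec, inner_gnsMk, star_weyl, ← weyl_add, ← neg_smul,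
      ← add_smul, ← ofReal_neg, ← ofReal_add, hline, show (-s + t) ^ 2 = (s - t) ^ 2 by ring]

/-- Gaussian states are weak KMS states. -/
theorem isWeakKMS_of_gaussian [CompleteSpace ℋ] {H : ℋ →ₗ.[ℂ] ℋ} {β : ℝ} (hβ : β ≠ 0)
    {T : ℋ →L[ℂ] ℋ} (hT : IsBoundedInverse H T) (hT0 : 0 ≤ T)
    (hω : ∀ f, ω (weyl f) = Complex.exp ((-((⟪f, T f⟫_ℂ).re / β / 2) : ℝ) : ℂ)) :
    IsWeakKMS H β ω := by
  have hC2 := isC2_of_gaussian hω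
  have hone : ω 1 = 1 := by
    rw [← weyl_zero, hω]
    simp
  refine ⟨hone, hC2, fun a b => ?_⟩
  have hβ' : (β : ℂ) ≠ 0 := by exact_mod_cast hβ
  -- On a pair of Weyl elements, differentiate the Gaussian along `k + t iHf`. As `T(iHf) = if`, the
  -- cross term is `Re ⟪k, if⟫ = -σ(g, f)`.
  have key (f g : H.domain) : (symplForm (g : ℋ) f : ℂ) * ω (weyl ((f : ℋ) + g)) =
      β * (Complex.I * expField ω (Complex.I • H f) ((f : ℋ) + g)) := by
    set k : ℋ := (f : ℋ) + g with hk
    set h : ℋ := Complex.I • H f with hh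
    have hTh : T h = Complex.I • (f : ℋ) := by rw [hh, map_smul, hT.apply_domain]
    have h1 := hasDerivAt_state_weyl (hC2.2 h) k
    have hsymm : (⟪h, T k⟫_ℂ).re = (⟪k, T h⟫_ℂ).re := by
      rw [← IsSymmetric_of_nonneg hT0, ← inner_conj_symm, conj_re]
    have h2 : HasDerivAt (fun t : ℝ => ω (weyl (k + (t : ℂ) • h)))
        (-((⟪k, T h⟫_ℂ).re / β : ℝ) * ω (weyl k)) 0 := by
      have e1 (t : ℝ) : ω (weyl (k + (t : ℂ) • h)) = Complex.exp ((-(((⟪k, T k⟫_ℂ).re +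
          2 * t * (⟪k, T h⟫_ℂ).re + t ^ 2 * (⟪h, T h⟫_ℂ).re) / β / 2) : ℝ) : ℂ) := by
        rw [hω]
        congr 6
        simp only [map_add, map_smul, inner_add_left, inner_add_right, inner_smul_left,
          inner_smul_right, conj_ofReal, add_re, re_ofReal_mul, hsymm]
        ring
      have e2 : HasDerivAt (fun t : ℝ => -(((⟪k, T k⟫_ℂ).re +
          2 * t * (⟪k, T h⟫_ℂ).re + t ^ 2 * (⟪h, T h⟫_ℂ).re) / β / 2))
          (-((⟪k, T h⟫_ℂ).re / β)) 0 := by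
        have := ((((((hasDerivAt_id (0 : ℝ)).const_mul 2).mul_const (⟪k, T h⟫_ℂ).re).const_add
          (⟪k, T k⟫_ℂ).re).add ((hasDerivAt_pow 2 (0 : ℝ)).mul_const
            (⟪h, T h⟫_ℂ).re)).div_const β).div_const 2 |>.neg
        refine this.congr_deriv ?_
        simp
        ring
      have e3 := e2.ofReal_comp.cexp
      simp only [← e1] at e3
      refine e3.congr_deriv ?_
      simp
      ring
    have h3 := h1.unique h2
    have h4 : (⟪k, T h⟫_ℂ).re = -symplForm (g : ℋ) f := by
      rw [hTh, inner_smul_right, hk, inner_add_left]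
      have : (⟪(f : ℋ), f⟫_ℂ).im = 0 := inner_self_im (𝕜 := ℂ) _
      rw [mul_comm, Complex.mul_I_re, add_im, this, zero_add]
      rfl
    rw [h3, h4]
    push_cast
    field_simp
  have hl : ω (weylSum (weylBracket (a.mapDomain Subtype.val) (b.mapDomain Subtype.val))) =
      a.sum fun f c => b.sum fun g d =>
        c * d * ((symplForm (g : ℋ) f : ℂ) * ω (weyl ((f : ℋ) + g))) := by
    let Λ : (ℋ →₀ ℂ) →ₗ[ℂ] ℂ := Finsupp.lsum ℂ fun f => (LinearMap.id : ℂ →ₗ[ℂ] ℂ).smulRight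
      (ω (weyl f))
    have hΛ (x : ℋ →₀ ℂ) : ω (weylSum x) = Λ x := by
      simp [Λ, weylSum, Finsupp.sum, Finsupp.lsum_apply]
    have hΛs (f : ℋ) (c : ℂ) : Λ (Finsupp.single f c) = c * ω (weyl f) := by
      simp [Λ]
    rw [hΛ]
    unfold weylBracket
    rw [Finsupp.sum_mapDomain_index_inj Subtype.val_injective, Finsupp.sum, map_sum]
    refine Finset.sum_congr rfl fun f _ => ?_
    rw [Finsupp.sum_mapDomain_index_inj Subtype.val_injective, Finsupp.sum, map_sum]
    refine Finset.sum_congr rfl fun g _ => ?_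
    rw [hΛs]
    ring
  rw [hl]
  unfold expMulDeriv
  rw [Finsupp.mul_sum]
  refine Finset.sum_congr rfl fun f _ => ?_
  dsimp only
  rw [Finsupp.mul_sum]
  refine Finset.sum_congr rfl fun g _ => ?_
  dsimp only
  rw [key]
  ring

end GaussianState

/-! ### States from limits of averages -/

section ExistsState

open Filter Topology

/-- The average of the elements of `𝒲(E, 0)` along a random vector of `E`. -/
def averageMap {Ω : Type*} [MeasurableSpace Ω] (μ : Measure Ω) [IsFiniteMeasure μ] (X : Ω → ℋ)
    (hX : ∀ a : BoundedContinuousFunction ℋ ℂ, AEStronglyMeasurable (fun u => a (X u)) μ) :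
    WeylAlg ℋ →ₗ[ℂ] ℂ where
  toFun a := ∫ u, (a : BoundedContinuousFunction ℋ ℂ) (X u) ∂μ
  map_add' a b := integral_add
    (Integrable.of_bound (hX _) ‖(a : BoundedContinuousFunction ℋ ℂ)‖
      (Eventually.of_forall fun _ => BoundedContinuousFunction.norm_coe_le_norm _ _))
    (Integrable.of_bound (hX _) ‖(b : BoundedContinuousFunction ℋ ℂ)‖
      (Eventually.of_forall fun _ => BoundedContinuousFunction.norm_coe_le_norm _ _))
  map_smul' c _ := integral_const_mul c _

lemma norm_averageMap_le {Ω : Type*} [MeasurableSpace Ω] {μ : Measure Ω} [IsProbabilityMeasure μ]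
    {X : Ω → ℋ}
    (hX : ∀ a : BoundedContinuousFunction ℋ ℂ, AEStronglyMeasurable (fun u => a (X u)) μ)
    (a : WeylAlg ℋ) : ‖averageMap μ X hX a‖ ≤ ‖a‖ := by
  have := norm_integral_le_of_norm_le_const (μ := μ) (C := ‖a‖) (Eventually.of_forall fun u =>
    BoundedContinuousFunction.norm_coe_le_norm (a : BoundedContinuousFunction ℋ ℂ) (X u))
  simpa [averageMap] using this

lemma averageMap_nonneg {Ω : Type*} [MeasurableSpace Ω] {μ : Measure Ω} [IsProbabilityMeasure μ]
    {X : Ω → ℋ}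
    (hX : ∀ a : BoundedContinuousFunction ℋ ℂ, AEStronglyMeasurable (fun u => a (X u)) μ)
    {a : WeylAlg ℋ} (ha : 0 ≤ a) : 0 ≤ averageMap μ X hX a := by
  obtain ⟨b, rfl⟩ := CStarAlgebra.nonneg_iff_eq_star_mul_self.1 ha
  have h1 (u : Ω) : ((star b * b : WeylAlg ℋ) : BoundedContinuousFunction ℋ ℂ) (X u) =
      ((Complex.normSq ((b : BoundedContinuousFunction ℋ ℂ) (X u)) : ℝ) : ℂ) :=
    (Complex.normSq_eq_conj_mul_self).symm
  change 0 ≤ ∫ u, ((star b * b : WeylAlg ℋ) : BoundedContinuousFunction ℋ ℂ) (X u) ∂μ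
  simp only [h1]
  rw [integral_complex_ofReal]
  exact_mod_cast integral_nonneg fun u => Complex.normSq_nonneg _

/-- A bounded net of positive functionals has a positive limit functional. -/
lemma exists_limit_state {ι : Type*} {l : Filter ι} [l.NeBot] (ψ : ι → WeylAlg ℋ →ₗ[ℂ] ℂ)
    (hb : ∀ i a, ‖ψ i a‖ ≤ ‖a‖) (hp : ∀ i a, 0 ≤ a → 0 ≤ ψ i a) :
    ∃ ω : WeylAlg ℋ →ₚ[ℂ] ℂ, ∀ a z, Tendsto (fun i => ψ i a) l (𝓝 z) → ω a = z := by
  -- Along an ultrafilter the values, confined to a disc of radius `‖a‖`, converge for every `a`;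
  -- they keep any limit that already exists along `l`.
  let U := Ultrafilter.of l
  have hU : (U : Filter ι) ≤ l := Ultrafilter.of_le l
  have hex (a : WeylAlg ℋ) : ∃ z, Tendsto (fun i => ψ i a) U (𝓝 z) := by
    obtain ⟨z, -, hz⟩ := (isCompact_closedBall (0 : ℂ) ‖a‖).ultrafilter_le_nhds
      (U.map fun i => ψ i a) (by
        rw [le_principal_iff]
        exact Ultrafilter.mem_map.2 <| univ_mem' fun i => by simpa using hb i a)
    exact ⟨z, hz⟩
  choose z hz using hex
  let Λ : WeylAlg ℋ →ₗ[ℂ] ℂ :=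
    { toFun := z
      map_add' := fun a b => tendsto_nhds_unique (hz (a + b)) (by
        simpa only [map_add] using (hz a).add (hz b))
      map_smul' := fun c a => tendsto_nhds_unique (hz (c • a)) (by
        have := (hz a).const_smul c
        simpa only [map_smul, RingHom.id_apply] using this) }
  refine ⟨PositiveLinearMap.mk₀ Λ fun a ha => ?_, fun a w hw => ?_⟩
  · exact ge_of_tendsto' (hz a) fun i => hp i a ha
  · exact tendsto_nhds_unique (hz a) (hw.mono_left hU)

variable [CompleteSpace ℋ] {H : ℋ →ₗ.[ℂ] ℋ} {B : EigenBasis H} {s β : ℝ}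
  {μ : Measure (NegSobolev H s)}

lemma continuous_gaussian (T : ℋ →L[ℂ] ℋ) (β : ℝ) : Continuous fun f : ℋ =>
    Complex.exp ((-((⟪f, T f⟫_ℂ).re / β / 2) : ℝ) : ℂ) := by
  fun_prop

/-- The finite rank operator `∑ k ∈ F, τ_k ^ (-s/2) ⟪e_k, ·⟫ e_k`. -/
def cutoffOp (B : EigenBasis H) (s : ℝ) (F : Finset B.Idx) : ℋ →L[ℂ] ℋ :=
  ∑ k ∈ F, (((B.tau k ^ (s / 2))⁻¹ : ℝ) : ℂ) • (innerSL ℂ (B.basis k)).smulRight (B.basis k)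

lemma cutoffOp_apply (F : Finset B.Idx) (x : ℋ) : cutoffOp B s F x =
    ∑ k ∈ F, (((B.tau k ^ (s / 2))⁻¹ : ℝ) : ℂ) • (⟪B.basis k, x⟫_ℂ • B.basis k) := by
  simp [cutoffOp]

lemma inner_cutoffOp (F : Finset B.Idx) (x y : ℋ) :
    ⟪x, cutoffOp B s F y⟫_ℂ = ⟪cutoffOp B s F x, y⟫_ℂ := by
  rw [cutoffOp_apply, cutoffOp_apply, inner_sum, sum_inner]
  refine Finset.sum_congr rfl fun k _ => ?_
  simp only [inner_smul_left, inner_smul_right, conj_ofReal, inner_conj_symm]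
  ring

lemma negPow_cutoffOp (h : GoodInverse H s) (F : Finset B.Idx) (x : ℋ) :
    negPow H (s / 2) (cutoffOp B s F x) = ∑ k ∈ F, B.basis.repr x k • B.basis k := by
  rw [cutoffOp_apply, map_sum]
  refine Finset.sum_congr rfl fun k _ => ?_
  rw [h.negPow_smul_basis, HilbertBasis.repr_apply_apply]

/-- There is a state with the Gaussian characteristic function of a KMS measure. -/
lemma exists_gaussian_state [IsProbabilityMeasure μ] (h : GoodInverse H s) (hβ : β ≠ 0)
    (hμ : IsKMSMeasure B s β μ) : ∃ ω : WeylAlg ℋ →ₚ[ℂ] ℂ, ∀ f, ω (weyl f) =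
      Complex.exp ((-((⟪f, boundedInv H f⟫_ℂ).re / β / 2) : ℝ) : ℂ) := by
  have hX (F : Finset B.Idx) (a : BoundedContinuousFunction ℋ ℂ) :
      AEStronglyMeasurable (fun u => a (cutoffOp B s F (negSobolevMap H s u))) μ := by
    have hc : Continuous fun u => a (cutoffOp B s F (negSobolevMap H s u)) :=
      a.continuous.comp ((cutoffOp B s F).continuous.comp
        (isometry_negSobolevMap H s).continuous)
    exact hc.measurable.aestronglyMeasurable
  -- Weyl functions are defined on `E`, not on `ℋ^{-s}`. The cutoff applied to `H^{-s/2} u` is the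
  -- truncation of `u` to finitely many basis vectors, which lies in `E`.
  obtain ⟨ω, hω⟩ := exists_limit_state (l := (atTop : Filter (Finset B.Idx)))
    (fun F => averageMap μ _ (hX F)) (fun F => norm_averageMap_le (hX F))
    (fun F a ha => averageMap_nonneg (hX F) ha)
  refine ⟨ω, fun f => hω _ _ ?_⟩
  -- Moving the truncation to the other argument gives the Fourier transform at the truncated `f`,
  -- which lies in `ℋ^s` for every `f ∈ E`.
  have h1 (F : Finset B.Idx) : averageMap μ _ (hX F) (weyl f) =
      Complex.exp ((-((⟪∑ k ∈ F, B.basis.repr f k • B.basis k,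
        boundedInv H (∑ k ∈ F, B.basis.repr f k • B.basis k)⟫_ℂ).re / β / 2) : ℝ) : ℂ) := by
    rw [← negPow_cutoffOp h, ← fourierMeas_of_isKMSMeasure h hβ hμ
      (mem_sobolev_iff.2 ⟨_, rfl⟩), fourierMeas_negPow]
    change ∫ u, Complex.exp ((((⟪f, cutoffOp B s F (negSobolevMap H s u)⟫_ℂ).re : ℝ) : ℂ) *
      Complex.I) ∂μ = _
    simp only [inner_cutoffOp]
  simp only [h1]
  exact (continuous_gaussian (boundedInv H) β).continuousAt.tendsto.comp (B.basis.hasSum_repr f)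

/-- Two norm continuous functions that agree on the dense subspace `ℋ^s` agree on `E`. -/
lemma IsExtendedState.apply_weyl [IsProbabilityMeasure μ] (h : GoodInverse H s) (hβ : β ≠ 0)
    (hμ : IsKMSMeasure B s β μ) {ω : WeylAlg ℋ →ₚ[ℂ] ℂ}
    (hω : IsExtendedState H s (fourierMeas H s μ) ω) (f : ℋ) :
    ω (weyl f) = Complex.exp ((-((⟪f, boundedInv H f⟫_ℂ).re / β / 2) : ℝ) : ℂ) := by
  refine congrFun (Continuous.ext_on (h.denseRange_negPow B) hω.2.2
    (continuous_gaussian (boundedInv H) β) ?_) f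
  rintro _ ⟨g, rfl⟩
  have hg : negPow H (s / 2) g ∈ sobolev H s := mem_sobolev_iff.2 ⟨g, rfl⟩
  exact (hω.2.1 _ hg).trans (fourierMeas_of_isKMSMeasure h hβ hμ hg)

theorem existsUnique_extendedState [IsProbabilityMeasure μ] (h : GoodInverse H s) (hβ : β ≠ 0)
    (hμ : IsKMSMeasure B s β μ) :
    ∃! ω : WeylAlg ℋ →ₚ[ℂ] ℂ, IsExtendedState H s (fourierMeas H s μ) ω := by
  obtain ⟨ω, hω⟩ := exists_gaussian_state h hβ hμ
  refine ⟨ω, ⟨?_, fun f hf => ?_, ?_⟩, fun ω' hω' => state_ext fun f => ?_⟩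
  · rw [← weyl_zero, hω]
    simp
  · rw [hω, fourierMeas_of_isKMSMeasure h hβ hμ hf]
  · simp only [hω]
    exact continuous_gaussian _ _
  · rw [hω, hω'.apply_weyl h hβ hμ]

theorem IsExtendedState.isWeakKMS [IsProbabilityMeasure μ] (h : GoodInverse H s) (hβ : β ≠ 0)
    (hμ : IsKMSMeasure B s β μ) {ω : WeylAlg ℋ →ₚ[ℂ] ℂ}
    (hω : IsExtendedState H s (fourierMeas H s μ) ω) : IsWeakKMS H β ω :=
  isWeakKMS_of_gaussian hβ h.inv h.nonneg (hω.apply_weyl h hβ hμ)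

end ExistsState

/-! ### Gaussian integration by parts -/

section Stein

open Filter Topology ProbabilityTheory
open scoped NNReal

/-- Gaussian integration by parts on the real line. -/
lemma integral_deriv_gaussianReal {v : ℝ≥0} (hv : v ≠ 0) {f f' : ℝ → ℝ} {M : ℝ}
    (hf : ∀ x, HasDerivAt f (f' x) x) (hfM : ∀ x, |f x| ≤ M) (hfM' : ∀ x, |f' x| ≤ M)
    (hm' : Measurable f') :
    ∫ x, f' x ∂gaussianReal 0 v = (v : ℝ)⁻¹ * ∫ x, x * f x ∂gaussianReal 0 v := by
  have hv' : (0 : ℝ) < v := by exact_mod_cast pos_iff_ne_zero.2 hv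
  let p := gaussianPDFReal 0 v
  have hpd (x : ℝ) : HasDerivAt p (-(x / v) * p x) x := by
    have h1 : HasDerivAt (fun x : ℝ => -(x - 0) ^ 2 / (2 * (v : ℝ))) (-(x / v)) x := by
      have := ((((hasDerivAt_id x).sub_const 0).pow 2).neg).div_const (2 * (v : ℝ))
      refine this.congr_deriv ?_
      simp
      field_simp
    refine (h1.exp.const_mul (√(2 * Real.pi * v))⁻¹).congr_deriv ?_
    simp only [p, gaussianPDFReal]
    ring
  have hfc : Continuous f := continuous_iff_continuousAt.2 fun x => (hf x).continuousAt
  have hpi : Integrable p := integrable_gaussianPDFReal 0 v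
  have hxp : Integrable fun x => x * p x := by
    have h1 := (integrable_mul_exp_neg_mul_sq (b := (2 * (v : ℝ))⁻¹) (by positivity)).const_mul
      (√(2 * Real.pi * v))⁻¹
    refine h1.congr (Eventually.of_forall fun x => ?_)
    simp only [p, gaussianPDFReal, sub_zero]
    rw [show -(x ^ 2) / (2 * (v : ℝ)) = -(2 * (v : ℝ))⁻¹ * x ^ 2 by ring]
    ring
  have hxp' : Integrable fun x => -(x / v) * p x := by
    refine (hxp.const_mul (-(v : ℝ)⁻¹)).congr (Eventually.of_forall fun x => ?_)
    simp only []
    ring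
  have key := integral_mul_deriv_eq_deriv_mul_of_integrable (u := f) (u' := f') (v := p)
    (v' := fun x => -(x / v) * p x) (fun x _ => hf x) (fun x _ => hpd x)
    (hxp'.bdd_mul (c := M) hfc.measurable.aestronglyMeasurable (Eventually.of_forall hfM))
    (hpi.bdd_mul (c := M) hm'.aestronglyMeasurable (Eventually.of_forall hfM'))
    (hpi.bdd_mul (c := M) hfc.measurable.aestronglyMeasurable (Eventually.of_forall hfM))
  rw [integral_gaussianReal_eq_integral_smul hv, integral_gaussianReal_eq_integral_smul hv,
    ← integral_const_mul]
  have h2 : ∫ x, gaussianPDFReal 0 v x • f' x = ∫ x, f' x * p x := by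
    refine integral_congr_ae (Eventually.of_forall fun x => ?_)
    simp only [smul_eq_mul, p]
    ring
  rw [h2, ← neg_eq_iff_eq_neg.2 key, ← integral_neg]
  refine integral_congr_ae (Eventually.of_forall fun x => ?_)
  simp only [smul_eq_mul, p]
  ring

variable {ι : Type*} [DecidableEq ι]

lemma measurable_update_prod (i : ι) :
    Measurable fun p : ℝ × (ι → ℝ) => Function.update p.2 i p.1 := by
  refine measurable_pi_lambda _ fun j => ?_
  by_cases h : j = i
  · subst h
    simpa using measurable_fst
  · simp only [Function.update_of_ne h]
    exact (measurable_pi_apply j).comp measurable_snd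

/-- Resampling one coordinate preserves a product of probability measures. -/
lemma map_update_infinitePi (γ : ι → Measure ℝ) [∀ i, IsProbabilityMeasure (γ i)] (i : ι) :
    ((γ i).prod (Measure.infinitePi γ)).map (fun p => Function.update p.2 i p.1) =
      Measure.infinitePi γ := by
  refine Measure.eq_infinitePi _ fun s t ht => ?_
  rw [Measure.map_apply (measurable_update_prod i)
    (MeasurableSet.pi s.countable_toSet fun j _ => ht j)]
  by_cases hi : i ∈ s
  · have h1 : (fun p : ℝ × (ι → ℝ) => Function.update p.2 i p.1) ⁻¹' (Set.pi s t) =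
        t i ×ˢ Set.pi (s.erase i : Finset ι) t := by
      ext p
      simp only [Set.mem_preimage, Set.mem_pi, Set.mem_prod, Finset.mem_coe, Finset.mem_erase]
      constructor
      · intro h
        refine ⟨by simpa using h i hi, fun j hj => ?_⟩
        simpa [Function.update_of_ne hj.1] using h j hj.2
      · rintro ⟨h1, h2⟩ j hj
        by_cases hji : j = i
        · subst hji
          simpa using h1
        · rw [Function.update_of_ne hji]
          exact h2 j ⟨hji, hj⟩
    rw [h1, Measure.prod_prod, Measure.infinitePi_pi _ fun j _ => ht j,
      Finset.mul_prod_erase s (fun j => γ j (t j)) hi]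
  · have h1 : (fun p : ℝ × (ι → ℝ) => Function.update p.2 i p.1) ⁻¹' (Set.pi s t) =
        Set.univ ×ˢ Set.pi s t := by
      ext p
      simp only [Set.mem_preimage, Set.mem_pi, Set.mem_prod, Finset.mem_coe, Set.mem_univ,
        true_and]
      refine forall₂_congr fun j hj => ?_
      rw [Function.update_of_ne (fun h : j = i => hi (h ▸ hj))]
    rw [h1, Measure.prod_prod, Measure.infinitePi_pi _ fun j _ => ht j, measure_univ, one_mul]

variable {v : ι → ℝ≥0}

lemma memLp_eval_gaussian (i : ι) :
    MemLp (fun w : ι → ℝ => w i) 2 (Measure.infinitePi fun i => gaussianReal 0 (v i)) :=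
  (memLp_id_gaussianReal' 2 (by simp)).comp_measurePreserving
    (measurePreserving_eval_infinitePi (fun i => gaussianReal 0 (v i)) i)

lemma integrable_eval_gaussian (i : ι) :
    Integrable (fun w : ι → ℝ => w i) (Measure.infinitePi fun i => gaussianReal 0 (v i)) :=
  (memLp_eval_gaussian i).integrable (by norm_num)

/-- Gaussian integration by parts along one coordinate of a product. -/
lemma integral_deriv_infinitePi_gaussian (i : ι) (hv : v i ≠ 0) {f f' : (ι → ℝ) → ℝ} {M : ℝ}
    (hf : ∀ w x, HasDerivAt (fun x => f (Function.update w i x)) (f' (Function.update w i x)) x)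
    (hfM : ∀ w, |f w| ≤ M) (hfM' : ∀ w, |f' w| ≤ M) (hm : Measurable f) (hm' : Measurable f') :
    ∫ w, f' w ∂(Measure.infinitePi fun i => gaussianReal 0 (v i)) =
      (v i : ℝ)⁻¹ * ∫ w, w i * f w ∂(Measure.infinitePi fun i => gaussianReal 0 (v i)) := by
  set P := Measure.infinitePi fun i => gaussianReal 0 (v i) with hP
  -- Redrawing coordinate `i` independently leaves the law unchanged, so that coordinate may be
  -- integrated first, with the one-dimensional formula.
  have hswap {g : (ι → ℝ) → ℝ} (hg : Measurable g) (hgi : Integrable g P) :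
      ∫ w, g w ∂P = ∫ w, ∫ x, g (Function.update w i x) ∂gaussianReal 0 (v i) ∂P := by
    have hmap := map_update_infinitePi (fun i => gaussianReal 0 (v i)) i
    rw [← hP] at hmap
    have hgi' : Integrable (fun p : ℝ × (ι → ℝ) => g (Function.update p.2 i p.1))
        ((gaussianReal 0 (v i)).prod P) := by
      rw [← hmap] at hgi
      exact hgi.comp_measurable (measurable_update_prod i)
    rw [← integral_prod_symm _ hgi']
    conv_lhs => rw [← hmap]
    rw [integral_map (measurable_update_prod i).aemeasurable hg.aestronglyMeasurable]
  have hf'i : Integrable f' P :=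
    Integrable.of_bound hm'.aestronglyMeasurable M (Eventually.of_forall hfM')
  have hfi : Integrable (fun w => w i * f w) P :=
    (integrable_eval_gaussian i).mul_bdd (c := M) hm.aestronglyMeasurable
      (Eventually.of_forall hfM)
  have hmi : Measurable fun w : ι → ℝ => w i * f w := (measurable_pi_apply i).mul hm
  rw [hswap hm' hf'i, hswap hmi hfi, ← integral_const_mul]
  refine integral_congr_ae (Eventually.of_forall fun w => ?_)
  simp only [Function.update_self]
  exact integral_deriv_gaussianReal hv (hf w) (fun x => hfM _) (fun x => hfM' _)
    (hm'.comp ((measurable_update w)))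

end Stein

/-! ### The Gaussian measure -/

section GaussianMeasure

open Filter Topology ProbabilityTheory
open scoped NNReal ENNReal

variable {H : ℋ →ₗ.[ℂ] ℋ} (B : EigenBasis H) (s β : ℝ)

/-- The variances of the coordinates of the Gaussian measure. -/
def gaussVar (i : B.Idx × Bool) : ℝ≥0 := (B.tau i.1 / β).toNNReal

/-- The law of the coordinates `(⟨e_k, u⟩, ⟨f_k, u⟩)_k`. -/
def gaussCoordLaw : Measure (B.Idx × Bool → ℝ) :=
  Measure.infinitePi fun i => gaussianReal 0 (gaussVar B β i)

instance : IsProbabilityMeasure (gaussCoordLaw B β) := by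
  unfold gaussCoordLaw
  infer_instance

/-- The coefficients of `H ^ (-s/2) u` in terms of the coordinates of `u`. -/
def gaussCoef (w : B.Idx × Bool → ℝ) (k : B.Idx) : ℂ :=
  ((B.tau k ^ (s / 2) : ℝ) : ℂ) * ((w (k, false) : ℂ) + (w (k, true) : ℂ) * Complex.I)

open Classical in
/-- The random vector `H ^ (-s/2) u`. -/
def gaussVec (w : B.Idx × Bool → ℝ) : ℋ :=
  if h : Memℓp (gaussCoef B s w) 2 then B.basis.repr.symm ⟨gaussCoef B s w, h⟩ else 0

variable {B s β}

lemma hasSum_gaussVec {w : B.Idx × Bool → ℝ} (h : Memℓp (gaussCoef B s w) 2) :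
    HasSum (fun k => gaussCoef B s w k • B.basis k) (gaussVec B s w) := by
  unfold gaussVec
  rw [dif_pos h]
  exact B.basis.hasSum_repr_symm ⟨gaussCoef B s w, h⟩

lemma inner_gaussVec {w : B.Idx × Bool → ℝ} (h : Memℓp (gaussCoef B s w) 2) (k : B.Idx) :
    ⟪B.basis k, gaussVec B s w⟫_ℂ = gaussCoef B s w k := by
  unfold gaussVec
  rw [dif_pos h, ← HilbertBasis.repr_apply_apply, LinearIsometryEquiv.apply_symm_apply]

lemma measurable_gaussCoef (k : B.Idx) : Measurable fun w => gaussCoef B s w k := by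
  unfold gaussCoef
  exact ((Complex.measurable_ofReal.comp (measurable_pi_apply _)).add
    ((Complex.measurable_ofReal.comp (measurable_pi_apply _)).mul_const _)).const_mul _

variable [CompleteSpace ℋ]

lemma gaussVar_coe (h : GoodInverse H s) (hβ : 0 < β) (i : B.Idx × Bool) :
    (gaussVar B β i : ℝ) = B.tau i.1 / β :=
  Real.coe_toNNReal _ (div_pos (h.tau_pos i.1) hβ).le

lemma gaussVar_ne_zero (h : GoodInverse H s) (hβ : 0 < β) (i : B.Idx × Bool) :
    gaussVar B β i ≠ 0 := by
  have h1 := gaussVar_coe h hβ i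
  have h2 := div_pos (h.tau_pos i.1) hβ
  intro h0
  rw [h0] at h1
  simp only [NNReal.coe_zero] at h1
  linarith

lemma norm_gaussCoef_sq (h : GoodInverse H s) (w : B.Idx × Bool → ℝ) (k : B.Idx) :
    ‖gaussCoef B s w k‖ ^ 2 = B.tau k ^ s * (w (k, false) ^ 2 + w (k, true) ^ 2) := by
  have h1 : (B.tau k ^ (s / 2)) ^ 2 = B.tau k ^ s := by
    rw [← Real.rpow_natCast, ← Real.rpow_mul (h.tau_pos k).le]
    congr 1
    push_cast
    ring
  unfold gaussCoef
  rw [norm_mul, mul_pow, Complex.norm_real, Real.norm_eq_abs, sq_abs, h1,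
    ← Complex.normSq_eq_norm_sq, Complex.normSq_add_mul_I]

lemma integral_sq_gaussCoordLaw (i : B.Idx × Bool) :
    ∫ w, w i ^ 2 ∂gaussCoordLaw B β = gaussVar B β i := by
  have h1 : ∫ x, x ^ 2 ∂gaussianReal 0 (gaussVar B β i) = gaussVar B β i := by
    have := variance_of_integral_eq_zero (X := fun x : ℝ => x)
      (μ := gaussianReal 0 (gaussVar B β i)) (by fun_prop) (by simp)
    rw [← this, variance_fun_id_gaussianReal]
  rw [← h1, ← Measure.infinitePi_map_eval (fun i => gaussianReal 0 (gaussVar B β i)) i,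
    integral_map (measurable_pi_apply i).aemeasurable (by fun_prop)]
  rfl

/-- The expectation of `‖H^{-s/2} u‖²` is `∑ τ_k^s · 2 τ_k / β`, at most `2 ‖H⁻¹‖ / β` times the
trace of `H^{-s}`. This is where the trace condition places the Gaussian measure on `ℋ^{-s}`. -/
lemma lintegral_gaussCoef_lt_top (h : GoodInverse H s) (hβ : 0 < β) :
    ∫⁻ w, ∑' k, ENNReal.ofReal (‖gaussCoef B s w k‖ ^ 2) ∂gaussCoordLaw B β < ∞ := by
  have : Countable B.Idx := inferInstance
  rw [lintegral_tsum fun k =>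
    (((measurable_gaussCoef k).norm.pow_const 2).ennreal_ofReal).aemeasurable]
  have h1 (k : B.Idx) : ∫⁻ w, ENNReal.ofReal (‖gaussCoef B s w k‖ ^ 2) ∂gaussCoordLaw B β ≤
      ENNReal.ofReal (B.tau k ^ s * (2 * (‖boundedInv H‖ / β))) := by
    have hi (i : B.Idx × Bool) : Integrable (fun w => w i ^ 2) (gaussCoordLaw B β) :=
      (memLp_eval_gaussian i).integrable_sq
    simp only [norm_gaussCoef_sq h]
    have hint : Integrable (fun w => B.tau k ^ s * (w (k, false) ^ 2 + w (k, true) ^ 2))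
        (gaussCoordLaw B β) := ((hi _).add (hi _)).const_mul _
    rw [← ofReal_integral_eq_lintegral_ofReal hint
      (Eventually.of_forall fun w => mul_nonneg (Real.rpow_nonneg (h.tau_pos k).le _)
        (add_nonneg (sq_nonneg _) (sq_nonneg _)))]
    refine ENNReal.ofReal_le_ofReal ?_
    rw [integral_const_mul]
    refine mul_le_mul_of_nonneg_left ?_ (Real.rpow_nonneg (h.tau_pos k).le _)
    rw [integral_add (hi _) (hi _), integral_sq_gaussCoordLaw, integral_sq_gaussCoordLaw,
      gaussVar_coe h hβ, gaussVar_coe h hβ, ← two_mul]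
    have := EigenBasis.tau_le h.inv h.nonneg k
    gcongr
  refine (ENNReal.tsum_le_tsum h1).trans_lt ?_
  exact lt_top_iff_ne_top.2 ((EigenBasis.summable_tau_rpow h.inv h.nonneg h.hs
    h.trace).mul_right _).tsum_ofReal_ne_top

lemma memℓp_of_tsum_ne_top {w : B.Idx × Bool → ℝ}
    (hw : ∑' k, ENNReal.ofReal (‖gaussCoef B s w k‖ ^ 2) ≠ ∞) :
    Memℓp (gaussCoef B s w) 2 := by
  refine memℓp_gen ?_
  have h1 := ENNReal.summable_toReal hw
  simpa [ENNReal.toReal_ofReal] using h1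

lemma ae_memℓp_gaussCoef (h : GoodInverse H s) (hβ : 0 < β) :
    ∀ᵐ w ∂gaussCoordLaw B β, Memℓp (gaussCoef B s w) 2 := by
  have h1 := ae_lt_top' (AEMeasurable.tsum fun k =>
    (((measurable_gaussCoef k).norm.pow_const 2).ennreal_ofReal).aemeasurable)
    (lintegral_gaussCoef_lt_top (B := B) h hβ).ne
  filter_upwards [h1] with w hw
  exact memℓp_of_tsum_ne_top hw.ne

lemma aestronglyMeasurable_gaussVec (h : GoodInverse H s) (hβ : 0 < β) :
    AEStronglyMeasurable (gaussVec B s) (gaussCoordLaw B β) := by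
  refine aestronglyMeasurable_of_tendsto_ae (u := (atTop : Filter (Finset B.Idx)))
    (f := fun F w => ∑ k ∈ F, gaussCoef B s w k • B.basis k) (fun F => ?_) ?_
  · refine Finset.aestronglyMeasurable_fun_sum _ fun k _ => ?_
    exact (measurable_gaussCoef k).aestronglyMeasurable.smul_const _
  · filter_upwards [ae_memℓp_gaussCoef h hβ] with w hw
    exact hasSum_gaussVec hw

lemma integrable_norm_gaussVec (h : GoodInverse H s) (hβ : 0 < β) :
    Integrable (fun w => ‖gaussVec B s w‖) (gaussCoordLaw B β) := by
  have hm := aestronglyMeasurable_gaussVec (B := B) h hβ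
  have hsq : Integrable (fun w => ‖gaussVec B s w‖ ^ 2) (gaussCoordLaw B β) := by
    refine ⟨hm.norm.pow 2, ?_⟩
    refine lt_of_le_of_lt (lintegral_mono fun w => ?_) (lintegral_gaussCoef_lt_top (B := B) h hβ)
    rw [Real.enorm_eq_ofReal (sq_nonneg _)]
    by_cases hw : Memℓp (gaussCoef B s w) 2
    · have h1 := B.basis.hasSum_norm_inner_sq (gaussVec B s w)
      simp only [inner_gaussVec hw] at h1
      rw [← h1.tsum_eq, ENNReal.ofReal_tsum_of_nonneg (fun _ => sq_nonneg _) h1.summable]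
    · unfold gaussVec
      rw [dif_neg hw]
      simp
  refine ((integrable_const (1 : ℝ)).add hsq).mono' hm.norm (Eventually.of_forall fun w => ?_)
  rw [norm_norm, Pi.add_apply]
  nlinarith [sq_nonneg (‖gaussVec B s w‖ - 1)]

/-- The random element of `ℋ^{-s}` whose law is the Gaussian measure. -/
def gaussElem (h : GoodInverse H s) (w : B.Idx × Bool → ℝ) : NegSobolev H s :=
  Function.surjInv (negSobolevMap_surjective H s (h.denseRange_negPow B)) (gaussVec B s w)

variable (B β) in
/-- The Gaussian measure on `ℋ^{-s}`. -/
def gaussMeasure (h : GoodInverse H s) : Measure (NegSobolev H s) :=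
  (gaussCoordLaw B β).map (gaussElem h)

lemma negSobolevMap_gaussElem (h : GoodInverse H s) (w : B.Idx × Bool → ℝ) :
    negSobolevMap H s (gaussElem h w) = gaussVec B s w :=
  Function.surjInv_eq _ _

lemma aemeasurable_gaussElem (h : GoodInverse H s) (hβ : 0 < β) :
    AEMeasurable (gaussElem h) (gaussCoordLaw B β) := by
  have hK : Isometry
      (Function.surjInv (negSobolevMap_surjective H s (h.denseRange_negPow B))) := by
    refine Isometry.of_dist_eq fun x y => ?_
    have hs := negSobolevMap_surjective H s (h.denseRange_negPow B)
    rw [← (isometry_negSobolevMap H s).dist_eq, Function.surjInv_eq hs, Function.surjInv_eq hs]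
  exact (hK.continuous.comp_aestronglyMeasurable
    (aestronglyMeasurable_gaussVec h hβ)).aemeasurable

lemma isProbabilityMeasure_gaussMeasure (h : GoodInverse H s) (hβ : 0 < β) :
    IsProbabilityMeasure (gaussMeasure B β h) :=
  Measure.isProbabilityMeasure_map (aemeasurable_gaussElem h hβ)

lemma integrable_pairing_gaussMeasure (h : GoodInverse H s) (hβ : 0 < β) {f : ℋ}
    (hf : f ∈ sobolev H s) : Integrable (pairing H s f) (gaussMeasure B β h) := by
  obtain ⟨g, rfl⟩ := mem_sobolev_iff.1 hf
  refine (integrable_map_measure (continuous_pairing hf).measurable.aestronglyMeasurable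
    (aemeasurable_gaussElem h hβ)).2 ?_
  refine ((integrable_norm_gaussVec (B := B) h hβ).const_mul ‖g‖).mono'
    ((continuous_pairing hf).measurable.comp_aemeasurable
      (aemeasurable_gaussElem h hβ)).aestronglyMeasurable (Eventually.of_forall fun w => ?_)
  change ‖pairing H s _ (gaussElem h w)‖ ≤ _
  rw [pairing_negPow, negSobolevMap_gaussElem]
  exact (Complex.abs_re_le_norm _).trans (norm_inner_le_norm _ _)

/-- Embedding of `Fin n` in the index set of the basis. -/
def EigenBasis.idx {n : ℕ} (hn : (n : ℕ∞) ≤ B.N) (k : Fin n) : B.Idx :=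
  ⟨k, lt_of_lt_of_le (by exact_mod_cast k.2) hn⟩

/-- The first coordinates, on the product space. -/
def gaussProj {n : ℕ} (hn : (n : ℕ∞) ≤ B.N) (w : B.Idx × Bool → ℝ) :
    (Fin n → ℝ) × (Fin n → ℝ) :=
  (fun k => w (EigenBasis.idx hn k, false), fun k => w (EigenBasis.idx hn k, true))

/-- The weight `τ_k^{s/2}` in `gaussCoef` cancels the weight of the preimage of `e_k` under
`H^{-s/2}`. It can fail only on the null event where `gaussVec` takes its default value. -/
lemma cylProj_gaussElem (h : GoodInverse H s) {n : ℕ} (hn : (n : ℕ∞) ≤ B.N)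
    {w : B.Idx × Bool → ℝ} (hw : Memℓp (gaussCoef B s w) 2) :
    cylProj B s n (gaussElem h w) = gaussProj hn w := by
  have key (k : B.Idx) (c : ℂ) : pairing H s (c • B.basis k) (gaussElem h w) =
      ((starRingEnd ℂ) c * ((w (k, false) : ℂ) + (w (k, true) : ℂ) * Complex.I)).re := by
    have h0 : ((B.tau k ^ (s / 2) : ℝ) : ℂ) ≠ 0 := by
      exact_mod_cast (Real.rpow_pos_of_pos (h.tau_pos k) (s / 2)).ne'
    rw [← h.negPow_smul_basis k c, pairing_negPow, negSobolevMap_gaussElem, inner_smul_left,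
      inner_smul_left, inner_gaussVec hw, gaussCoef, conj_ofReal, ofReal_inv]
    congr 1
    field_simp
  have hI (k : B.Idx) := key k Complex.I
  have h1 (k : B.Idx) := key k 1
  simp only [one_smul] at h1
  unfold cylProj gaussProj
  ext k
  · simp only []
    rw [EigenBasis.e_fin hn, h1]
    simp [EigenBasis.idx]
  · simp only []
    rw [EigenBasis.e_fin hn, hI]
    simp [EigenBasis.idx]

lemma measurable_gaussProj {n : ℕ} (hn : (n : ℕ∞) ≤ B.N) : Measurable (gaussProj hn) := by
  unfold gaussProj
  fun_prop

lemma integral_gaussMeasure (h : GoodInverse H s) (hβ : 0 < β) {n m : ℕ}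
    (hn : (n : ℕ∞) ≤ B.N) (hm : (m : ℕ∞) ≤ B.N)
    {g : ((Fin n → ℝ) × (Fin n → ℝ)) → ((Fin m → ℝ) × (Fin m → ℝ)) → ℝ}
    (hg : Continuous fun p : ((Fin n → ℝ) × (Fin n → ℝ)) × ((Fin m → ℝ) × (Fin m → ℝ)) =>
      g p.1 p.2) :
    ∫ u, g (cylProj B s n u) (cylProj B s m u) ∂gaussMeasure B β h =
      ∫ w, g (gaussProj hn w) (gaussProj hm w) ∂gaussCoordLaw B β := by
  have hgm : Measurable fun u => g (cylProj B s n u) (cylProj B s m u) :=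
    hg.measurable.comp ((measurable_cylProj h n).prodMk (measurable_cylProj h m))
  unfold gaussMeasure
  rw [integral_map (aemeasurable_gaussElem h hβ) hgm.aestronglyMeasurable]
  refine integral_congr_ae ?_
  filter_upwards [ae_memℓp_gaussCoef h hβ] with w hw
  rw [cylProj_gaussElem h hn hw, cylProj_gaussElem h hm hw]

end GaussianMeasure

/-! ### The Gaussian measure is a KMS measure -/

section GaussianKMS

open Filter Topology ProbabilityTheory

variable [CompleteSpace ℋ] {H : ℋ →ₗ.[ℂ] ℋ} {B : EigenBasis H} {s β : ℝ}

lemma hasDerivAt_gaussProj_update {n : ℕ} (hn : (n : ℕ∞) ≤ B.N) (w : B.Idx × Bool → ℝ)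
    (i : B.Idx × Bool) (x : ℝ) :
    HasDerivAt (fun x => gaussProj hn (Function.update w i x))
      (gaussProj hn (Pi.single i 1)) x := by
  have h1 (j : B.Idx × Bool) :
      HasDerivAt (fun x => Function.update w i x j) ((Pi.single i 1 : B.Idx × Bool → ℝ) j) x := by
    by_cases h : j = i
    · subst h
      simpa using hasDerivAt_id' x
    · simpa [Function.update_of_ne h, Pi.single_eq_of_ne h] using hasDerivAt_const x (w j)
  unfold gaussProj
  exact (hasDerivAt_pi.2 fun k => h1 _).prodMk (hasDerivAt_pi.2 fun k => h1 _)

lemma exists_abs_le_of_hasCompactSupport {X : Type*} [TopologicalSpace X] {f : X → ℝ}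
    (hf : Continuous f) (hc : HasCompactSupport f) : ∃ M, 0 ≤ M ∧ ∀ x, |f x| ≤ M := by
  obtain ⟨M, hM⟩ := hc.exists_bound_of_continuous hf
  exact ⟨max M 0, le_max_right _ _, fun x => (hM x).trans (le_max_left _ _)⟩

/-- The directional derivative of `c₁ c₂` along a coordinate of the product space. -/
def cylDeriv {n m : ℕ} (hn : (n : ℕ∞) ≤ B.N) (hm : (m : ℕ∞) ≤ B.N)
    (c₁ : (Fin n → ℝ) × (Fin n → ℝ) → ℝ) (c₂ : (Fin m → ℝ) × (Fin m → ℝ) → ℝ)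
    (i : B.Idx × Bool) (w : B.Idx × Bool → ℝ) : ℝ :=
  fderiv ℝ c₁ (gaussProj hn w) (gaussProj hn (Pi.single i 1)) * c₂ (gaussProj hm w) +
    c₁ (gaussProj hn w) * fderiv ℝ c₂ (gaussProj hm w) (gaussProj hm (Pi.single i 1))

section Cyl

variable {n m : ℕ} (hn : (n : ℕ∞) ≤ B.N) (hm : (m : ℕ∞) ≤ B.N)
    {c₁ : (Fin n → ℝ) × (Fin n → ℝ) → ℝ} {c₂ : (Fin m → ℝ) × (Fin m → ℝ) → ℝ}
    (h₁ : ContDiff ℝ (⊤ : ℕ∞) c₁) (h₁c : HasCompactSupport c₁)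
    (h₂ : ContDiff ℝ (⊤ : ℕ∞) c₂) (h₂c : HasCompactSupport c₂) (i : B.Idx × Bool)

include h₁ h₁c h₂ h₂c

lemma exists_bound_cyl : ∃ M, (∀ w, |c₁ (gaussProj hn w) * c₂ (gaussProj hm w)| ≤ M) ∧
    ∀ w, |cylDeriv hn hm c₁ c₂ i w| ≤ M := by
  obtain ⟨M1, hM1, h1⟩ := exists_abs_le_of_hasCompactSupport h₁.continuous h₁c
  obtain ⟨M2, hM2, h2⟩ := exists_abs_le_of_hasCompactSupport h₂.continuous h₂c
  obtain ⟨M3, hM3, h3⟩ := exists_abs_le_of_hasCompactSupport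
    (f := fun x => fderiv ℝ c₁ x (gaussProj hn (Pi.single i 1)))
    ((h₁.continuous_fderiv (by simp)).clm_apply continuous_const)
    (h₁c.fderiv_apply ℝ _)
  obtain ⟨M4, hM4, h4⟩ := exists_abs_le_of_hasCompactSupport
    (f := fun x => fderiv ℝ c₂ x (gaussProj hm (Pi.single i 1)))
    ((h₂.continuous_fderiv (by simp)).clm_apply continuous_const)
    (h₂c.fderiv_apply ℝ _)
  refine ⟨max (M1 * M2) (M3 * M2 + M1 * M4), fun w => ?_, fun w => ?_⟩
  · refine le_trans ?_ (le_max_left _ _)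
    rw [abs_mul]
    exact mul_le_mul (h1 _) (h2 _) (abs_nonneg _) hM1
  · refine le_trans ?_ (le_max_right _ _)
    unfold cylDeriv
    refine (abs_add_le _ _).trans (add_le_add ?_ ?_)
    · rw [abs_mul]
      exact mul_le_mul (h3 _) (h2 _) (abs_nonneg _) hM3
    · rw [abs_mul]
      exact mul_le_mul (h1 _) (h4 _) (abs_nonneg _) hM1

lemma measurable_cylProd : Measurable fun w => c₁ (gaussProj hn w) * c₂ (gaussProj hm w) :=
  (h₁.continuous.measurable.comp (measurable_gaussProj hn)).mul
    (h₂.continuous.measurable.comp (measurable_gaussProj hm))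

lemma measurable_cylDeriv : Measurable (cylDeriv hn hm c₁ c₂ i) := by
  have e1 : Measurable fun x => fderiv ℝ c₁ x (gaussProj hn (Pi.single i 1)) :=
    ((h₁.continuous_fderiv (by simp)).clm_apply continuous_const).measurable
  have e2 : Measurable fun x => fderiv ℝ c₂ x (gaussProj hm (Pi.single i 1)) :=
    ((h₂.continuous_fderiv (by simp)).clm_apply continuous_const).measurable
  exact ((e1.comp (measurable_gaussProj hn)).mul
    (h₂.continuous.measurable.comp (measurable_gaussProj hm))).add
    ((h₁.continuous.measurable.comp (measurable_gaussProj hn)).mul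
    (e2.comp (measurable_gaussProj hm)))

lemma integrable_cylDeriv : Integrable (cylDeriv hn hm c₁ c₂ i) (gaussCoordLaw B β) := by
  obtain ⟨M, -, hM⟩ := exists_bound_cyl hn hm h₁ h₁c h₂ h₂c i
  exact Integrable.of_bound (measurable_cylDeriv hn hm h₁ h₁c h₂ h₂c i).aestronglyMeasurable M
    (Eventually.of_forall hM)

lemma integrable_mul_cylProd :
    Integrable (fun w => w i * (c₁ (gaussProj hn w) * c₂ (gaussProj hm w)))
      (gaussCoordLaw B β) := by
  obtain ⟨M, hM, -⟩ := exists_bound_cyl hn hm h₁ h₁c h₂ h₂c i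
  exact (integrable_eval_gaussian i).mul_bdd (c := M)
    (measurable_cylProd hn hm h₁ h₁c h₂ h₂c).aestronglyMeasurable (Eventually.of_forall hM)

/-- Gaussian integration by parts in one coordinate; the constant is the inverse of the variance `τ
/ β`. -/
lemma integral_cylDeriv (h : GoodInverse H s) (hβ : 0 < β) :
    ∫ w, cylDeriv hn hm c₁ c₂ i w ∂gaussCoordLaw B β =
      β * (B.tau i.1)⁻¹ * ∫ w, w i * (c₁ (gaussProj hn w) * c₂ (gaussProj hm w))
        ∂gaussCoordLaw B β := by
  obtain ⟨M, hM, hM'⟩ := exists_bound_cyl hn hm h₁ h₁c h₂ h₂c i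
  have h3 := integral_deriv_infinitePi_gaussian (v := gaussVar B β) i (gaussVar_ne_zero h hβ i)
    (f := fun w => c₁ (gaussProj hn w) * c₂ (gaussProj hm w))
    (f' := cylDeriv hn hm c₁ c₂ i) (M := M) (fun w x => ?_) hM hM'
    (measurable_cylProd hn hm h₁ h₁c h₂ h₂c) (measurable_cylDeriv hn hm h₁ h₁c h₂ h₂c i)
  · rw [gaussVar_coe h hβ, inv_div, div_eq_mul_inv] at h3
    exact h3
  · have e1 := (h₁.differentiable (by simp)).differentiableAt.hasFDerivAt.comp_hasDerivAt x
      (hasDerivAt_gaussProj_update hn w i x)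
    have e2 := (h₂.differentiable (by simp)).differentiableAt.hasFDerivAt.comp_hasDerivAt x
      (hasDerivAt_gaussProj_update hm w i x)
    exact e1.mul e2

end Cyl

lemma gaussProj_single_false {n : ℕ} (hn : (n : ℕ∞) ≤ B.N) (k : Fin n) :
    gaussProj hn (Pi.single (EigenBasis.idx hn k, false) 1) = (Pi.single k 1, 0) := by
  unfold gaussProj
  ext l
  · simp [Pi.single_apply, EigenBasis.idx, Fin.ext_iff]
  · simp

lemma gaussProj_single_true {n : ℕ} (hn : (n : ℕ∞) ≤ B.N) (k : Fin n) :
    gaussProj hn (Pi.single (EigenBasis.idx hn k, true) 1) = (0, Pi.single k 1) := by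
  unfold gaussProj
  ext l
  · simp
  · simp [Pi.single_apply, EigenBasis.idx, Fin.ext_iff]

/-- A coordinate direction of `F` may be absent from `G`: for `k ≥ m` both sides vanish. -/
lemma clm_gaussProj_single_false {n m : ℕ} (hn : (n : ℕ∞) ≤ B.N) (hm : (m : ℕ∞) ≤ B.N)
    (k : Fin n) (D : ((Fin m → ℝ) × (Fin m → ℝ)) →L[ℝ] ℝ) :
    D (gaussProj hm (Pi.single (EigenBasis.idx hn k, false) 1)) =
      ∑ l : Fin m, if (k : ℕ) = l then D (Pi.single l 1, 0) else 0 := by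
  rw [clm_prod_pi_apply]
  refine Finset.sum_congr rfl fun l _ => ?_
  simp [gaussProj, Pi.single_apply, EigenBasis.idx, eq_comm]

lemma clm_gaussProj_single_true {n m : ℕ} (hn : (n : ℕ∞) ≤ B.N) (hm : (m : ℕ∞) ≤ B.N)
    (k : Fin n) (D : ((Fin m → ℝ) × (Fin m → ℝ)) →L[ℝ] ℝ) :
    D (gaussProj hm (Pi.single (EigenBasis.idx hn k, true) 1)) =
      ∑ l : Fin m, if (k : ℕ) = l then D (0, Pi.single l 1) else 0 := by
  rw [clm_prod_pi_apply]
  refine Finset.sum_congr rfl fun l _ => ?_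
  simp [gaussProj, Pi.single_apply, EigenBasis.idx, eq_comm]

lemma fderiv_fderiv_symm {X : Type*} [NormedAddCommGroup X] [NormedSpace ℝ X] {φ : X → ℝ}
    (hφ : ContDiff ℝ (⊤ : ℕ∞) φ) (x a b : X) :
    fderiv ℝ (fun x => fderiv ℝ φ x a) x b = fderiv ℝ (fun x => fderiv ℝ φ x b) x a := by
  have hd : DifferentiableAt ℝ (fderiv ℝ φ) x :=
    ((hφ.fderiv_right (m := (⊤ : ℕ∞)) (by simp)).differentiable (by simp)).differentiableAt
  have h1 (a b : X) : fderiv ℝ (fun x => fderiv ℝ φ x a) x b = fderiv ℝ (fderiv ℝ φ) x b a := by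
    rw [fderiv_clm_apply hd (differentiableAt_const a)]
    simp
  have h2 : minSmoothness ℝ 2 ≤ ((⊤ : ℕ∞) : WithTop ℕ∞) := by
    rw [minSmoothness_of_isRCLikeNormedField]
    exact WithTop.coe_le_coe.2 (le_top : (2 : ℕ∞) ≤ ⊤)
  rw [h1, h1]
  exact (hφ.contDiffAt.isSymmSndFDerivAt h2) b a

/-- The Gaussian measure satisfies the KMS condition. -/
theorem isKMSMeasure_gaussMeasure (h : GoodInverse H s) (hβ : 0 < β) :
    IsKMSMeasure B s β (gaussMeasure B β h) := by
  refine ⟨fun f _ hHf => ?_, fun F G => ?_⟩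
  · have h1 := integrable_pairing_gaussMeasure (B := B) h hβ
      (Submodule.smul_mem _ Complex.I hHf)
    refine h1.congr (Eventually.of_forall fun u => ?_)
    simp only [pairingX, dif_pos f.2]
  · have hF1 (a) : Continuous fun x => fderiv ℝ F.φ x a :=
      (F.smooth.continuous_fderiv (by simp)).clm_apply continuous_const
    have hG1 (a) : Continuous fun x => fderiv ℝ G.φ x a :=
      (G.smooth.continuous_fderiv (by simp)).clm_apply continuous_const
    have hFs (a) : ContDiff ℝ (⊤ : ℕ∞) fun x => fderiv ℝ F.φ x a :=
      (F.smooth.fderiv_right (by simp)).clm_apply contDiff_const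
    have hFc (a) : HasCompactSupport fun x => fderiv ℝ F.φ x a := F.compact.fderiv_apply ℝ a
    simp only [cylGrad_eq_ofCoord, symplForm_ofCoord F.hn G.hn, h.pairingX_ofCoord F.hn, cylFun]
    rw [integral_gaussMeasure h hβ F.hn G.hn (g := fun x y => ∑ k : Fin F.n, ∑ l : Fin G.n,
        if (k : ℕ) = l then fderiv ℝ F.φ x (Pi.single k 1, 0) * fderiv ℝ G.φ y (0, Pi.single l 1) -
          fderiv ℝ F.φ x (0, Pi.single k 1) * fderiv ℝ G.φ y (Pi.single l 1, 0) else 0),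
      integral_gaussMeasure h hβ F.hn G.hn (g := fun x y => (∑ k : Fin F.n,
        (B.tauFin F.hn k)⁻¹ * (fderiv ℝ F.φ x (Pi.single k 1, 0) * x.2 k -
          fderiv ℝ F.φ x (0, Pi.single k 1) * x.1 k)) * G.φ y)]
    · let q : Fin F.n → B.Idx × Bool := fun k => (EigenBasis.idx F.hn k, false)
      let p : Fin F.n → B.Idx × Bool := fun k => (EigenBasis.idx F.hn k, true)
      let φq : Fin F.n → (Fin F.n → ℝ) × (Fin F.n → ℝ) → ℝ :=
        fun k x => fderiv ℝ F.φ x (Pi.single k 1, 0)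
      let φp : Fin F.n → (Fin F.n → ℝ) × (Fin F.n → ℝ) → ℝ :=
        fun k x => fderiv ℝ F.φ x (0, Pi.single k 1)
      -- The bracket is a divergence, `∑ k, ∂_{p k}(∂_{q k} φ · G) - ∂_{q k}(∂_{p k} φ · G)`,
      -- because the mixed second derivatives of `φ` cancel. Integration by parts then replaces each
      -- `∂_i` by multiplication with `β τ⁻¹ w i`.
      have hl (w : B.Idx × Bool → ℝ) : (∑ k : Fin F.n, ∑ l : Fin G.n, if (k : ℕ) = l then
          fderiv ℝ F.φ (gaussProj F.hn w) (Pi.single k 1, 0) *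
            fderiv ℝ G.φ (gaussProj G.hn w) (0, Pi.single l 1) -
          fderiv ℝ F.φ (gaussProj F.hn w) (0, Pi.single k 1) *
            fderiv ℝ G.φ (gaussProj G.hn w) (Pi.single l 1, 0) else 0) =
          ∑ k, (cylDeriv F.hn G.hn (φq k) G.φ (p k) w - cylDeriv F.hn G.hn (φp k) G.φ (q k) w) := by
        refine Finset.sum_congr rfl fun k _ => ?_
        unfold cylDeriv
        simp only [p, q]
        rw [clm_gaussProj_single_true F.hn G.hn k, clm_gaussProj_single_false F.hn G.hn k,
          gaussProj_single_true, gaussProj_single_false,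
          fderiv_fderiv_symm F.smooth _ (Pi.single k 1, 0) (0, Pi.single k 1),
          add_sub_add_left_eq_sub, Finset.mul_sum, Finset.mul_sum, ← Finset.sum_sub_distrib]
        refine Finset.sum_congr rfl fun l _ => ?_
        split_ifs
        · rfl
        · ring
      have hr (w : B.Idx × Bool → ℝ) : (∑ k : Fin F.n, (B.tauFin F.hn k)⁻¹ *
          (fderiv ℝ F.φ (gaussProj F.hn w) (Pi.single k 1, 0) * (gaussProj F.hn w).2 k -
          fderiv ℝ F.φ (gaussProj F.hn w) (0, Pi.single k 1) * (gaussProj F.hn w).1 k)) *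
            G.φ (gaussProj G.hn w) =
          ∑ k, (B.tauFin F.hn k)⁻¹ *
            (w (p k) * (φq k (gaussProj F.hn w) * G.φ (gaussProj G.hn w)) -
            w (q k) * (φp k (gaussProj F.hn w) * G.φ (gaussProj G.hn w))) := by
        rw [Finset.sum_mul]
        refine Finset.sum_congr rfl fun k _ => ?_
        simp only [gaussProj, φq, φp, p, q]
        ring
      simp only [hl, hr]
      rw [integral_finsetSum, integral_finsetSum, Finset.mul_sum]
      · refine Finset.sum_congr rfl fun k _ => ?_
        rw [integral_sub
            (integrable_cylDeriv F.hn G.hn (hFs _) (hFc _) G.smooth G.compact _)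
            (integrable_cylDeriv F.hn G.hn (hFs _) (hFc _) G.smooth G.compact _),
          integral_const_mul, integral_sub
            (integrable_mul_cylProd F.hn G.hn (hFs _) (hFc _) G.smooth G.compact _)
            (integrable_mul_cylProd F.hn G.hn (hFs _) (hFc _) G.smooth G.compact _),
          integral_cylDeriv F.hn G.hn (hFs _) (hFc _) G.smooth G.compact _ h hβ,
          integral_cylDeriv F.hn G.hn (hFs _) (hFc _) G.smooth G.compact _ h hβ]
        simp only [p, q, EigenBasis.idx, EigenBasis.tauFin]
        ring
      · exact fun k _ => ((integrable_mul_cylProd F.hn G.hn (hFs _) (hFc _) G.smooth G.compact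
          _).sub (integrable_mul_cylProd F.hn G.hn (hFs _) (hFc _) G.smooth G.compact
          _)).const_mul _
      · exact fun k _ => (integrable_cylDeriv F.hn G.hn (hFs _) (hFc _) G.smooth G.compact _).sub
          (integrable_cylDeriv F.hn G.hn (hFs _) (hFc _) G.smooth G.compact _)
    · have hGc := G.smooth.continuous
      have e1 (a) := (hF1 a).comp (continuous_fst (X := (Fin F.n → ℝ) × (Fin F.n → ℝ))
        (Y := (Fin G.n → ℝ) × (Fin G.n → ℝ)))
      refine Continuous.mul ?_ (hGc.comp continuous_snd)
      refine continuous_finsetSum _ fun k _ => continuous_const.mul ?_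
      exact ((e1 _).mul (by fun_prop)).sub ((e1 _).mul (by fun_prop))
    · have e1 (a) := (hF1 a).comp (continuous_fst (X := (Fin F.n → ℝ) × (Fin F.n → ℝ))
        (Y := (Fin G.n → ℝ) × (Fin G.n → ℝ)))
      have e2 (a) := (hG1 a).comp (continuous_snd (X := (Fin F.n → ℝ) × (Fin F.n → ℝ))
        (Y := (Fin G.n → ℝ) × (Fin G.n → ℝ)))
      refine continuous_finsetSum _ fun k _ => continuous_finsetSum _ fun l _ => ?_
      split_ifs
      · exact ((e1 _).mul (e2 _)).sub ((e1 _).mul (e2 _))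
      · exact continuous_const

end GaussianKMS

/-! ### From weak KMS states to KMS measures -/

section WeakKMS

variable [CompleteSpace ℋ] {H : ℋ →ₗ.[ℂ] ℋ} {s β : ℝ}

lemma goodInverse_of_negPowTraceClass (hself : IsSelfAdjoint H) (hpos : IsStrictlyPos H)
    (hs : 0 < s) (htr : NegPowTraceClass H s) : GoodInverse H s :=
  ⟨isBoundedInverse_boundedInv htr.1,
    (isBoundedInverse_boundedInv htr.1).nonneg hself hpos, hs, htr.2⟩

/-- A function that is continuous on `ℋ^s` and agrees with the characteristic function of `μ` on
`ℋ^s ∩ D(H)` agrees with it on `ℋ^s`. -/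
lemma eqOn_sobolev_of_continuous {B : EigenBasis H} (h : GoodInverse H s)
    {μ : Measure (NegSobolev H s)} [IsProbabilityMeasure μ] {θ : ℋ → ℂ}
    (hθ : ∀ f ∈ sobolev H s, f ∈ H.domain → fourierMeas H s μ f = θ f)
    (hc : SobolevContinuous H s θ) {f : ℋ} (hf : f ∈ sobolev H s) :
    fourierMeas H s μ f = θ f := by
  obtain ⟨g, rfl⟩ := mem_sobolev_iff.1 hf
  have h1 := B.basis.hasSum_repr g
  have h2 := (continuous_fourierMeas_negPow (μ := μ)).continuousAt.tendsto.comp h1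
  have h3 := hc.continuousAt.tendsto.comp h1
  refine tendsto_nhds_unique h2 (h3.congr fun F => ?_)
  simp only [Function.comp]
  refine (hθ _ (mem_sobolev_iff.2 ⟨_, rfl⟩) ?_).symm
  -- Images of partial sums are finite combinations of eigenvectors, hence in `D(H)`, where
  -- agreement is assumed.
  rw [map_sum]
  refine Submodule.sum_mem _ fun k _ => ?_
  rw [map_smul, h.negPow_basis]
  exact Submodule.smul_mem _ _ (Submodule.smul_mem _ _
    (h.inv.apply_eigenvector (h.tau_pos k).ne' (EigenBasis.inv_apply h.inv k)).1)

end WeakKMS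

end

theorem mainTheorem4 {ℋ : Type*} [NormedAddCommGroup ℋ] [InnerProductSpace ℂ ℋ] [CompleteSpace ℋ]
    [TopologicalSpace.SeparableSpace ℋ] (H : ℋ →ₗ.[ℂ] ℋ) (hself : IsSelfAdjoint H)
    (hpos : IsStrictlyPos H) (s : ℝ) (hs : 0 < s) (htr : NegPowTraceClass H s)
    (β : ℝ) (hβ : 0 < β) :
    Nonempty (EigenBasis H) ∧ ∀ B : EigenBasis H,
      (∀ ω : WeylAlg ℋ →ₚ[ℂ] ℂ, IsWeakKMS H β ω →
        ∃ μ : Measure (NegSobolev H s), IsProbabilityMeasure μ ∧ IsKMSMeasure B s β μ ∧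
          (∀ f ∈ sobolev H s, f ∈ H.domain → fourierMeas H s μ f = ω (weyl f)) ∧
          (SobolevContinuous H s (fun f => ω (weyl f)) →
            ∀ f ∈ sobolev H s, fourierMeas H s μ f = ω (weyl f))) ∧
      (∀ μ : Measure (NegSobolev H s), IsProbabilityMeasure μ → IsKMSMeasure B s β μ →
        (∃! ω : WeylAlg ℋ →ₚ[ℂ] ℂ, IsExtendedState H s (fourierMeas H s μ) ω) ∧
        ∀ ω : WeylAlg ℋ →ₚ[ℂ] ℂ, IsExtendedState H s (fourierMeas H s μ) ω →
          IsWeakKMS H β ω) := by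
  have h := goodInverse_of_negPowTraceClass hself hpos hs htr
  refine ⟨exists_eigenBasis hself hpos hs htr, fun B => ⟨fun ω hω => ?_, fun μ hμp hμ => ?_⟩⟩
  -- The measure does not depend on `ω`: it is the Gaussian one, since both transforms are forced to
  -- be the same function on `ℋ^s ∩ D(H)`.
  · have hp := isProbabilityMeasure_gaussMeasure (B := B) h hβ
    have hk := isKMSMeasure_gaussMeasure (B := B) h hβ
    have h1 : ∀ f ∈ sobolev H s, f ∈ H.domain →
        fourierMeas H s (gaussMeasure B β h) f = ω (weyl f) := fun f hf hd =>
      (fourierMeas_of_isKMSMeasure h hβ.ne' hk hf).trans (hω.apply_weyl hβ.ne' h.inv hd).symm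
    exact ⟨_, hp, hk, h1, fun hc f hf => eqOn_sobolev_of_continuous (B := B) h h1 hc hf⟩
  · exact ⟨existsUnique_extendedState h hβ.ne' hμ, fun ω hω => hω.isWeakKMS h hβ.ne' hμ⟩
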